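/- Let $(\Sigma,g)$ be a compact smooth Riemannian surface with non-empty boundary $\partial\Sigma$, and let $K:\Sigma\to\mathbb R$ and $h:\partial\Sigma\to\mathbb R$ be continuous, with $K\le 0$ on $\Sigma$ and $K<0$ on $\partial\Sigma$. Let $\mathfrak D=h/\sqrt{|K|}$ on $\partial\Sigma$. Then $\mathfrak D_M:=\max_{\partial\Sigma}|\mathfrak D|$ exists, and for every $u\in H^1(\Sigma)$ the functions $|K|e^u$ and $he^{u/2}$ (with the trace of $u$ on the boundary) are integrable on $\Sigma$ and on $\partial\Sigma$ respectively, and $\int_\Sigma|K|e^u>0$. For every $\varepsilon>0$ there is a constant $C_\varepsilon$ such that every $u\in H^1(\Sigma)$ satisfies $$\frac{\left(\int_{\partial\Sigma}he^{u/2}\right)^2}{\int_\Sigma|K|e^u}\le\frac{(\mathfrak D_M+\varepsilon)^2}{4}\int_\Sigma|\nabla u|^2+C_\varepsilon .$$ Moreover the constant $\mathfrak D_M^2/4$ is sharp: for no real number $a<\mathfrak D_M^2/4$ is there a constant $C$ such that $\left(\int_{\partial\Sigma}he^{u/2}\right)^2\big/\int_\Sigma|K|e^u\le a\int_\Sigma|\nabla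 u|^2+C$ for all $u\in H^1(\Sigma)$. Here $H^1(\Sigma)$ is the completion, in the norm $\left(\|u\|_{L^2(\Sigma)}^2+\|\nabla u\|_{L^2(\Sigma)}^2\right)^{1/2}$, of the functions smooth on $\Sigma$ up to the boundary; integrals are with respect to the area of $\Sigma$ and the arclength of $\partial\Sigma$. -/

import Mathlib

open Set Filter MeasureTheory Bundle
open scoped Manifold ContDiff Topology ENNReal RealInnerProductSpace

noncomputable section

namespace SurfaceTrace

/-- The coordinate plane in which the charts of a surface with boundary take their values; the
model is the closed half-plane `{y | 0 ≤ y 0}`, whose boundary line is `{y | y 0 = 0}`. -/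
abbrev Plane : Type := EuclideanSpace ℝ (Fin 2)

section

variable (M : Type*) [TopologicalSpace M] [ChartedSpace (EuclideanHalfSpace 2) M]

/-- The boundary `∂Σ` of a surface with boundary. -/
abbrev bdry : Set M := (𝓡∂ 2).boundary M

end

section

variable {M : Type*} [TopologicalSpace M] [ChartedSpace (EuclideanHalfSpace 2) M]

/-- The coordinate vector field `∂/∂yᵢ` of the chart around `p`, at the point of the surface with
coordinates `y`: the derivative of the inverse chart in the direction `eᵢ`. -/
def coordVec (p : M) (y : Plane) (i : Fin 2) :
    TangentSpace (𝓡∂ 2) ((extChartAt (𝓡∂ 2) p).symm y) :=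
  mfderivWithin 𝓘(ℝ, Plane) (𝓡∂ 2) (extChartAt (𝓡∂ 2) p).symm (range (𝓡∂ 2)) y
    (EuclideanSpace.single i (1 : ℝ) : Plane)

end

section

variable {M : Type*} [TopologicalSpace M] [ChartedSpace (EuclideanHalfSpace 2) M]
  [RiemannianBundle (fun x : M => TangentSpace (𝓡∂ 2) x)]

/-- The area density `√det (gᵢⱼ)` in the chart around `p`, with
`gᵢⱼ = g (∂/∂yᵢ, ∂/∂yⱼ)`. -/
def areaDensity (p : M) (y : Plane) : ℝ :=
  √(Matrix.det (Matrix.of fun i j : Fin 2 => ⟪coordVec p y i, coordVec p y j⟫))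

/-- The Riemannian gradient `∇f` of a real function: the vector field that represents the
differential `df` through the metric. -/
def grad (f : M → ℝ) (x : M) : TangentSpace (𝓡∂ 2) x :=
  haveI : FiniteDimensional ℝ (TangentSpace (𝓡∂ 2) x) :=
    inferInstanceAs (FiniteDimensional ℝ Plane)
  haveI : CompleteSpace (TangentSpace (𝓡∂ 2) x) := FiniteDimensional.complete ℝ _
  (InnerProductSpace.toDual ℝ (TangentSpace (𝓡∂ 2) x)).symm (mfderiv (𝓡∂ 2) 𝓘(ℝ, ℝ) f x)

theorem inner_grad (f : M → ℝ) (x : M) (v : TangentSpace (𝓡∂ 2) x) :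
    ⟪grad f x, v⟫ = (mfderiv (𝓡∂ 2) 𝓘(ℝ, ℝ) f x v : ℝ) := by
  have : FiniteDimensional ℝ (TangentSpace (𝓡∂ 2) x) :=
    inferInstanceAs (FiniteDimensional ℝ Plane)
  have : CompleteSpace (TangentSpace (𝓡∂ 2) x) := FiniteDimensional.complete ℝ _
  exact InnerProductSpace.toDual_symm_apply

variable [MeasurableSpace M]

/-- The Riemannian area on the domain of the chart around `p` (and zero outside): the image under
the inverse chart of `√det (gᵢⱼ) dy`. -/
def chartArea (p : M) : Measure M :=
  (((volume : Measure Plane).restrict (extChartAt (𝓡∂ 2) p).target).withDensity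
    (fun y => ENNReal.ofReal (areaDensity p y))).map (extChartAt (𝓡∂ 2) p).symm

/-- The points of the boundary line of the half-plane. -/
def linePt (t : ℝ) : Plane := !₂[0, t]

/-- The arclength of `∂Σ` on the domain of the chart around `p` (and zero outside): the image under
`t ↦ φ⁻¹ (0, t)` of `|∂/∂y₁| dt`. It is a measure on the surface, carried by the boundary. -/
def chartLength (p : M) : Measure M :=
  (((volume : Measure ℝ).restrict {t | linePt t ∈ (extChartAt (𝓡∂ 2) p).target}).withDensity
    (fun t => ENNReal.ofReal ‖coordVec p (linePt t) 1‖)).map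
      (fun t => (extChartAt (𝓡∂ 2) p).symm (linePt t))

variable (M)

/-- The Riemannian area measure of the surface. By the change of variables formula the measures
`chartArea p` agree on the overlaps of the charts; their supremum is the measure that restricts to
`chartArea p` on the domain of each chart. -/
def area : Measure M := ⨆ p : M, chartArea p

/-- The arclength measure of the boundary, as a measure on the surface carried by `∂Σ`, glued in
the same way from the measures `chartLength p`. -/
def bdryLength : Measure M := ⨆ p : M, chartLength p

variable {M}

/-- The smooth functions `f n` converge to `u` in the `H¹` norm, and the vector field `X` is the
limit of their gradients: `f n → u` in `L²(Σ)` and `∇(f n) → X` in `L²(Σ)`, the length of vectors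
being taken in the Riemannian metric. -/
structure IsH1Limit (f : ℕ → M → ℝ) (u : M → ℝ) (X : ∀ x : M, TangentSpace (𝓡∂ 2) x) :
    Prop where
  smooth : ∀ n, ContMDiff (𝓡∂ 2) 𝓘(ℝ, ℝ) ∞ (f n)
  tendsto_fun : Tendsto (fun n => eLpNorm (fun x => f n x - u x) 2 (area M)) atTop (𝓝 0)
  aestronglyMeasurable : ∀ n, AEStronglyMeasurable (fun x => ‖grad (f n) x - X x‖) (area M)
  tendsto_grad :
    Tendsto (fun n => eLpNorm (fun x => ‖grad (f n) x - X x‖) 2 (area M)) atTop (𝓝 0)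

/-- `u ∈ H¹(Σ)`: the completion in the `H¹` norm of the functions that are smooth on the compact
surface up to its boundary, realised in `L²(Σ)`. -/
def MemH1 (u : M → ℝ) : Prop :=
  MemLp u 2 (area M) ∧ ∃ f X, IsH1Limit f u X

open Classical in
/-- The weak gradient `∇u` of `u ∈ H¹(Σ)` (unique almost everywhere). -/
def weakGrad (u : M → ℝ) : ∀ x : M, TangentSpace (𝓡∂ 2) x :=
  if h : ∃ X, ∃ f, IsH1Limit f u X then h.choose else fun _ => 0

/-- The Dirichlet integral `∫_Σ |∇u|²`. -/
def dirichlet (u : M → ℝ) : ℝ := ∫ x, ‖weakGrad u x‖ ^ 2 ∂(area M)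

/-- `τ ∈ L²(∂Σ)` is the trace of `u`: whenever smooth functions converge to `u` in `H¹(Σ)`, their
restrictions to the boundary converge to `τ` in `L²(∂Σ)`. -/
def IsTrace (u τ : M → ℝ) : Prop :=
  MemLp τ 2 (bdryLength M) ∧ ∀ f X, IsH1Limit f u X →
    Tendsto (fun n => eLpNorm (fun x => f n x - τ x) 2 (bdryLength M)) atTop (𝓝 0)

open Classical in
/-- The boundary values of `u ∈ H¹(Σ)`, a function that is determined almost everywhere with
respect to `bdryLength M`. -/
def trace (u : M → ℝ) : M → ℝ :=
  if h : ∃ τ, IsTrace u τ then h.choose else fun _ => 0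

end

section

variable {M : Type*} [TopologicalSpace M] [ChartedSpace (EuclideanHalfSpace 2) M]

/-- The quotient `𝔇 = h / √|K|` (used on `∂Σ` only). -/
def quot (K h : M → ℝ) (x : M) : ℝ := h x / √|K x|

/-- `𝔇_M`, the largest value of `|𝔇|` on the boundary. -/
def quotMax (K h : M → ℝ) : ℝ := sSup ((fun x => |quot K h x|) '' bdry M)

end

section

variable {M : Type*} [TopologicalSpace M] [ChartedSpace (EuclideanHalfSpace 2) M]
  [RiemannianBundle (fun x : M => TangentSpace (𝓡∂ 2) x)]
  [MeasurableSpace M]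

/-- `∫_Σ |K| e^u`. -/
def curvInt (K u : M → ℝ) : ℝ := ∫ x, |K x| * Real.exp (u x) ∂(area M)

/-- `∫_{∂Σ} h e^{u/2}`, with the trace of `u` on the boundary. -/
def bdryInt (h u : M → ℝ) : ℝ := ∫ x, h x * Real.exp (trace u x / 2) ∂(bdryLength M)

end

end SurfaceTrace

end

/-!
The inequality rests on the trace inequality `∫_{∂Σ} |w| ≤ C ∫_Σ (|∇w| + |w|)`, applied to
`w = e^{u/2}`. Near a boundary point the constant in front of the gradient can be taken as close to
`1` as one likes: in a chart, integrate along the direction `∂₀ + a ∂₁` that is orthogonal to the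
boundary at that point (`exists_nhds_trace_le`). Since `h` and `√|K|` are almost constant in a small
neighbourhood and `|h| ≤ 𝔇_M √|K|` there, a partition of unity gives
`∫_{∂Σ} |h| w ≤ (𝔇_M + ε) ∫_Σ √|K| |∇w| + C ∫_Σ √|K| w` (`exists_weighted_trace_le`). With
`∇w = w ∇u / 2` and the Cauchy-Schwarz inequality this is the claim for smooth `u`
(`exists_smooth_inequality`).

The passage to `H¹` needs three facts. The gradient is closable (`IsH1Limit.ae_eq_zero`), by
integration by parts against test functions in the interior of a chart; hence the weak gradient and
the trace do not depend on the approximating sequence. Exponentials are bounded in `L²` along a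
convergent sequence: the Sobolev inequality `W¹'¹ ⊂ L²`, applied to the powers of a function,
bounds its moments, and with them the exponential series, once its `H¹` norm is small
(`exists_trudinger`); this suffices because the differences of the sequence are small and one of
its members is a bounded function. Finally, `L²` convergence and a bound for `∫ e²ᵛ` allow passage
to the limit in `∫ k eᵛ` (`tendsto_integral_mul_exp`).

For the sharpness, let `|𝔇|` be largest at `x₀ ∈ ∂Σ` and let `ψ = c y₀ + (y₁ - t₀)²` near `x₀`, with
`c` such that `|∇ψ|` is slightly larger than `1` at `x₀`. The functions `u = -2 log (ρ² + ψ)`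
concentrate at `x₀` as `ρ → 0`: integration along the lines `y₁ = t` shows that, up to bounded
terms, `∫_Σ e^u` is at most `L = ∫_{∂Σ} e^{u/2}`, and `∫_Σ |∇u|²` at most slightly more than `4 L`, while
`L → ∞` (`exists_concentrating`). A bound with the constant `a` therefore forces
`h(x₀)² ≤ 4 a |K(x₀)|`. If `𝔇_M = 0` the constant `a` is negative, and such a bound would make
the Dirichlet integral bounded on `H¹`, which the case `K = -1`, `h = 1` excludes.
-/

noncomputable section

namespace SurfaceTrace

set_option linter.unusedSectionVars false

/-! ### Metric coefficients in a chart -/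

section

variable {M : Type*} [TopologicalSpace M] [ChartedSpace (EuclideanHalfSpace 2) M]

/-- The closed half-plane in which the charts take their values. -/
def halfPlane : Set Plane := {y | 0 ≤ y 0}

theorem range_model : range (𝓡∂ 2) = halfPlane := range_modelWithCornersEuclideanHalfSpace 2

theorem isClosed_halfPlane : IsClosed halfPlane :=
  isClosed_le continuous_const (by fun_prop)

theorem uniqueDiffOn_halfPlane : UniqueDiffOn ℝ halfPlane := by
  rw [← range_model]; exact (𝓡∂ 2).uniqueDiffOn

theorem target_subset_halfPlane (p : M) : (extChartAt (𝓡∂ 2) p).target ⊆ halfPlane := by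
  rw [← range_model]; exact extChartAt_target_subset_range p

theorem target_mem_nhdsWithin {p : M} {y : Plane} (hy : y ∈ (extChartAt (𝓡∂ 2) p).target) :
    (extChartAt (𝓡∂ 2) p).target ∈ 𝓝[halfPlane] y := by
  rw [← range_model]; exact extChartAt_target_mem_nhdsWithin_of_mem hy

theorem measurableSet_target (p : M) : MeasurableSet (extChartAt (𝓡∂ 2) p).target := by
  rw [extChartAt_target, range_model]
  exact ((chartAt (EuclideanHalfSpace 2) p).open_target.preimage
    (𝓡∂ 2).continuous_symm).measurableSet.inter isClosed_halfPlane.measurableSet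

/-- The derivative of the inverse chart, as a map of the plane into itself. -/
def invChartDeriv (p : M) (y : Plane) : Plane →L[ℝ] Plane :=
  mfderivWithin 𝓘(ℝ, Plane) (𝓡∂ 2) (extChartAt (𝓡∂ 2) p).symm (range (𝓡∂ 2)) y

/-- A vector of the plane is determined by its coordinates. -/
theorem plane_eq_sum (v : Plane) :
    v = v 0 • EuclideanSpace.single 0 (1 : ℝ) + v 1 • EuclideanSpace.single 1 (1 : ℝ) := by
  ext i; fin_cases i <;> simp

section

variable [IsManifold (𝓡∂ 2) ∞ M]

theorem coordVec_eq_symmL {p : M} {y : Plane} (hy : y ∈ (extChartAt (𝓡∂ 2) p).target)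
    (i : Fin 2) : coordVec p y i =
      (trivializationAt Plane (TangentSpace (𝓡∂ 2)) p).symmL ℝ ((extChartAt (𝓡∂ 2) p).symm y)
        (EuclideanSpace.single i (1 : ℝ) : Plane) := by
  have hx : (extChartAt (𝓡∂ 2) p).symm y ∈ (chartAt (EuclideanHalfSpace 2) p).source := by
    rw [← extChartAt_source (𝓡∂ 2)]; exact (extChartAt (𝓡∂ 2) p).map_target hy
  have h1 := TangentBundle.symmL_trivializationAt (I := 𝓡∂ 2) (x₀ := p) hx
  have h2 := congrArg (fun z => invChartDeriv p z (EuclideanSpace.single i (1 : ℝ) : Plane))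
    ((extChartAt (𝓡∂ 2) p).right_inv hy)
  exact h2.symm.trans (DFunLike.congr_fun h1.symm _)

theorem mfderivWithin_symm_apply (p : M) (y : Plane) (v : Plane) :
    mfderivWithin 𝓘(ℝ, Plane) (𝓡∂ 2) (extChartAt (𝓡∂ 2) p).symm (range (𝓡∂ 2)) y v
      = v 0 • coordVec p y 0 + v 1 • coordVec p y 1 := by
  conv_lhs => rw [plane_eq_sum v]
  exact ((invChartDeriv p y).map_add _ _).trans
    (congrArg₂ (· + ·) ((invChartDeriv p y).map_smul _ _) ((invChartDeriv p y).map_smul _ _))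

theorem coordVec_comb_eq_zero {p : M} {y : Plane} (hy : y ∈ (extChartAt (𝓡∂ 2) p).target)
    {a b : ℝ} (h : a • coordVec p y 0 + b • coordVec p y 1 = 0) : a = 0 ∧ b = 0 := by
  have hinv := isInvertible_mfderivWithin_extChartAt_symm (I := 𝓡∂ 2) hy
  have h' : mfderivWithin 𝓘(ℝ, Plane) (𝓡∂ 2) (extChartAt (𝓡∂ 2) p).symm (range (𝓡∂ 2)) y
      (!₂[a, b] : Plane) = 0 := by
    rw [mfderivWithin_symm_apply]; simpa using h
  have := hinv.injective (h'.trans (ContinuousLinearMap.map_zero _).symm)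
  have e : (!₂[a, b] : Plane) = 0 := this
  have e0 := congrArg (fun v : Plane => v 0) e
  have e1 := congrArg (fun v : Plane => v 1) e
  exact ⟨by simpa using e0, by simpa using e1⟩

theorem coordVec_ne_zero {p : M} {y : Plane} (hy : y ∈ (extChartAt (𝓡∂ 2) p).target)
    (i : Fin 2) : coordVec p y i ≠ 0 := by
  intro h
  fin_cases i
  · have := coordVec_comb_eq_zero hy (a := 1) (b := 0)
      (by rw [one_smul, zero_smul, add_zero]; exact h)
    simp at this
  · have := coordVec_comb_eq_zero hy (a := 0) (b := 1)
      (by rw [one_smul, zero_smul, zero_add]; exact h)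
    simp at this

end

section

variable [RiemannianBundle (fun x : M => TangentSpace (𝓡∂ 2) x)]

/-- The coefficients `gᵢⱼ` of the metric in the chart around `p`. -/
def metricCoeff (p : M) (y : Plane) (i j : Fin 2) : ℝ := ⟪coordVec p y i, coordVec p y j⟫

/-- The determinant of the metric in the chart around `p`. -/
def metricDet (p : M) (y : Plane) : ℝ :=
  metricCoeff p y 0 0 * metricCoeff p y 1 1 - metricCoeff p y 0 1 ^ 2

theorem metricCoeff_comm (p : M) (y : Plane) (i j : Fin 2) :
    metricCoeff p y i j = metricCoeff p y j i := real_inner_comm _ _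

theorem areaDensity_eq (p : M) (y : Plane) : areaDensity p y = √(metricDet p y) := by
  unfold areaDensity metricDet
  rw [Matrix.det_fin_two]
  simp only [Matrix.of_apply]
  congr 1
  rw [sq, ← metricCoeff_comm p y 1 0]; simp only [metricCoeff]
  rw [real_inner_comm (coordVec p y 0) (coordVec p y 1)]

theorem norm_comb_sq (p : M) (y : Plane) (a b : ℝ) :
    ‖a • coordVec p y 0 + b • coordVec p y 1‖ ^ 2 =
      a ^ 2 * metricCoeff p y 0 0 + 2 * (a * b) * metricCoeff p y 0 1
        + b ^ 2 * metricCoeff p y 1 1 := by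
  rw [← real_inner_self_eq_norm_sq]
  simp only [inner_add_left, inner_add_right, real_inner_smul_left, real_inner_smul_right]
  rw [real_inner_comm (coordVec p y 0) (coordVec p y 1)]
  simp only [metricCoeff]; ring

variable [IsManifold (𝓡∂ 2) ∞ M]

theorem metricCoeff_self_pos {p : M} {y : Plane} (hy : y ∈ (extChartAt (𝓡∂ 2) p).target)
    (i : Fin 2) : 0 < metricCoeff p y i i := by
  exact real_inner_self_pos.2 fun h => coordVec_ne_zero hy i h

theorem metricDet_pos {p : M} {y : Plane} (hy : y ∈ (extChartAt (𝓡∂ 2) p).target) :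
    0 < metricDet p y := by
  have h1 := metricCoeff_self_pos hy 1
  have h2 : 0 <
      ‖metricCoeff p y 1 1 • coordVec p y 0 + (-metricCoeff p y 0 1) • coordVec p y 1‖ ^ 2 := by
    refine pow_pos (norm_pos_iff.2 fun h => ?_) 2
    exact h1.ne' (coordVec_comb_eq_zero hy h).1
  rw [norm_comb_sq] at h2
  have : 0 < metricCoeff p y 1 1 * metricDet p y := by unfold metricDet; nlinarith
  exact (pos_iff_pos_of_mul_pos this).1 h1

theorem areaDensity_pos {p : M} {y : Plane} (hy : y ∈ (extChartAt (𝓡∂ 2) p).target) :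
    0 < areaDensity p y := by
  rw [areaDensity_eq]; exact Real.sqrt_pos.2 (metricDet_pos hy)

variable [IsContMDiffRiemannianBundle (𝓡∂ 2) ∞ (EuclideanSpace ℝ (Fin 2))
      (fun x : M => TangentSpace (𝓡∂ 2) x)]

theorem continuousOn_metricCoeff (p : M) (i j : Fin 2) :
    ContinuousOn (fun y => metricCoeff p y i j) (extChartAt (𝓡∂ 2) p).target := by
  have key : ∀ i : Fin 2, ContMDiffOn (𝓡∂ 2) ((𝓡∂ 2).prod 𝓘(ℝ, Plane)) 0
      (fun x : M => (⟨x, (trivializationAt Plane (TangentSpace (𝓡∂ 2)) p).symm x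
        (EuclideanSpace.single i (1 : ℝ) : Plane)⟩ :
          TotalSpace Plane (TangentSpace (𝓡∂ 2) (M := M))))
      (trivializationAt Plane (TangentSpace (𝓡∂ 2)) p).baseSet := by
    intro i
    rw [contMDiffOn_zero_iff]
    have := (trivializationAt Plane (TangentSpace (𝓡∂ 2) (M := M)) p).continuousOn_symm
    exact this.comp (f := fun x : M => (x, (EuclideanSpace.single i (1 : ℝ) : Plane)))
      (by fun_prop) (fun x hx => ⟨hx, mem_univ _⟩)
  have h : ContMDiffOn (𝓡∂ 2) 𝓘(ℝ, ℝ) 0 (fun x : M =>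
      (⟪(trivializationAt Plane (TangentSpace (𝓡∂ 2)) p).symm x
        (EuclideanSpace.single i (1 : ℝ) : Plane),
        (trivializationAt Plane (TangentSpace (𝓡∂ 2)) p).symm x
        (EuclideanSpace.single j (1 : ℝ) : Plane)⟫ : ℝ))
      (trivializationAt Plane (TangentSpace (𝓡∂ 2)) p).baseSet := by
    have : IsContMDiffRiemannianBundle (𝓡∂ 2) 0 Plane (fun x : M => TangentSpace (𝓡∂ 2) x) :=
      IsContMDiffRiemannianBundle.of_le (n := ∞) (by simp)
    exact ContMDiffOn.inner_bundle (key i) (key j)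
  refine ((contMDiffOn_zero_iff.1 h).comp (continuousOn_extChartAt_symm p) ?_).congr ?_
  · intro y hy
    have := (extChartAt (𝓡∂ 2) p).map_target hy
    rw [extChartAt_source] at this
    exact this
  · intro y hy
    simp only [metricCoeff, Function.comp]
    rw [coordVec_eq_symmL hy, coordVec_eq_symmL hy]
    have hb : (extChartAt (𝓡∂ 2) p).symm y ∈
        (trivializationAt Plane (TangentSpace (𝓡∂ 2)) p).baseSet := by
      have := (extChartAt (𝓡∂ 2) p).map_target hy
      rw [extChartAt_source] at this
      exact this
    exact congrArg₂ (fun v w => (⟪v, w⟫ : ℝ)) (Trivialization.symmL_apply _ hb _)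
      (Trivialization.symmL_apply _ hb _)

theorem continuousOn_metricDet (p : M) :
    ContinuousOn (metricDet p) (extChartAt (𝓡∂ 2) p).target :=
  ((continuousOn_metricCoeff p 0 0).mul (continuousOn_metricCoeff p 1 1)).sub
    ((continuousOn_metricCoeff p 0 1).pow 2)

theorem continuousOn_areaDensity (p : M) :
    ContinuousOn (areaDensity p) (extChartAt (𝓡∂ 2) p).target := by
  have : areaDensity p = fun y => √(metricDet p y) := funext (areaDensity_eq p)
  rw [this]
  exact (continuousOn_metricDet p).sqrt

end

end

/-! ### Measures glued from charts -/

section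

/-- Measures `μ p`, carried by sets `U p` and compatible on the overlaps, are the restrictions of
their supremum. -/
theorem iSup_restrict_eq {α ι : Type*} [MeasurableSpace α] {U : ι → Set α}
    (hU : ∀ p, MeasurableSet (U p)) {μ : ι → Measure α} (hμ : ∀ p, (μ p).restrict (U p) = μ p)
    (h : ∀ p q, (μ q).restrict (U p) ≤ μ p) (p : ι) : (⨆ q, μ q).restrict (U p) = μ p := by
  refine le_antisymm ?_ ?_
  · have hle : (⨆ q, μ q) ≤ μ p + (⨆ q, μ q).restrict (U p)ᶜ := by
      refine iSup_le fun q => ?_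
      rw [← Measure.restrict_add_restrict_compl (μ := μ q) (hU p)]
      exact add_le_add (h p q) (Measure.restrict_mono_measure (le_iSup μ q) _)
    calc (⨆ q, μ q).restrict (U p)
        ≤ (μ p + (⨆ q, μ q).restrict (U p)ᶜ).restrict (U p) := Measure.restrict_mono_measure hle _
      _ = μ p := by
        rw [Measure.restrict_add, hμ, Measure.restrict_restrict (hU p)]
        simp
  · conv_lhs => rw [← hμ p]
    exact Measure.restrict_mono_measure (le_iSup μ p) _

/-! ### Change of charts -/

section

variable {M : Type*} [TopologicalSpace M] [ChartedSpace (EuclideanHalfSpace 2) M]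

variable [IsManifold (𝓡∂ 2) ∞ M]

/-- The derivative of the change of charts from `p` to `q` at the point with `p`-coordinates `y`. -/
def transDeriv (p q : M) (y : Plane) : Plane →L[ℝ] Plane :=
  tangentCoordChange (𝓡∂ 2) p q ((extChartAt (𝓡∂ 2) p).symm y)

theorem hasFDerivWithinAt_trans {p q : M} {y : Plane} (hy : y ∈ (extChartAt (𝓡∂ 2) p).target)
    (hq : (extChartAt (𝓡∂ 2) p).symm y ∈ (extChartAt (𝓡∂ 2) q).source) :
    HasFDerivWithinAt (fun z => extChartAt (𝓡∂ 2) q ((extChartAt (𝓡∂ 2) p).symm z))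
      (transDeriv p q y) halfPlane y := by
  have h := hasFDerivWithinAt_tangentCoordChange (I := 𝓡∂ 2) (x := p) (y := q)
    ⟨(extChartAt (𝓡∂ 2) p).map_target hy, hq⟩
  rwa [(extChartAt (𝓡∂ 2) p).right_inv hy, range_model] at h

theorem invChartDeriv_trans {p q : M} {y : Plane} (hy : y ∈ (extChartAt (𝓡∂ 2) p).target)
    (hq : (extChartAt (𝓡∂ 2) p).symm y ∈ (extChartAt (𝓡∂ 2) q).source) (v : Plane) :
    invChartDeriv p y v = invChartDeriv q
      (extChartAt (𝓡∂ 2) q ((extChartAt (𝓡∂ 2) p).symm y)) (transDeriv p q y v) := by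
  set τ : Plane → Plane := fun z => extChartAt (𝓡∂ 2) q ((extChartAt (𝓡∂ 2) p).symm z) with hτ
  have hτy : τ y ∈ (extChartAt (𝓡∂ 2) q).target := (extChartAt (𝓡∂ 2) q).map_source hq
  have h1 : HasMFDerivWithinAt 𝓘(ℝ, Plane) (𝓡∂ 2) (extChartAt (𝓡∂ 2) q).symm (range (𝓡∂ 2)) (τ y)
      (mfderivWithin 𝓘(ℝ, Plane) (𝓡∂ 2) (extChartAt (𝓡∂ 2) q).symm (range (𝓡∂ 2)) (τ y)) :=
    (mdifferentiableWithinAt_extChartAt_symm hτy).hasMFDerivWithinAt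
  have h2 : HasMFDerivWithinAt 𝓘(ℝ, Plane) 𝓘(ℝ, Plane) τ (range (𝓡∂ 2)) y (transDeriv p q y) := by
    have := hasFDerivWithinAt_trans hy hq
    rw [← range_model] at this
    exact this.hasMFDerivWithinAt
  have h3 := h1.comp y h2 (fun z _ => by
    rw [mem_preimage, hτ]; simp [extChartAt])
  have h4 : HasMFDerivWithinAt 𝓘(ℝ, Plane) (𝓡∂ 2) (extChartAt (𝓡∂ 2) p).symm (range (𝓡∂ 2)) y
      (mfderivWithin 𝓘(ℝ, Plane) (𝓡∂ 2) (extChartAt (𝓡∂ 2) p).symm (range (𝓡∂ 2)) y) :=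
    (mdifferentiableWithinAt_extChartAt_symm hy).hasMFDerivWithinAt
  have hev : ((extChartAt (𝓡∂ 2) q).symm ∘ τ) =ᶠ[𝓝[range (𝓡∂ 2)] y] (extChartAt (𝓡∂ 2) p).symm := by
    have hc : ContinuousWithinAt (extChartAt (𝓡∂ 2) p).symm (range (𝓡∂ 2)) y :=
      h4.continuousWithinAt
    filter_upwards [hc.preimage_mem_nhdsWithin
      (isOpen_extChartAt_source q |>.mem_nhds hq)] with z hz
    exact (extChartAt (𝓡∂ 2) q).left_inv hz
  have h5 := h4.congr_of_eventuallyEq hev ((extChartAt (𝓡∂ 2) q).left_inv hq)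
  have hu : UniqueMDiffWithinAt 𝓘(ℝ, Plane) (range (𝓡∂ 2)) y :=
    ((𝓡∂ 2).uniqueDiffOn y (extChartAt_target_subset_range p hy)).uniqueMDiffWithinAt
  exact DFunLike.congr_fun (hu.eq h5 h3) v

theorem det_plane (A : Plane →L[ℝ] Plane) :
    A.det = A (EuclideanSpace.single 0 1) 0 * A (EuclideanSpace.single 1 1) 1
      - A (EuclideanSpace.single 1 1) 0 * A (EuclideanSpace.single 0 1) 1 := by
  rw [ContinuousLinearMap.det, ← LinearMap.det_toMatrix (EuclideanSpace.basisFun (Fin 2) ℝ).toBasis,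
    Matrix.det_fin_two]
  simp [LinearMap.toMatrix_apply]

section

variable [RiemannianBundle (fun x : M => TangentSpace (𝓡∂ 2) x)]

/-- The metric at a point, as a function that also accepts vectors of the coordinate plane, which
is definitionally the tangent space. -/
def metricAt (x : M) (v w : TangentSpace (𝓡∂ 2) x) : ℝ := ⟪v, w⟫

theorem metricAt_comb (x : M) (v w : TangentSpace (𝓡∂ 2) x) (a b c d : ℝ) :
    metricAt x (a • v + b • w) (c • v + d • w) =
      a * c * metricAt x v v + (a * d + b * c) * metricAt x v w + b * d * metricAt x w w := by
  unfold metricAt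
  simp only [inner_add_left, inner_add_right, real_inner_smul_left, real_inner_smul_right]
  rw [real_inner_comm v w]
  ring

theorem metricCoeff_eq_metricAt (p : M) (y : Plane) (i j : Fin 2) :
    metricCoeff p y i j = metricAt ((extChartAt (𝓡∂ 2) p).symm y)
      (invChartDeriv p y (EuclideanSpace.single i 1))
      (invChartDeriv p y (EuclideanSpace.single j 1)) :=
  rfl

/-- The transformation law of the metric coefficients. -/
theorem metricCoeff_trans {p q : M} {y : Plane} (hy : y ∈ (extChartAt (𝓡∂ 2) p).target)
    (hq : (extChartAt (𝓡∂ 2) p).symm y ∈ (extChartAt (𝓡∂ 2) q).source) (i j : Fin 2) :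
    metricCoeff p y i j =
      transDeriv p q y (EuclideanSpace.single i 1) 0 *
          transDeriv p q y (EuclideanSpace.single j 1) 0 *
          metricCoeff q (extChartAt (𝓡∂ 2) q ((extChartAt (𝓡∂ 2) p).symm y)) 0 0
        + (transDeriv p q y (EuclideanSpace.single i 1) 0 *
            transDeriv p q y (EuclideanSpace.single j 1) 1 +
          transDeriv p q y (EuclideanSpace.single i 1) 1 *
            transDeriv p q y (EuclideanSpace.single j 1) 0) *
          metricCoeff q (extChartAt (𝓡∂ 2) q ((extChartAt (𝓡∂ 2) p).symm y)) 0 1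
        + transDeriv p q y (EuclideanSpace.single i 1) 1 *
          transDeriv p q y (EuclideanSpace.single j 1) 1 *
          metricCoeff q (extChartAt (𝓡∂ 2) q ((extChartAt (𝓡∂ 2) p).symm y)) 1 1 := by
  set v := transDeriv p q y (EuclideanSpace.single i 1) with hv
  set w := transDeriv p q y (EuclideanSpace.single j 1) with hw
  set z := extChartAt (𝓡∂ 2) q ((extChartAt (𝓡∂ 2) p).symm y) with hz
  have hx : (extChartAt (𝓡∂ 2) q).symm z = (extChartAt (𝓡∂ 2) p).symm y :=
    (extChartAt (𝓡∂ 2) q).left_inv hq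
  have e : ∀ u : Plane, invChartDeriv q z u =
      u 0 • invChartDeriv q z (EuclideanSpace.single 0 1)
        + u 1 • invChartDeriv q z (EuclideanSpace.single 1 1) := fun u => by
    conv_lhs => rw [plane_eq_sum u]
    rw [map_add, map_smul, map_smul]
  simp only [metricCoeff_eq_metricAt]
  rw [invChartDeriv_trans hy hq, invChartDeriv_trans hy hq, ← hz, ← hv, ← hw, hx, e v, e w]
  exact metricAt_comb _ _ _ _ _ _ _

theorem metricDet_trans {p q : M} {y : Plane} (hy : y ∈ (extChartAt (𝓡∂ 2) p).target)
    (hq : (extChartAt (𝓡∂ 2) p).symm y ∈ (extChartAt (𝓡∂ 2) q).source) :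
    metricDet p y = (transDeriv p q y).det ^ 2 *
      metricDet q (extChartAt (𝓡∂ 2) q ((extChartAt (𝓡∂ 2) p).symm y)) := by
  unfold metricDet
  rw [metricCoeff_trans hy hq, metricCoeff_trans hy hq, metricCoeff_trans hy hq, det_plane]
  ring

theorem areaDensity_trans {p q : M} {y : Plane} (hy : y ∈ (extChartAt (𝓡∂ 2) p).target)
    (hq : (extChartAt (𝓡∂ 2) p).symm y ∈ (extChartAt (𝓡∂ 2) q).source) :
    areaDensity p y = |(transDeriv p q y).det| *
      areaDensity q (extChartAt (𝓡∂ 2) q ((extChartAt (𝓡∂ 2) p).symm y)) := by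
  rw [areaDensity_eq, areaDensity_eq, metricDet_trans hy hq, Real.sqrt_mul (sq_nonneg _),
    Real.sqrt_sq_eq_abs]

end

end

end

/-! ### The area and the arclength in a chart -/

section

variable {M : Type*} [TopologicalSpace M] [ChartedSpace (EuclideanHalfSpace 2) M]

theorem measurableSet_inter_preimage {α β : Type*} [TopologicalSpace α] [MeasurableSpace α]
    [BorelSpace α] [TopologicalSpace β] [MeasurableSpace β] [BorelSpace β] {f : α → β} {T : Set α}
    (hf : ContinuousOn f T) (hT : MeasurableSet T) {A : Set β} (hA : MeasurableSet A) :
    MeasurableSet (T ∩ f ⁻¹' A) := by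
  rw [← Subtype.image_preimage_coe]
  exact hT.subtype_image (hf.domRestrict.measurable hA)

theorem setLIntegral_mul_indicator_comp {α β : Type*} [MeasurableSpace α] {μ : Measure α}
    {T : Set α} {f : α → β} {A : Set β} (hT : MeasurableSet T)
    (hTA : MeasurableSet (T ∩ f ⁻¹' A)) (g : α → ℝ≥0∞) :
    ∫⁻ y in T, g y * A.indicator 1 (f y) ∂μ = ∫⁻ y in T ∩ f ⁻¹' A, g y ∂μ := by
  rw [← lintegral_indicator hT, ← lintegral_indicator hTA]
  congr 1 with y
  by_cases h1 : y ∈ T <;> by_cases h2 : f y ∈ A <;> simp [h1, h2]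

theorem continuous_linePt : Continuous linePt := by
  unfold linePt
  fun_prop

theorem linePt_add (t s : ℝ) : linePt (t + s) = linePt t + s • EuclideanSpace.single 1 (1 : ℝ) := by
  ext i; fin_cases i <;> simp [linePt]

theorem linePt_mem_halfPlane (t : ℝ) : linePt t ∈ halfPlane := by simp [linePt, halfPlane]

theorem eq_linePt {y : Plane} (hy : y 0 = 0) : y = linePt (y 1) := by
  ext i; fin_cases i <;> simp [linePt, hy]

/-- The parameters of the boundary line that belong to the chart around `p`. -/
def lineSet (p : M) : Set ℝ := {t | linePt t ∈ (extChartAt (𝓡∂ 2) p).target}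

theorem measurableSet_lineSet (p : M) : MeasurableSet (lineSet p) :=
  continuous_linePt.measurable (measurableSet_target p)

theorem continuousOn_symm_linePt (p : M) :
    ContinuousOn (fun t => (extChartAt (𝓡∂ 2) p).symm (linePt t)) (lineSet p) :=
  (continuousOn_extChartAt_symm p).comp continuous_linePt.continuousOn fun _ h => h

/-- Membership of the boundary is read off in any chart. -/
theorem mem_bdry_iff [IsManifold (𝓡∂ 2) ∞ M] {p x : M} (hx : x ∈ (extChartAt (𝓡∂ 2) p).source) :
    x ∈ bdry M ↔ extChartAt (𝓡∂ 2) p x 0 = 0 := by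
  have hxs : x ∈ (chartAt (EuclideanHalfSpace 2) p).source := by rwa [← extChartAt_source (𝓡∂ 2)]
  have hi := ModelWithCorners.isInteriorPoint_iff_of_mem_atlas (I := 𝓡∂ 2) (n := ∞) (by simp)
    (chart_mem_atlas (EuclideanHalfSpace 2) p) hxs
  have h0 : 0 ≤ extChartAt (𝓡∂ 2) p x 0 :=
    target_subset_halfPlane p ((extChartAt (𝓡∂ 2) p).map_source hx)
  have hint : x ∈ (𝓡∂ 2).interior M ↔ 0 < extChartAt (𝓡∂ 2) p x 0 := by
    refine hi.trans ⟨fun h => ?_, fun h => ?_⟩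
    · have h' := interior_mono ((chartAt (EuclideanHalfSpace 2) p).extend_target_subset_range) h
      rw [interior_range_modelWithCornersEuclideanHalfSpace] at h'
      exact h'
    · refine (chartAt (EuclideanHalfSpace 2) p).mem_interior_extend_target
        ((chartAt (EuclideanHalfSpace 2) p).map_source hxs) ?_
      rw [interior_range_modelWithCornersEuclideanHalfSpace]
      exact h
  have hc : x ∈ bdry M ↔ x ∉ (𝓡∂ 2).interior M := by
    rw [← mem_compl_iff, ModelWithCorners.compl_interior]
  rw [hc, hint]
  exact ⟨fun h => le_antisymm (not_lt.1 h) h0, fun h => h.not_gt⟩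

variable [RiemannianBundle (fun x : M => TangentSpace (𝓡∂ 2) x)]

/-- The length density `|∂/∂y₁|` along the boundary line in the chart around `p`. -/
def lengthDensity (p : M) (t : ℝ) : ℝ := √(metricCoeff p (linePt t) 1 1)

theorem lengthDensity_eq (p : M) (t : ℝ) : lengthDensity p t = ‖coordVec p (linePt t) 1‖ :=
  (norm_eq_sqrt_real_inner (coordVec p (linePt t) 1)).symm

variable [IsManifold (𝓡∂ 2) ∞ M] [IsContMDiffRiemannianBundle (𝓡∂ 2) ∞ (EuclideanSpace ℝ (Fin 2))
      (fun x : M => TangentSpace (𝓡∂ 2) x)]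

theorem continuousOn_lengthDensity (p : M) : ContinuousOn (lengthDensity p) (lineSet p) :=
  (((continuousOn_metricCoeff p 1 1).comp continuous_linePt.continuousOn fun _ h => h)).sqrt

variable [MeasurableSpace M] [BorelSpace M]

theorem lintegral_chartArea (p : M) {F : M → ℝ≥0∞} (hF : Measurable F) :
    ∫⁻ x, F x ∂(chartArea p) = ∫⁻ y in (extChartAt (𝓡∂ 2) p).target,
      ENNReal.ofReal (areaDensity p y) * F ((extChartAt (𝓡∂ 2) p).symm y) := by
  have h1 : AEMeasurable (extChartAt (𝓡∂ 2) p).symm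
      ((volume : Measure Plane).restrict (extChartAt (𝓡∂ 2) p).target) :=
    (continuousOn_extChartAt_symm p).aemeasurable (measurableSet_target p)
  have h2 : AEMeasurable (fun y => ENNReal.ofReal (areaDensity p y))
      ((volume : Measure Plane).restrict (extChartAt (𝓡∂ 2) p).target) :=
    ((continuousOn_areaDensity p).aemeasurable (measurableSet_target p)).ennreal_ofReal
  unfold chartArea
  rw [lintegral_map' hF.aemeasurable (h1.mono_ac (withDensity_absolutelyContinuous _ _)),
    lintegral_withDensity_eq_lintegral_mul₀ h2
      (g := fun a => F ((extChartAt (𝓡∂ 2) p).symm a)) (hF.comp_aemeasurable h1)]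
  rfl

theorem lintegral_chartLength (p : M) {F : M → ℝ≥0∞} (hF : Measurable F) :
    ∫⁻ x, F x ∂(chartLength p) = ∫⁻ t in lineSet p,
      ENNReal.ofReal (lengthDensity p t) * F ((extChartAt (𝓡∂ 2) p).symm (linePt t)) := by
  have h1 : AEMeasurable (fun t => (extChartAt (𝓡∂ 2) p).symm (linePt t))
      ((volume : Measure ℝ).restrict (lineSet p)) :=
    (continuousOn_symm_linePt p).aemeasurable (measurableSet_lineSet p)
  have h2 : AEMeasurable (fun t => ENNReal.ofReal (lengthDensity p t))
      ((volume : Measure ℝ).restrict (lineSet p)) :=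
    ((continuousOn_lengthDensity p).aemeasurable (measurableSet_lineSet p)).ennreal_ofReal
  have e : chartLength p = (((volume : Measure ℝ).restrict (lineSet p)).withDensity
      (fun t => ENNReal.ofReal (lengthDensity p t))).map
        (fun t => (extChartAt (𝓡∂ 2) p).symm (linePt t)) := by
    simp only [lengthDensity_eq]; rfl
  rw [e, lintegral_map' hF.aemeasurable (h1.mono_ac (withDensity_absolutelyContinuous _ _)),
    lintegral_withDensity_eq_lintegral_mul₀ h2
      (g := fun a => F ((extChartAt (𝓡∂ 2) p).symm (linePt a))) (hF.comp_aemeasurable h1)]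
  rfl

theorem measurableSet_source (p : M) : MeasurableSet (extChartAt (𝓡∂ 2) p).source :=
  (isOpen_extChartAt_source p).measurableSet

theorem chartArea_apply (p : M) {A : Set M} (hA : MeasurableSet A) :
    chartArea p A = ∫⁻ y in (extChartAt (𝓡∂ 2) p).target ∩ (extChartAt (𝓡∂ 2) p).symm ⁻¹' A,
      ENNReal.ofReal (areaDensity p y) := by
  rw [← lintegral_indicator_one hA, lintegral_chartArea p (measurable_one.indicator hA)]
  exact setLIntegral_mul_indicator_comp (measurableSet_target p) (measurableSet_inter_preimage
    (continuousOn_extChartAt_symm p) (measurableSet_target p) hA) _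

theorem chartLength_apply (p : M) {A : Set M} (hA : MeasurableSet A) :
    chartLength p A = ∫⁻ t in lineSet p ∩ (fun t => (extChartAt (𝓡∂ 2) p).symm (linePt t)) ⁻¹' A,
      ENNReal.ofReal (lengthDensity p t) := by
  rw [← lintegral_indicator_one hA, lintegral_chartLength p (measurable_one.indicator hA)]
  exact setLIntegral_mul_indicator_comp (measurableSet_lineSet p) (measurableSet_inter_preimage
    (continuousOn_symm_linePt p) (measurableSet_lineSet p) hA) _

theorem chartArea_restrict_source (p : M) :
    (chartArea p).restrict (extChartAt (𝓡∂ 2) p).source = chartArea p := by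
  rw [Measure.restrict_eq_self_of_ae_mem]
  rw [ae_iff, show {a | a ∉ (extChartAt (𝓡∂ 2) p).source} = (extChartAt (𝓡∂ 2) p).sourceᶜ from rfl,
    chartArea_apply p (measurableSet_source p).compl]
  convert! setLIntegral_empty _
  rw [eq_empty_iff_forall_notMem]
  exact fun y hy => hy.2 ((extChartAt (𝓡∂ 2) p).map_target hy.1)

theorem chartLength_restrict_source (p : M) :
    (chartLength p).restrict (extChartAt (𝓡∂ 2) p).source = chartLength p := by
  rw [Measure.restrict_eq_self_of_ae_mem]
  rw [ae_iff, show {a | a ∉ (extChartAt (𝓡∂ 2) p).source} = (extChartAt (𝓡∂ 2) p).sourceᶜ from rfl,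
    chartLength_apply p (measurableSet_source p).compl]
  convert! setLIntegral_empty _
  rw [eq_empty_iff_forall_notMem]
  exact fun y hy => hy.2 ((extChartAt (𝓡∂ 2) p).map_target hy.1)

theorem chartArea_restrict_le (p q : M) :
    (chartArea q).restrict (extChartAt (𝓡∂ 2) p).source ≤ chartArea p := by
  refine Measure.le_iff.2 fun A hA => ?_
  set φ := extChartAt (𝓡∂ 2) p with hφ
  set ψ := extChartAt (𝓡∂ 2) q with hψ
  rw [Measure.restrict_apply hA, chartArea_apply q (hA.inter (measurableSet_source p)),
    chartArea_apply p hA]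
  set S := φ.target ∩ φ.symm ⁻¹' (A ∩ ψ.source) with hS
  have hSm : MeasurableSet S := measurableSet_inter_preimage (continuousOn_extChartAt_symm p)
    (measurableSet_target p) (hA.inter (measurableSet_source q))
  have hSd : ∀ y ∈ S, HasFDerivWithinAt (fun z => ψ (φ.symm z)) (transDeriv p q y) S y :=
    fun y hy => (hasFDerivWithinAt_trans hy.1 hy.2.2).mono fun z hz =>
      target_subset_halfPlane p hz.1
  have hinj : InjOn (fun z => ψ (φ.symm z)) S := fun y hy z hz h =>
    φ.symm.injOn hy.1 hz.1 (ψ.injOn hy.2.2 hz.2.2 h)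
  have himg : (fun z => ψ (φ.symm z)) '' S = ψ.target ∩ ψ.symm ⁻¹' (A ∩ φ.source) := by
    ext z
    constructor
    · rintro ⟨y, hy, rfl⟩
      refine ⟨ψ.map_source hy.2.2, ?_⟩
      simp only [mem_preimage, ψ.left_inv hy.2.2]
      exact ⟨hy.2.1, φ.map_target hy.1⟩
    · rintro ⟨hz, hzA, hzs⟩
      refine ⟨φ (ψ.symm z), ⟨φ.map_source hzs, ?_⟩, ?_⟩
      · rw [mem_preimage, φ.left_inv hzs]
        exact ⟨hzA, ψ.map_target hz⟩
      · simp only [φ.left_inv hzs, ψ.right_inv hz]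
  rw [← himg, lintegral_image_eq_lintegral_abs_det_fderiv_mul volume hSm hSd hinj]
  calc _ = ∫⁻ y in S, ENNReal.ofReal (areaDensity p y) := by
        refine setLIntegral_congr_fun hSm fun y hy => ?_
        rw [areaDensity_trans hy.1 hy.2.2, ENNReal.ofReal_mul (abs_nonneg _)]
    _ ≤ _ := lintegral_mono_set (inter_subset_inter_right _ (preimage_mono inter_subset_left))

theorem chartLength_restrict_le (p q : M) :
    (chartLength q).restrict (extChartAt (𝓡∂ 2) p).source ≤ chartLength p := by
  refine Measure.le_iff.2 fun A hA => ?_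
  set φ := extChartAt (𝓡∂ 2) p with hφ
  set ψ := extChartAt (𝓡∂ 2) q with hψ
  rw [Measure.restrict_apply hA, chartLength_apply q (hA.inter (measurableSet_source p)),
    chartLength_apply p hA]
  set S := lineSet p ∩ (fun t => φ.symm (linePt t)) ⁻¹' (A ∩ ψ.source) with hS
  have hSm : MeasurableSet S := measurableSet_inter_preimage (continuousOn_symm_linePt p)
    (measurableSet_lineSet p) (hA.inter (measurableSet_source q))
  set τ : Plane → Plane := fun z => ψ (φ.symm z) with hτ
  -- the change of charts preserves the boundary line
  have hτ0 : ∀ t ∈ lineSet p, φ.symm (linePt t) ∈ ψ.source → τ (linePt t) 0 = 0 := fun t ht hs => by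
    rw [hτ]
    refine (mem_bdry_iff hs).1 ((mem_bdry_iff (φ.map_target ht)).2 ?_)
    rw [φ.right_inv ht]; simp [linePt]
  have hline : ∀ t ∈ lineSet p, φ.symm (linePt t) ∈ ψ.source →
      HasDerivAt (fun s => τ (linePt s))
        (transDeriv p q (linePt t) (EuclideanSpace.single 1 1)) t := by
    intro t ht hs
    have h1 : HasDerivWithinAt linePt (EuclideanSpace.single 1 1) univ t := by
      have : HasDerivAt (fun s : ℝ => linePt t + (s - t) • EuclideanSpace.single 1 (1 : ℝ))
          ((1 : ℝ) • EuclideanSpace.single 1 (1 : ℝ)) t :=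
        (((hasDerivAt_id t).sub_const t).smul_const _).const_add _
      rw [one_smul] at this
      refine (this.congr_of_eventuallyEq (Eventually.of_forall fun s => ?_)).hasDerivWithinAt
      simp only [← linePt_add, add_sub_cancel]
    exact hasDerivWithinAt_univ.1 ((hasFDerivWithinAt_trans ht hs).comp_hasDerivWithinAt t h1
      fun s _ => linePt_mem_halfPlane s)
  have hcoord : ∀ t ∈ lineSet p, φ.symm (linePt t) ∈ ψ.source → ∀ i : Fin 2,
      HasDerivAt (fun s => τ (linePt s) i)
        (transDeriv p q (linePt t) (EuclideanSpace.single 1 1) i) t :=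
    fun t ht hs i =>
      ((EuclideanSpace.proj i : Plane →L[ℝ] ℝ).hasFDerivAt.comp_hasDerivAt t (hline t ht hs))
  have hzero : ∀ t ∈ S, transDeriv p q (linePt t) (EuclideanSpace.single 1 1) 0 = 0 := by
    intro t ht
    have hev : ∀ᶠ s in 𝓝 t, τ (linePt s) 0 = 0 := by
      have h1 : ∀ᶠ z in 𝓝[halfPlane] (linePt t), z ∈ φ.target ∧ φ.symm z ∈ ψ.source := by
        have hc : ContinuousWithinAt φ.symm halfPlane (linePt t) :=
          ((continuousOn_extChartAt_symm p) _ ht.1).mono_of_mem_nhdsWithin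
            (target_mem_nhdsWithin ht.1)
        exact (target_mem_nhdsWithin ht.1 : φ.target ∈ _) |> fun h => Filter.Eventually.and h
          (hc.preimage_mem_nhdsWithin ((isOpen_extChartAt_source q).mem_nhds ht.2.2))
      have h2 : Tendsto linePt (𝓝 t) (𝓝[halfPlane] (linePt t)) :=
        tendsto_nhdsWithin_iff.2 ⟨continuous_linePt.continuousAt,
          Eventually.of_forall linePt_mem_halfPlane⟩
      filter_upwards [h2.eventually h1] with s hs using hτ0 s hs.1 hs.2
    exact (hcoord t ht.1 ht.2.2 0).unique
      ((hasDerivAt_const t (0 : ℝ)).congr_of_eventuallyEq hev)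
  have hinj : InjOn (fun t => τ (linePt t) 1) S := fun s hs t ht h => by
    have h' : τ (linePt s) = τ (linePt t) := by
      rw [eq_linePt (hτ0 s hs.1 hs.2.2), eq_linePt (hτ0 t ht.1 ht.2.2)]; exact congrArg linePt h
    have := φ.symm.injOn hs.1 ht.1 (ψ.injOn hs.2.2 ht.2.2 h')
    simpa [linePt] using congrArg (fun z : Plane => z 1) this
  have himg : (fun t => τ (linePt t) 1) '' S =
      lineSet q ∩ (fun t => ψ.symm (linePt t)) ⁻¹' (A ∩ φ.source) := by
    ext z
    constructor
    · rintro ⟨t, ht, rfl⟩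
      have e : linePt (τ (linePt t) 1) = τ (linePt t) := (eq_linePt (hτ0 t ht.1 ht.2.2)).symm
      refine ⟨?_, ?_⟩
      · show linePt (τ (linePt t) 1) ∈ ψ.target
        rw [e]; exact ψ.map_source ht.2.2
      · show ψ.symm (linePt (τ (linePt t) 1)) ∈ A ∩ φ.source
        rw [e, hτ]
        simp only [ψ.left_inv ht.2.2]
        exact ⟨ht.2.1, φ.map_target ht.1⟩
    · rintro ⟨hz, hzA, hzs⟩
      have hb : φ (ψ.symm (linePt z)) 0 = 0 := by
        refine (mem_bdry_iff hzs).1 ((mem_bdry_iff (ψ.map_target hz)).2 ?_)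
        rw [ψ.right_inv hz]; simp [linePt]
      have e : linePt (φ (ψ.symm (linePt z)) 1) = φ (ψ.symm (linePt z)) := (eq_linePt hb).symm
      refine ⟨φ (ψ.symm (linePt z)) 1, ⟨?_, ?_⟩, ?_⟩
      · show linePt (φ (ψ.symm (linePt z)) 1) ∈ φ.target
        rw [e]; exact φ.map_source hzs
      · show φ.symm (linePt (φ (ψ.symm (linePt z)) 1)) ∈ A ∩ ψ.source
        rw [e, φ.left_inv hzs]; exact ⟨hzA, ψ.map_target hz⟩
      · simp only [e, hτ, φ.left_inv hzs, ψ.right_inv hz]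
        simp [linePt]
  rw [← himg, lintegral_image_eq_lintegral_abs_deriv_mul hSm
    (fun t ht => (hcoord t ht.1 ht.2.2 1).hasDerivWithinAt) hinj]
  calc _ = ∫⁻ t in S, ENNReal.ofReal (lengthDensity p t) := by
        refine setLIntegral_congr_fun hSm fun t ht => ?_
        have e : linePt (τ (linePt t) 1) = τ (linePt t) := (eq_linePt (hτ0 t ht.1 ht.2.2)).symm
        simp only []
        rw [← ENNReal.ofReal_mul (abs_nonneg _)]
        congr 1
        unfold lengthDensity
        rw [e, metricCoeff_trans ht.1 ht.2.2, hzero t ht, ← Real.sqrt_sq_eq_abs,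
          ← Real.sqrt_mul (sq_nonneg _)]
        congr 1
        simp only [hτ]; ring
    _ ≤ _ := lintegral_mono_set (inter_subset_inter_right _ (preimage_mono inter_subset_left))

/-- The area measure restricts to the chart area on the domain of a chart. -/
theorem area_restrict_source (p : M) :
    (area M).restrict (extChartAt (𝓡∂ 2) p).source = chartArea p :=
  iSup_restrict_eq measurableSet_source chartArea_restrict_source chartArea_restrict_le p

/-- The arclength measure restricts to the chart arclength on the domain of a chart. -/
theorem bdryLength_restrict_source (p : M) :
    (bdryLength M).restrict (extChartAt (𝓡∂ 2) p).source = chartLength p :=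
  iSup_restrict_eq measurableSet_source chartLength_restrict_source chartLength_restrict_le p

theorem isClosed_bdry : IsClosed (bdry M) := ModelWithCorners.isClosed_boundary (n := ∞) (by simp)

/-- The arclength measure is carried by the boundary. -/
theorem bdryLength_restrict_bdry : (bdryLength M).restrict (bdry M) = bdryLength M := by
  refine le_antisymm Measure.restrict_le_self (iSup_le fun p => ?_)
  have : (chartLength p).restrict (bdry M) = chartLength p := by
    rw [Measure.restrict_eq_self_of_ae_mem]
    rw [ae_iff, show {a | a ∉ bdry M} = (bdry M)ᶜ from rfl,
      chartLength_apply p isClosed_bdry.measurableSet.compl]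
    convert! setLIntegral_empty _
    rw [eq_empty_iff_forall_notMem]
    intro t ht
    refine ht.2 ((mem_bdry_iff ((extChartAt (𝓡∂ 2) p).map_target ht.1)).2 ?_)
    rw [(extChartAt (𝓡∂ 2) p).right_inv ht.1]; simp [linePt]
  rw [← this]
  exact Measure.restrict_mono_measure (le_iSup chartLength p) _

end

/-! ### Inequalities on the half-plane -/

section

theorem measurable_indicator_of_continuousOn {α : Type*} [TopologicalSpace α] [MeasurableSpace α]
    [BorelSpace α] {f : α → ℝ≥0∞} {T : Set α} (hf : ContinuousOn f T) (hT : MeasurableSet T) :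
    Measurable (T.indicator f) := by
  classical
  rw [← piecewise_eq_indicator]
  exact hf.measurable_piecewise continuousOn_const hT

/-- The point with coordinates `(s, t)`. -/
def pt (z : ℝ × ℝ) : Plane := !₂[z.1, z.2]

theorem continuous_pt : Continuous pt := by unfold pt; fun_prop

theorem measurePreserving_pt : MeasurePreserving pt volume volume :=
  (EuclideanSpace.volume_preserving_symm_measurableEquiv_toLp (Fin 2)).symm.comp
    (volume_preserving_finTwoArrow ℝ).symm

theorem lintegral_plane {F : Plane → ℝ≥0∞} (hF : Measurable F) :
    ∫⁻ y, F y = ∫⁻ s, ∫⁻ t, F (pt (s, t)) := by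
  rw [← measurePreserving_pt.lintegral_comp hF, Measure.volume_eq_prod,
    lintegral_prod (fun z => F (pt z)) (hF.comp continuous_pt.measurable).aemeasurable]

theorem pt_add_smul (s t a b r : ℝ) :
    pt (s, t) + r • pt (a, b) = pt (s + r * a, t + r * b) := by
  ext i; fin_cases i <;> simp [pt]

theorem enorm_le_lintegral_deriv {g g' : ℝ → ℝ} {R : ℝ}
    (hg : ∀ s, 0 ≤ s → HasDerivWithinAt g (g' s) (Ici 0) s) (hg' : ContinuousOn g' (Ici 0))
    (hR : ∀ s, R ≤ s → g s = 0) : ‖g 0‖ₑ ≤ ∫⁻ s in Ici 0, ‖g' s‖ₑ := by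
  have hb : (0 : ℝ) ≤ max R 0 := le_max_right _ _
  have h1 : ∫ s in (0 : ℝ)..(max R 0), g' s = g (max R 0) - g 0 := by
    refine intervalIntegral.integral_eq_sub_of_hasDerivAt_of_le hb
      (fun s hs => ((hg s hs.1).continuousWithinAt).mono Icc_subset_Ici_self)
      (fun s hs => (hg s hs.1.le).hasDerivAt (Ici_mem_nhds hs.1)) ?_
    exact (hg'.mono (by rw [uIcc_of_le hb]; exact Icc_subset_Ici_self)).intervalIntegrable
  rw [hR _ (le_max_left _ _), zero_sub, intervalIntegral.integral_of_le hb] at h1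
  calc ‖g 0‖ₑ = ‖∫ s in Ioc 0 (max R 0), g' s‖ₑ := by rw [h1, enorm_neg]
    _ ≤ ∫⁻ s in Ioc 0 (max R 0), ‖g' s‖ₑ := enorm_integral_le_lintegral_enorm _
    _ ≤ _ := lintegral_mono_set fun s hs => hs.1.le

/-- A compactly supported function that is continuously differentiable up to the boundary of the
half-plane. Only its values on the half-plane matter. -/
structure IsTestFun (G : Plane → ℝ) : Prop where
  contDiffOn : ContDiffOn ℝ 1 G halfPlane
  bounded_support : ∃ R, ∀ y ∈ halfPlane, R ≤ ‖y‖ → G y = 0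

variable {G : Plane → ℝ}

theorem IsTestFun.hasFDerivWithinAt (hG : IsTestFun G) {y : Plane} (hy : y ∈ halfPlane) :
    HasFDerivWithinAt G (fderivWithin ℝ G halfPlane y) halfPlane y :=
  ((hG.contDiffOn.differentiableOn one_ne_zero) y hy).hasFDerivWithinAt

theorem IsTestFun.continuousOn_fderiv (hG : IsTestFun G) (n : Plane) :
    ContinuousOn (fun y => fderivWithin ℝ G halfPlane y n) halfPlane :=
  (hG.contDiffOn.continuousOn_fderivWithin uniqueDiffOn_halfPlane le_rfl).clm_apply
    continuousOn_const

theorem IsTestFun.enorm_le_lintegral_ray (hG : IsTestFun G) {y n : Plane} (hy : y ∈ halfPlane)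
    (hn : 0 ≤ n 0) (hn0 : n ≠ 0) :
    ‖G y‖ₑ ≤ ∫⁻ s in Ici (0 : ℝ), ‖fderivWithin ℝ G halfPlane (y + s • n) n‖ₑ := by
  obtain ⟨R, hR⟩ := hG.bounded_support
  have hmem : ∀ s : ℝ, 0 ≤ s → y + s • n ∈ halfPlane := fun s hs => by
    have h0 : 0 ≤ y 0 := hy
    show 0 ≤ (y + s • n) 0
    simpa using add_nonneg h0 (mul_nonneg hs hn)
  have hnn : 0 < ‖n‖ := norm_pos_iff.2 hn0
  have key := enorm_le_lintegral_deriv (g := fun s : ℝ => G (y + s • n))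
    (g' := fun s => fderivWithin ℝ G halfPlane (y + s • n) n) (R := max 0 ((R + ‖y‖) / ‖n‖))
    (fun s hs => by
      have h1 : HasDerivWithinAt (fun s : ℝ => y + s • n) n (Ici 0) s := by
        simpa using (((hasDerivAt_id s).smul_const n).const_add y).hasDerivWithinAt
      exact (hG.hasFDerivWithinAt (hmem s hs)).comp_hasDerivWithinAt s h1 hmem)
    ((hG.continuousOn_fderiv n).comp (by fun_prop) hmem)
    (fun s hs => by
      have hs0 : 0 ≤ s := (le_max_left _ _).trans hs
      have hs1 : (R + ‖y‖) / ‖n‖ ≤ s := (le_max_right _ _).trans hs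
      refine hR _ (hmem s hs0) ?_
      rw [div_le_iff₀ hnn] at hs1
      have h2 : ‖s • n‖ ≤ ‖y + s • n‖ + ‖y‖ := by
        have := norm_sub_le (y + s • n) y
        simpa using this
      rw [norm_smul, Real.norm_of_nonneg hs0] at h2
      linarith)
  simpa using key

/-- The size of the derivative of `G` in the direction `n`, extended by zero. -/
def dirDeriv (G : Plane → ℝ) (n y : Plane) : ℝ≥0∞ :=
  halfPlane.indicator (fun y => ‖fderivWithin ℝ G halfPlane y n‖ₑ) y

theorem IsTestFun.measurable_dirDeriv (hG : IsTestFun G) (n : Plane) :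
    Measurable (dirDeriv G n) := by
  have h := (hG.continuousOn_fderiv n).enorm
  exact measurable_indicator_of_continuousOn h isClosed_halfPlane.measurableSet

theorem IsTestFun.enorm_le_lintegral_dirDeriv (hG : IsTestFun G) {y n : Plane}
    (hy : y ∈ halfPlane) (hn : 0 ≤ n 0) (hn0 : n ≠ 0) :
    ‖G y‖ₑ ≤ ∫⁻ s : ℝ, dirDeriv G n (y + s • n) := by
  refine (hG.enorm_le_lintegral_ray hy hn hn0).trans ?_
  rw [← lintegral_indicator measurableSet_Ici]
  refine lintegral_mono fun s => ?_
  by_cases hs : s ∈ Ici (0 : ℝ)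
  · have : y + s • n ∈ halfPlane := by
      have h0 : 0 ≤ y 0 := hy
      show 0 ≤ (y + s • n) 0
      simpa using add_nonneg h0 (mul_nonneg hs hn)
    simp [hs, dirDeriv, this]
  · simp [hs]

/-- The trace inequality on the half-plane, with an oblique derivative. -/
theorem IsTestFun.lintegral_line_le (hG : IsTestFun G) (a : ℝ) :
    ∫⁻ t, ‖G (linePt t)‖ₑ ≤ ∫⁻ y in halfPlane, ‖fderivWithin ℝ G halfPlane y (pt (1, a))‖ₑ := by
  have hm := hG.measurable_dirDeriv (pt (1, a))
  have hn0 : pt (1, a) ≠ 0 := fun h => by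
    simpa [pt] using congrArg (fun v : Plane => v 0) h
  calc ∫⁻ t, ‖G (linePt t)‖ₑ
      ≤ ∫⁻ t, ∫⁻ s, dirDeriv G (pt (1, a)) (pt (s, t + s * a)) := by
        refine lintegral_mono fun t => ?_
        refine (hG.enorm_le_lintegral_dirDeriv (linePt_mem_halfPlane t) (by simp [pt]) hn0).trans
          (le_of_eq ?_)
        refine lintegral_congr fun s => ?_
        rw [show linePt t = pt (0, t) from rfl, pt_add_smul]; simp
    _ = ∫⁻ s, ∫⁻ t, dirDeriv G (pt (1, a)) (pt (s, t + s * a)) := by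
        refine lintegral_lintegral_swap ?_
        refine (hm.comp (continuous_pt.measurable.comp ?_)).aemeasurable
        fun_prop
    _ = ∫⁻ s, ∫⁻ t, dirDeriv G (pt (1, a)) (pt (s, t)) := by
        refine lintegral_congr fun s => ?_
        exact lintegral_add_right_eq_self (fun t => dirDeriv G (pt (1, a)) (pt (s, t))) _
    _ = ∫⁻ y, dirDeriv G (pt (1, a)) y := (lintegral_plane hm).symm
    _ = _ := lintegral_indicator isClosed_halfPlane.measurableSet _

/-- The Sobolev inequality on the half-plane. -/
theorem IsTestFun.lintegral_sq_le (hG : IsTestFun G) :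
    ∫⁻ y in halfPlane, ‖G y‖ₑ ^ 2 ≤
      (∫⁻ y in halfPlane, ‖fderivWithin ℝ G halfPlane y (pt (1, 0))‖ₑ) *
      (∫⁻ y in halfPlane, ‖fderivWithin ℝ G halfPlane y (pt (0, 1))‖ₑ) := by
  have hm0 := hG.measurable_dirDeriv (pt (1, 0))
  have hm1 := hG.measurable_dirDeriv (pt (0, 1))
  have hn0 : pt (1, 0) ≠ 0 := fun h => by
    simpa [pt] using congrArg (fun v : Plane => v 0) h
  have hn1 : pt (0, 1) ≠ 0 := fun h => by
    simpa [pt] using congrArg (fun v : Plane => v 1) h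
  have hGm : Measurable (halfPlane.indicator fun y => ‖G y‖ₑ ^ 2) := by
    have h : ContinuousOn (fun y => ‖G y‖ₑ ^ 2) halfPlane :=
      (ENNReal.continuous_pow 2).comp_continuousOn hG.contDiffOn.continuousOn.enorm
    exact measurable_indicator_of_continuousOn h isClosed_halfPlane.measurableSet
  set A : ℝ → ℝ≥0∞ := fun t => ∫⁻ s, dirDeriv G (pt (1, 0)) (pt (s, t)) with hA
  set B : ℝ → ℝ≥0∞ := fun s => ∫⁻ t, dirDeriv G (pt (0, 1)) (pt (s, t)) with hB
  have hAm : Measurable A :=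
    (hm0.comp (continuous_pt.measurable)).lintegral_prod_left'
  have hBm : Measurable B :=
    (hm1.comp (continuous_pt.measurable)).lintegral_prod_right'
  have hGA : ∀ s t, pt (s, t) ∈ halfPlane → ‖G (pt (s, t))‖ₑ ≤ A t := fun s t h => by
    refine (hG.enorm_le_lintegral_dirDeriv h (by simp [pt]) hn0).trans (le_of_eq ?_)
    have : ∀ r : ℝ, pt (s, t) + r • pt (1, 0) = pt (s + r, t) := fun r => by
      rw [pt_add_smul]; simp
    simp only [this]
    exact lintegral_add_left_eq_self (fun s => dirDeriv G (pt (1, 0)) (pt (s, t))) s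
  have hGB : ∀ s t, pt (s, t) ∈ halfPlane → ‖G (pt (s, t))‖ₑ ≤ B s := fun s t h => by
    refine (hG.enorm_le_lintegral_dirDeriv h (by simp [pt]) hn1).trans (le_of_eq ?_)
    have : ∀ r : ℝ, pt (s, t) + r • pt (0, 1) = pt (s, t + r) := fun r => by
      rw [pt_add_smul]; simp
    simp only [this]
    exact lintegral_add_left_eq_self (fun t => dirDeriv G (pt (0, 1)) (pt (s, t))) t
  calc ∫⁻ y in halfPlane, ‖G y‖ₑ ^ 2
      = ∫⁻ s, ∫⁻ t, halfPlane.indicator (fun y => ‖G y‖ₑ ^ 2) (pt (s, t)) := by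
        rw [← lintegral_indicator isClosed_halfPlane.measurableSet, lintegral_plane hGm]
    _ ≤ ∫⁻ s, ∫⁻ t, B s * A t := by
        refine lintegral_mono fun s => lintegral_mono fun t => ?_
        by_cases h : pt (s, t) ∈ halfPlane
        · rw [indicator_of_mem h, sq]
          exact mul_le_mul' (hGB s t h) (hGA s t h)
        · simp [h]
    _ = (∫⁻ t, A t) * ∫⁻ s, B s := by
        simp_rw [lintegral_const_mul _ hAm]
        rw [lintegral_mul_const _ hBm, mul_comm]
    _ = _ := by
        rw [← lintegral_indicator isClosed_halfPlane.measurableSet,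
          ← lintegral_indicator isClosed_halfPlane.measurableSet]
        congr 1
        · rw [hA, lintegral_lintegral_swap
            (f := fun t s => dirDeriv G (pt (1, 0)) (pt (s, t)))
            (hm0.comp (continuous_pt.comp continuous_swap).measurable).aemeasurable]
          exact (lintegral_plane hm0).symm
        · exact (lintegral_plane hm1).symm

end

/-! ### The gradient -/

section

variable {M : Type*} [TopologicalSpace M] [ChartedSpace (EuclideanHalfSpace 2) M]

/-- Functions that are smooth on the surface up to its boundary. -/
abbrev IsSmooth (f : M → ℝ) : Prop := ContMDiff (𝓡∂ 2) 𝓘(ℝ, ℝ) ∞ f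

theorem IsSmooth.mdifferentiableAt {f : M → ℝ} (hf : IsSmooth f) (x : M) :
    MDifferentiableAt (𝓡∂ 2) 𝓘(ℝ, ℝ) f x := ContMDiff.mdifferentiableAt hf (by simp)

theorem IsSmooth.comp {f : M → ℝ} (hf : IsSmooth f) {F : ℝ → ℝ} (hF : ContDiff ℝ ∞ F) :
    IsSmooth (fun x => F (f x)) := hF.contMDiff.comp hf

variable [RiemannianBundle (fun x : M => TangentSpace (𝓡∂ 2) x)]

theorem eq_grad_of_inner {f : M → ℝ} {x : M} {X : TangentSpace (𝓡∂ 2) x}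
    (h : ∀ v, (⟪X, v⟫ : ℝ) = mfderiv (𝓡∂ 2) 𝓘(ℝ, ℝ) f x v) : grad f x = X :=
  ext_inner_right ℝ fun v => (inner_grad f x v).trans (h v).symm

theorem grad_sub {f g : M → ℝ} {x : M} (hf : MDifferentiableAt (𝓡∂ 2) 𝓘(ℝ, ℝ) f x)
    (hg : MDifferentiableAt (𝓡∂ 2) 𝓘(ℝ, ℝ) g x) :
    grad (fun x => f x - g x) x = grad f x - grad g x := by
  refine eq_grad_of_inner fun v => ?_
  have h := (hf.hasMFDerivAt.sub hg.hasMFDerivAt).mfderiv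
  rw [show (fun x => f x - g x) = f - g from rfl, h, inner_sub_left, inner_grad, inner_grad]
  rfl

theorem grad_mul {f g : M → ℝ} {x : M} (hf : MDifferentiableAt (𝓡∂ 2) 𝓘(ℝ, ℝ) f x)
    (hg : MDifferentiableAt (𝓡∂ 2) 𝓘(ℝ, ℝ) g x) :
    grad (fun x => f x * g x) x = f x • grad g x + g x • grad f x := by
  refine eq_grad_of_inner fun v => ?_
  have h := (hf.hasMFDerivAt.mul hg.hasMFDerivAt).mfderiv
  rw [show (fun x => f x * g x) = f * g from rfl, h, inner_add_left, real_inner_smul_left,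
    real_inner_smul_left, inner_grad, inner_grad]
  rfl

theorem grad_comp {f : M → ℝ} {x : M} (hf : MDifferentiableAt (𝓡∂ 2) 𝓘(ℝ, ℝ) f x) {F : ℝ → ℝ}
    {F' : ℝ} (hF : HasDerivAt F F' (f x)) : grad (fun x => F (f x)) x = F' • grad f x := by
  refine eq_grad_of_inner fun v => ?_
  have h := (HasMFDerivAt.comp x hF.hasFDerivAt.hasMFDerivAt hf.hasMFDerivAt).mfderiv
  rw [show (fun x => F (f x)) = F ∘ f from rfl, h, real_inner_smul_left, inner_grad]
  exact mul_comm _ _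

theorem grad_eq_zero_of_eventuallyEq {f : M → ℝ} {x : M} {c : ℝ} (h : f =ᶠ[𝓝 x] fun _ => c) :
    grad f x = 0 := by
  refine eq_grad_of_inner fun v => ?_
  rw [h.mfderiv_eq, mfderiv_const, inner_zero_left]
  rfl

theorem grad_eq_zero_of_notMem_tsupport {f : M → ℝ} {x : M} (h : x ∉ tsupport f) :
    grad f x = 0 :=
  grad_eq_zero_of_eventuallyEq (c := 0) (notMem_tsupport_iff_eventuallyEq.1 h)

variable [IsManifold (𝓡∂ 2) ∞ M]

/-- The directional derivatives of a function read in a chart. -/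
theorem fderivWithin_chart {f : M → ℝ} {p : M} {y : Plane}
    (hy : y ∈ (extChartAt (𝓡∂ 2) p).target)
    (hf : MDifferentiableAt (𝓡∂ 2) 𝓘(ℝ, ℝ) f ((extChartAt (𝓡∂ 2) p).symm y)) (v : Plane) :
    fderivWithin ℝ (fun z => f ((extChartAt (𝓡∂ 2) p).symm z)) halfPlane y v =
      ⟪grad f ((extChartAt (𝓡∂ 2) p).symm y), v 0 • coordVec p y 0 + v 1 • coordVec p y 1⟫ := by
  have hu : UniqueMDiffWithinAt 𝓘(ℝ, Plane) (range (𝓡∂ 2)) y :=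
    ((𝓡∂ 2).uniqueDiffOn y (extChartAt_target_subset_range p hy)).uniqueMDiffWithinAt
  have h := mfderiv_comp_mfderivWithin y hf (mdifferentiableWithinAt_extChartAt_symm hy) hu
  rw [mfderivWithin_eq_fderivWithin, range_model] at h
  rw [inner_grad, ← mfderivWithin_symm_apply, range_model]
  exact DFunLike.congr_fun h v

theorem exists_coord {p : M} {y : Plane} (hy : y ∈ (extChartAt (𝓡∂ 2) p).target)
    (X : TangentSpace (𝓡∂ 2) ((extChartAt (𝓡∂ 2) p).symm y)) :
    ∃ a b : ℝ, X = a • coordVec p y 0 + b • coordVec p y 1 := by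
  obtain ⟨v, hv⟩ := (isInvertible_mfderivWithin_extChartAt_symm (I := 𝓡∂ 2) hy).surjective X
  exact ⟨_, _, hv.symm.trans (mfderivWithin_symm_apply p y v)⟩

/-- The length of a vector in terms of its inner products with the coordinate fields. -/
theorem norm_sq_mul_metricDet {p : M} {y : Plane} (hy : y ∈ (extChartAt (𝓡∂ 2) p).target)
    (X : TangentSpace (𝓡∂ 2) ((extChartAt (𝓡∂ 2) p).symm y)) :
    ‖X‖ ^ 2 * metricDet p y = metricCoeff p y 1 1 * ⟪X, coordVec p y 0⟫ ^ 2
      - 2 * metricCoeff p y 0 1 * (⟪X, coordVec p y 0⟫ * ⟪X, coordVec p y 1⟫)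
      + metricCoeff p y 0 0 * ⟪X, coordVec p y 1⟫ ^ 2 := by
  obtain ⟨a, b, rfl⟩ := exists_coord hy X
  rw [norm_comb_sq]
  simp only [inner_add_left, real_inner_smul_left]
  change _ = metricCoeff p y 1 1 * (a * metricCoeff p y 0 0 + b * metricCoeff p y 1 0) ^ 2
    - 2 * metricCoeff p y 0 1 * ((a * metricCoeff p y 0 0 + b * metricCoeff p y 1 0)
      * (a * metricCoeff p y 0 1 + b * metricCoeff p y 1 1))
    + metricCoeff p y 0 0 * (a * metricCoeff p y 0 1 + b * metricCoeff p y 1 1) ^ 2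
  rw [metricCoeff_comm p y 1 0, metricDet]
  ring

theorem contDiffOn_chart {f : M → ℝ} (hf : IsSmooth f) (p : M) :
    ContDiffOn ℝ ∞ (fun z => f ((extChartAt (𝓡∂ 2) p).symm z)) (extChartAt (𝓡∂ 2) p).target :=
  contMDiffOn_iff_contDiffOn.1 (hf.comp_contMDiffOn (contMDiffOn_extChartAt_symm p))

theorem contDiffWithinAt_chart {f : M → ℝ} (hf : IsSmooth f) {p : M} {y : Plane}
    (hy : y ∈ (extChartAt (𝓡∂ 2) p).target) :
    ContDiffWithinAt ℝ ∞ (fun z => f ((extChartAt (𝓡∂ 2) p).symm z)) halfPlane y :=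
  (contDiffOn_chart hf p y hy).mono_of_mem_nhdsWithin (target_mem_nhdsWithin hy)

theorem continuousOn_fderivWithin_chart {f : M → ℝ} (hf : IsSmooth f) (p : M) (v : Plane) :
    ContinuousOn (fun y => fderivWithin ℝ (fun z => f ((extChartAt (𝓡∂ 2) p).symm z)) halfPlane y v)
      (extChartAt (𝓡∂ 2) p).target := by
  intro y hy
  have h := (contDiffWithinAt_chart hf hy).fderivWithin_right (m := 0) uniqueDiffOn_halfPlane
    (by simp) (target_subset_halfPlane p hy)
  exact (h.continuousWithinAt.mono (target_subset_halfPlane p)).clm_apply continuousWithinAt_const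

theorem inner_grad_coordVec_zero {f : M → ℝ} (hf : IsSmooth f) {p : M} {y : Plane}
    (hy : y ∈ (extChartAt (𝓡∂ 2) p).target) :
    ⟪grad f ((extChartAt (𝓡∂ 2) p).symm y), coordVec p y 0⟫ =
      fderivWithin ℝ (fun z => f ((extChartAt (𝓡∂ 2) p).symm z)) halfPlane y (pt (1, 0)) := by
  rw [fderivWithin_chart hy (hf.mdifferentiableAt _)]
  simp only [inner_add_right, real_inner_smul_right]; simp [pt]

theorem inner_grad_coordVec_one {f : M → ℝ} (hf : IsSmooth f) {p : M} {y : Plane}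
    (hy : y ∈ (extChartAt (𝓡∂ 2) p).target) :
    ⟪grad f ((extChartAt (𝓡∂ 2) p).symm y), coordVec p y 1⟫ =
      fderivWithin ℝ (fun z => f ((extChartAt (𝓡∂ 2) p).symm z)) halfPlane y (pt (0, 1)) := by
  rw [fderivWithin_chart hy (hf.mdifferentiableAt _)]
  simp only [inner_add_right, real_inner_smul_right]; simp [pt]

variable [IsContMDiffRiemannianBundle (𝓡∂ 2) ∞ (EuclideanSpace ℝ (Fin 2))
      (fun x : M => TangentSpace (𝓡∂ 2) x)]

theorem IsSmooth.continuous_norm_grad {f : M → ℝ} (hf : IsSmooth f) :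
    Continuous fun x => ‖grad f x‖ := by
  rw [continuous_iff_continuousAt]
  intro p
  set φ := extChartAt (𝓡∂ 2) p with hφ
  have h1 : ContinuousOn (fun y => ‖grad f (φ.symm y)‖) φ.target := by
    have h0 := continuousOn_fderivWithin_chart hf p (pt (1, 0))
    have h1 := continuousOn_fderivWithin_chart hf p (pt (0, 1))
    have h2 := ((((continuousOn_metricCoeff p 1 1).mul (h0.pow 2)).sub
      ((continuousOn_const (c := (2 : ℝ)).mul (continuousOn_metricCoeff p 0 1)).mul
        (h0.mul h1))).add ((continuousOn_metricCoeff p 0 0).mul (h1.pow 2))).div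
      (continuousOn_metricDet p) (fun y hy => (metricDet_pos hy).ne')
    refine h2.sqrt.congr fun y hy => ?_
    have h3 := norm_sq_mul_metricDet hy (grad f (φ.symm y))
    rw [inner_grad_coordVec_zero hf hy, inner_grad_coordVec_one hf hy] at h3
    simp only [Pi.pow_apply, Pi.div_apply, Pi.sub_apply, Pi.add_apply, Pi.mul_apply]
    rw [← h3, mul_div_cancel_right₀ _ (metricDet_pos hy).ne', Real.sqrt_sq (norm_nonneg _)]
  have h2 : ContinuousOn (fun x => ‖grad f x‖) φ.source := by
    refine (h1.comp (continuousOn_extChartAt p) φ.mapsTo).congr fun x hx => ?_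
    simp only [Function.comp]
    rw [φ.left_inv hx]
  exact h2.continuousAt (extChartAt_source_mem_nhds p)

end

/-! ### Local inequalities on the surface -/

section

variable {M : Type*} [TopologicalSpace M] [ChartedSpace (EuclideanHalfSpace 2) M]

/-- A property that holds near the coordinates of a point holds on a neighbourhood of the point. -/
theorem exists_chart_nhds {p : M} {P : Plane → Prop}
    (h : ∀ᶠ y in 𝓝[(extChartAt (𝓡∂ 2) p).target] (extChartAt (𝓡∂ 2) p p), P y) :
    ∃ V : Set M, IsOpen V ∧ p ∈ V ∧ V ⊆ (extChartAt (𝓡∂ 2) p).source ∧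
      ∀ x ∈ V, P (extChartAt (𝓡∂ 2) p x) := by
  have h1 : Tendsto (extChartAt (𝓡∂ 2) p) (𝓝 p)
      (𝓝[(extChartAt (𝓡∂ 2) p).target] (extChartAt (𝓡∂ 2) p p)) :=
    tendsto_nhdsWithin_iff.2 ⟨continuousAt_extChartAt p, by
      filter_upwards [extChartAt_source_mem_nhds (I := 𝓡∂ 2) p] with x hx
      exact (extChartAt (𝓡∂ 2) p).map_source hx⟩
  obtain ⟨V, hV, hVo, hpV⟩ := mem_nhds_iff.1
    ((h1.eventually h).and (extChartAt_source_mem_nhds (I := 𝓡∂ 2) p))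
  exact ⟨V, hVo, hpV, fun x hx => (hV hx).2, fun x hx => (hV hx).1⟩

/-- A function on the surface read in a chart, extended by zero to the plane. -/
def chartFun (p : M) (v : M → ℝ) : Plane → ℝ :=
  (extChartAt (𝓡∂ 2) p).target.indicator fun y => v ((extChartAt (𝓡∂ 2) p).symm y)

theorem chartFun_of_mem {p : M} {v : M → ℝ} {y : Plane}
    (hy : y ∈ (extChartAt (𝓡∂ 2) p).target) :
    chartFun p v y = v ((extChartAt (𝓡∂ 2) p).symm y) := indicator_of_mem hy _

section
variable {p : M} {v : M → ℝ}

theorem chartFun_eventuallyEq {y : Plane} (hy : y ∈ (extChartAt (𝓡∂ 2) p).target) :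
    chartFun p v =ᶠ[𝓝[halfPlane] y] fun z => v ((extChartAt (𝓡∂ 2) p).symm z) := by
  filter_upwards [target_mem_nhdsWithin hy] with z hz
  exact indicator_of_mem hz _

variable [CompactSpace M]

theorem isCompact_chart_tsupport
    (hs : tsupport v ⊆ (extChartAt (𝓡∂ 2) p).source) :
    IsCompact (extChartAt (𝓡∂ 2) p '' tsupport v) :=
  (isClosed_tsupport v).isCompact.image_of_continuousOn ((continuousOn_extChartAt p).mono hs)

theorem chartFun_eq_zero {y : Plane} (hy : y ∉ extChartAt (𝓡∂ 2) p '' tsupport v) :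
    chartFun p v y = 0 := by
  by_contra h
  have hyT : y ∈ (extChartAt (𝓡∂ 2) p).target := by
    by_contra h'; exact h (indicator_of_notMem h' _)
  rw [chartFun, indicator_of_mem hyT] at h
  exact hy ⟨_, subset_tsupport v h, (extChartAt (𝓡∂ 2) p).right_inv hyT⟩

theorem chartFun_eventuallyEq_zero
    (hs : tsupport v ⊆ (extChartAt (𝓡∂ 2) p).source) {y : Plane}
    (hy : y ∉ (extChartAt (𝓡∂ 2) p).target) :
    chartFun p v =ᶠ[𝓝 y] fun _ => 0 := by
  have hK := (isCompact_chart_tsupport hs).isClosed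
  have : y ∉ extChartAt (𝓡∂ 2) p '' tsupport v := by
    rintro ⟨x, hx, rfl⟩; exact hy ((extChartAt (𝓡∂ 2) p).map_source (hs hx))
  filter_upwards [hK.isOpen_compl.mem_nhds this] with z hz
  exact chartFun_eq_zero hz

theorem isTestFun_chartFun [IsManifold (𝓡∂ 2) ∞ M]
    [RiemannianBundle (fun x : M => TangentSpace (𝓡∂ 2) x)]
    (hs : tsupport v ⊆ (extChartAt (𝓡∂ 2) p).source) (hv : IsSmooth v) :
    IsTestFun (chartFun p v) := by
  constructor
  · intro y hy
    by_cases hyT : y ∈ (extChartAt (𝓡∂ 2) p).target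
    · exact ((contDiffWithinAt_chart hv hyT).of_le (by simp)).congr_of_eventuallyEq
        (chartFun_eventuallyEq hyT) (indicator_of_mem hyT _)
    · exact contDiffWithinAt_const.congr_of_eventuallyEq
        ((chartFun_eventuallyEq_zero hs hyT).filter_mono nhdsWithin_le_nhds)
        (indicator_of_notMem hyT _)
  · obtain ⟨R, hR⟩ := (isCompact_chart_tsupport hs).isBounded.exists_norm_le
    refine ⟨R + 1, fun y _ hy => chartFun_eq_zero fun h => ?_⟩
    linarith [hR y h]

theorem enorm_fderivWithin_chartFun_le [IsManifold (𝓡∂ 2) ∞ M]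
    [RiemannianBundle (fun x : M => TangentSpace (𝓡∂ 2) x)]
    (hs : tsupport v ⊆ (extChartAt (𝓡∂ 2) p).source) (hv : IsSmooth v) (y n : Plane) :
    ‖fderivWithin ℝ (chartFun p v) halfPlane y n‖ₑ ≤
      (extChartAt (𝓡∂ 2) p).target.indicator (fun y =>
        ENNReal.ofReal ‖n 0 • coordVec p y 0 + n 1 • coordVec p y 1‖ *
          ENNReal.ofReal ‖grad v ((extChartAt (𝓡∂ 2) p).symm y)‖) y := by
  by_cases hyT : y ∈ (extChartAt (𝓡∂ 2) p).target
  · rw [indicator_of_mem hyT, (chartFun_eventuallyEq hyT).fderivWithin_eq (indicator_of_mem hyT _),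
      fderivWithin_chart hyT (hv.mdifferentiableAt _), ← ENNReal.ofReal_mul (norm_nonneg _),
      Real.enorm_eq_ofReal_abs]
    refine ENNReal.ofReal_le_ofReal ((abs_real_inner_le_norm _ _).trans_eq (mul_comm _ _))
  · rw [indicator_of_notMem hyT, ((chartFun_eventuallyEq_zero hs hyT).filter_mono
      nhdsWithin_le_nhds).fderivWithin_eq (indicator_of_notMem hyT _)]
    simp

end

theorem lintegral_eq_setLIntegral_of_tsupport {α : Type*} [MeasurableSpace α] {μ : Measure α}
    {U : Set α} (hU : MeasurableSet U) {F : α → ℝ≥0∞} (h : ∀ x ∉ U, F x = 0) :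
    ∫⁻ x, F x ∂μ = ∫⁻ x in U, F x ∂μ := by
  rw [← lintegral_indicator hU]
  congr 1 with x
  by_cases hx : x ∈ U <;> simp [hx, h]

variable [CompactSpace M] [IsManifold (𝓡∂ 2) ∞ M]
  [RiemannianBundle (fun x : M => TangentSpace (𝓡∂ 2) x)]
  [IsContMDiffRiemannianBundle (𝓡∂ 2) ∞ (EuclideanSpace ℝ (Fin 2))
      (fun x : M => TangentSpace (𝓡∂ 2) x)] [MeasurableSpace M] [BorelSpace M]

theorem lintegral_area_chart (p : M) {F : M → ℝ≥0∞} (hF : Measurable F)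
    (h : ∀ x ∉ (extChartAt (𝓡∂ 2) p).source, F x = 0) :
    ∫⁻ x, F x ∂(area M) = ∫⁻ y in (extChartAt (𝓡∂ 2) p).target,
      ENNReal.ofReal (areaDensity p y) * F ((extChartAt (𝓡∂ 2) p).symm y) := by
  rw [lintegral_eq_setLIntegral_of_tsupport (measurableSet_source p) h, area_restrict_source,
    lintegral_chartArea p hF]

theorem lintegral_bdryLength_chart (p : M) {F : M → ℝ≥0∞} (hF : Measurable F)
    (h : ∀ x ∉ (extChartAt (𝓡∂ 2) p).source, F x = 0) :
    ∫⁻ x, F x ∂(bdryLength M) = ∫⁻ t in lineSet p,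
      ENNReal.ofReal (lengthDensity p t) * F ((extChartAt (𝓡∂ 2) p).symm (linePt t)) := by
  rw [lintegral_eq_setLIntegral_of_tsupport (measurableSet_source p) h, bdryLength_restrict_source,
    lintegral_chartLength p hF]

theorem continuousOn_norm_comb (p : M) (a b : ℝ) :
    ContinuousOn (fun y => ‖a • coordVec p y 0 + b • coordVec p y 1‖)
      (extChartAt (𝓡∂ 2) p).target := by
  have h : (fun y => ‖a • coordVec p y 0 + b • coordVec p y 1‖) = fun y =>
      √(a ^ 2 * metricCoeff p y 0 0 + 2 * (a * b) * metricCoeff p y 0 1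
        + b ^ 2 * metricCoeff p y 1 1) := by
    ext y; rw [← norm_comb_sq, Real.sqrt_sq (norm_nonneg _)]
  rw [h]
  exact (((continuousOn_const.mul (continuousOn_metricCoeff p 0 0)).add
    (continuousOn_const.mul (continuousOn_metricCoeff p 0 1))).add
    (continuousOn_const.mul (continuousOn_metricCoeff p 1 1))).sqrt

/-- The trace inequality near a point, with a constant as close to `1` as one likes: the
boundary integral of `|v|` is controlled by the derivative of `v` along the constant coordinate
field that is orthogonal at the given point to the second coordinate field. -/
theorem exists_nhds_trace_le (x₀ : M) {ε : ℝ} (hε : 0 < ε) :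
    ∃ V : Set M, IsOpen V ∧ x₀ ∈ V ∧ ∀ v : M → ℝ, IsSmooth v → tsupport v ⊆ V →
      ∫⁻ x, ‖v x‖ₑ ∂(bdryLength M) ≤
        ENNReal.ofReal (1 + ε) * ∫⁻ x, ENNReal.ofReal ‖grad v x‖ ∂(area M) := by
  set φ := extChartAt (𝓡∂ 2) x₀ with hφ
  set q := φ x₀ with hq
  have hqT : q ∈ φ.target := mem_extChartAt_target x₀
  have hg : 0 < metricCoeff x₀ q 1 1 := metricCoeff_self_pos hqT 1
  -- `∂₀ + a ∂₁` is orthogonal to `∂₁` at `x₀`, so `|∂₁| |∂₀ + a ∂₁|` is the area density there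
  set a : ℝ := -(metricCoeff x₀ q 0 1 / metricCoeff x₀ q 1 1) with ha
  set N : Plane → ℝ := fun y => ‖(1 : ℝ) • coordVec x₀ y 0 + a • coordVec x₀ y 1‖ with hN
  have hNq : √(metricCoeff x₀ q 1 1) * N q = areaDensity x₀ q := by
    rw [areaDensity_eq, ← Real.sqrt_sq (show 0 ≤ N q from norm_nonneg _), ← Real.sqrt_mul hg.le]
    simp only [hN]
    rw [norm_comb_sq, metricDet, ha]
    congr 1
    field_simp
    ring
  have hL : 0 < √(metricCoeff x₀ q 1 1) := Real.sqrt_pos.2 hg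
  have hd : 0 < areaDensity x₀ q := areaDensity_pos hqT
  set l : ℝ := √(metricCoeff x₀ q 1 1) * (1 + ε / 2) with hl
  have hl0 : 0 ≤ l := by positivity
  have hev : ∀ᶠ y in 𝓝[φ.target] q, √(metricCoeff x₀ y 1 1) < l ∧
      l * N y < (1 + ε) * areaDensity x₀ y := by
    have h1 : ContinuousWithinAt (fun y => √(metricCoeff x₀ y 1 1)) φ.target q :=
      (continuousOn_metricCoeff x₀ 1 1).sqrt q hqT
    have h2 : ContinuousWithinAt (fun y => l * N y) φ.target q :=
      continuousWithinAt_const.mul (continuousOn_norm_comb x₀ 1 a q hqT)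
    have h3 : ContinuousWithinAt (fun y => (1 + ε) * areaDensity x₀ y) φ.target q :=
      continuousWithinAt_const.mul (continuousOn_areaDensity x₀ q hqT)
    refine (h1.eventually_lt continuousWithinAt_const ?_).and (h2.eventually_lt h3 ?_)
    · rw [hl]; nlinarith
    · show √(metricCoeff x₀ q 1 1) * (1 + ε / 2) * N q < (1 + ε) * areaDensity x₀ q
      rw [mul_right_comm, hNq]; nlinarith
  obtain ⟨V, hVo, hxV, hVs, hV⟩ := exists_chart_nhds hev
  refine ⟨V, hVo, hxV, fun v hv hvs => ?_⟩
  have hs : tsupport v ⊆ φ.source := hvs.trans hVs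
  have hG : IsTestFun (chartFun x₀ v) := isTestFun_chartFun hs hv
  have hvm : Measurable fun x => ‖v x‖ₑ := hv.continuous.measurable.enorm
  have hgm : Measurable fun x => ENNReal.ofReal ‖grad v x‖ :=
    hv.continuous_norm_grad.measurable.ennreal_ofReal
  have hv0 : ∀ x ∉ V, v x = 0 := fun x hx => image_eq_zero_of_notMem_tsupport fun h => hx (hvs h)
  have hg0 : ∀ x ∉ V, ‖grad v x‖ = 0 := fun x hx => by
    rw [grad_eq_zero_of_notMem_tsupport fun h => hx (hvs h)]; exact norm_zero
  have hVy : ∀ y ∈ φ.target, φ.symm y ∈ V → √(metricCoeff x₀ y 1 1) < l ∧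
      l * N y < (1 + ε) * areaDensity x₀ y := fun y hy h => by
    have := hV _ h
    rwa [← hφ, φ.right_inv hy] at this
  calc ∫⁻ x, ‖v x‖ₑ ∂(bdryLength M)
      = ∫⁻ t in lineSet x₀, ENNReal.ofReal (lengthDensity x₀ t) * ‖v (φ.symm (linePt t))‖ₑ :=
        lintegral_bdryLength_chart x₀ hvm fun x hx => by simp [hv0 x fun h => hx (hVs h)]
    _ ≤ ∫⁻ t in lineSet x₀, ENNReal.ofReal l * ‖chartFun x₀ v (linePt t)‖ₑ := by
        refine setLIntegral_mono' (measurableSet_lineSet x₀) fun t ht => ?_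
        rw [chartFun_of_mem (show linePt t ∈ _ from ht)]
        by_cases h : φ.symm (linePt t) ∈ V
        · gcongr
          exact (hVy _ ht h).1.le
        · rw [hv0 _ h]; simp
    _ ≤ ∫⁻ t, ENNReal.ofReal l * ‖chartFun x₀ v (linePt t)‖ₑ := setLIntegral_le_lintegral _ _
    _ = ENNReal.ofReal l * ∫⁻ t, ‖chartFun x₀ v (linePt t)‖ₑ :=
        lintegral_const_mul' _ _ ENNReal.ofReal_ne_top
    _ ≤ ENNReal.ofReal l * ∫⁻ y in halfPlane,
          ‖fderivWithin ℝ (chartFun x₀ v) halfPlane y (pt (1, a))‖ₑ := by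
        gcongr; exact hG.lintegral_line_le a
    _ ≤ ∫⁻ y, ENNReal.ofReal l * ‖fderivWithin ℝ (chartFun x₀ v) halfPlane y (pt (1, a))‖ₑ := by
        rw [lintegral_const_mul' _ _ ENNReal.ofReal_ne_top]
        exact mul_le_mul_right (setLIntegral_le_lintegral _ _) _
    _ ≤ ∫⁻ y in φ.target, ENNReal.ofReal (1 + ε) * (ENNReal.ofReal (areaDensity x₀ y) *
          ENNReal.ofReal ‖grad v (φ.symm y)‖) := by
        rw [← lintegral_indicator (measurableSet_target x₀)]
        refine lintegral_mono fun y => ?_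
        refine (mul_le_mul_right (enorm_fderivWithin_chartFun_le hs hv _ _) _).trans ?_
        by_cases hy : y ∈ φ.target
        · rw [indicator_of_mem hy, indicator_of_mem hy]
          by_cases h : φ.symm y ∈ V
          · rw [← mul_assoc, ← mul_assoc, ← ENNReal.ofReal_mul hl0,
              ← ENNReal.ofReal_mul (show 0 ≤ 1 + ε by positivity)]
            exact mul_le_mul_left (ENNReal.ofReal_le_ofReal (hVy _ hy h).2.le) _
          · rw [hg0 _ h]; simp
        · rw [indicator_of_notMem hy]; simp
    _ = ENNReal.ofReal (1 + ε) * ∫⁻ x, ENNReal.ofReal ‖grad v x‖ ∂(area M) := by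
        rw [lintegral_const_mul' _ _ ENNReal.ofReal_ne_top, lintegral_area_chart x₀ hgm
          fun x hx => by simp [hg0 x fun h => hx (hVs h)]]

/-- The Sobolev inequality near a point. -/
theorem exists_nhds_sobolev_le (x₀ : M) :
    ∃ V : Set M, IsOpen V ∧ x₀ ∈ V ∧ ∃ C : ℝ, 0 ≤ C ∧ ∀ v : M → ℝ, IsSmooth v → tsupport v ⊆ V →
      ∫⁻ x, ‖v x‖ₑ ^ 2 ∂(area M) ≤
        ENNReal.ofReal C * (∫⁻ x, ENNReal.ofReal ‖grad v x‖ ∂(area M)) ^ 2 := by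
  set φ := extChartAt (𝓡∂ 2) x₀ with hφ
  set q := φ x₀ with hq
  have hqT : q ∈ φ.target := mem_extChartAt_target x₀
  have hd : 0 < areaDensity x₀ q := areaDensity_pos hqT
  set N : ℝ × ℝ → Plane → ℝ := fun n y => ‖n.1 • coordVec x₀ y 0 + n.2 • coordVec x₀ y 1‖ with hN
  set d : ℝ := 2 * areaDensity x₀ q with hdd
  set c : ℝ := (N (1, 0) q + N (0, 1) q + 1) / areaDensity x₀ q with hc
  have hN0 : 0 ≤ N (1, 0) q := norm_nonneg _
  have hN1 : 0 ≤ N (0, 1) q := norm_nonneg _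
  have hcd : c * areaDensity x₀ q = N (1, 0) q + N (0, 1) q + 1 := div_mul_cancel₀ _ hd.ne'
  have hev : ∀ᶠ y in 𝓝[φ.target] q, areaDensity x₀ y < d ∧
      N (1, 0) y < c * areaDensity x₀ y ∧ N (0, 1) y < c * areaDensity x₀ y := by
    have h1 := continuousOn_areaDensity x₀ q hqT
    have h2 := continuousOn_norm_comb x₀ 1 0 q hqT
    have h3 := continuousOn_norm_comb x₀ 0 1 q hqT
    refine (h1.eventually_lt continuousWithinAt_const (by linarith)).and
      ((h2.eventually_lt (continuousWithinAt_const.mul h1) ?_).and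
      (h3.eventually_lt (continuousWithinAt_const.mul h1) ?_))
    · show N (1, 0) q < c * areaDensity x₀ q
      rw [hcd]; linarith
    · show N (0, 1) q < c * areaDensity x₀ q
      rw [hcd]; linarith
  obtain ⟨V, hVo, hxV, hVs, hV⟩ := exists_chart_nhds hev
  have hc0 : 0 ≤ c := by positivity
  refine ⟨V, hVo, hxV, d * c ^ 2, by positivity, fun v hv hvs => ?_⟩
  have hs : tsupport v ⊆ φ.source := hvs.trans hVs
  have hG : IsTestFun (chartFun x₀ v) := isTestFun_chartFun hs hv
  have hvm : Measurable fun x => ‖v x‖ₑ ^ 2 := hv.continuous.measurable.enorm.pow_const 2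
  have hgm : Measurable fun x => ENNReal.ofReal ‖grad v x‖ :=
    hv.continuous_norm_grad.measurable.ennreal_ofReal
  have hv0 : ∀ x ∉ V, v x = 0 := fun x hx => image_eq_zero_of_notMem_tsupport fun h => hx (hvs h)
  have hg0 : ∀ x ∉ V, ‖grad v x‖ = 0 := fun x hx => by
    rw [grad_eq_zero_of_notMem_tsupport fun h => hx (hvs h)]; exact norm_zero
  have hVy : ∀ y ∈ φ.target, φ.symm y ∈ V → areaDensity x₀ y < d ∧
      N (1, 0) y < c * areaDensity x₀ y ∧ N (0, 1) y < c * areaDensity x₀ y := fun y hy h => by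
    have := hV _ h
    rwa [← hφ, φ.right_inv hy] at this
  have hder : ∀ n : ℝ × ℝ, (∀ y ∈ φ.target, φ.symm y ∈ V → N n y < c * areaDensity x₀ y) →
      ∫⁻ y in halfPlane, ‖fderivWithin ℝ (chartFun x₀ v) halfPlane y (pt n)‖ₑ ≤
        ENNReal.ofReal c * ∫⁻ x, ENNReal.ofReal ‖grad v x‖ ∂(area M) := by
    intro n hn
    calc _ ≤ ∫⁻ y, ‖fderivWithin ℝ (chartFun x₀ v) halfPlane y (pt n)‖ₑ :=
          setLIntegral_le_lintegral _ _
      _ ≤ ∫⁻ y in φ.target, ENNReal.ofReal c * (ENNReal.ofReal (areaDensity x₀ y) *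
          ENNReal.ofReal ‖grad v (φ.symm y)‖) := by
        rw [← lintegral_indicator (measurableSet_target x₀)]
        refine lintegral_mono fun y => ?_
        refine (enorm_fderivWithin_chartFun_le hs hv _ _).trans ?_
        by_cases hy : y ∈ φ.target
        · rw [indicator_of_mem hy, indicator_of_mem hy]
          by_cases h : φ.symm y ∈ V
          · rw [← mul_assoc, ← ENNReal.ofReal_mul hc0]
            exact mul_le_mul_left (ENNReal.ofReal_le_ofReal (hn _ hy h).le) _
          · rw [hg0 _ h]; simp
        · rw [indicator_of_notMem hy]; simp
      _ = _ := by
        rw [lintegral_const_mul' _ _ ENNReal.ofReal_ne_top, lintegral_area_chart x₀ hgm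
          fun x hx => by simp [hg0 x fun h => hx (hVs h)]]
  calc ∫⁻ x, ‖v x‖ₑ ^ 2 ∂(area M)
      = ∫⁻ y in φ.target, ENNReal.ofReal (areaDensity x₀ y) * ‖v (φ.symm y)‖ₑ ^ 2 :=
        lintegral_area_chart x₀ hvm fun x hx => by simp [hv0 x fun h => hx (hVs h)]
    _ ≤ ∫⁻ y in φ.target, ENNReal.ofReal d * ‖chartFun x₀ v y‖ₑ ^ 2 := by
        refine setLIntegral_mono' (measurableSet_target x₀) fun y hy => ?_
        rw [chartFun_of_mem hy]
        by_cases h : φ.symm y ∈ V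
        · gcongr
          exact (hVy _ hy h).1.le
        · rw [hv0 _ h]; simp
    _ ≤ ∫⁻ y in halfPlane, ENNReal.ofReal d * ‖chartFun x₀ v y‖ₑ ^ 2 :=
        lintegral_mono_set (target_subset_halfPlane x₀)
    _ = ENNReal.ofReal d * ∫⁻ y in halfPlane, ‖chartFun x₀ v y‖ₑ ^ 2 :=
        lintegral_const_mul' _ _ ENNReal.ofReal_ne_top
    _ ≤ ENNReal.ofReal d * ((ENNReal.ofReal c * ∫⁻ x, ENNReal.ofReal ‖grad v x‖ ∂(area M)) *
          (ENNReal.ofReal c * ∫⁻ x, ENNReal.ofReal ‖grad v x‖ ∂(area M))) := by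
        refine mul_le_mul_right (hG.lintegral_sq_le.trans (mul_le_mul' ?_ ?_)) _
        · exact hder (1, 0) fun y hy h => (hVy y hy h).2.1
        · exact hder (0, 1) fun y hy h => (hVy y hy h).2.2
    _ = _ := by
        rw [ENNReal.ofReal_mul (show 0 ≤ d by positivity), ENNReal.ofReal_pow hc0]; ring

theorem area_lt_top : area M univ < ⊤ := by
  refine isCompact_univ.measure_lt_top_of_nhdsWithin fun x₀ _ => ?_
  rw [nhdsWithin_univ]
  set φ := extChartAt (𝓡∂ 2) x₀ with hφ
  have hqT : φ x₀ ∈ φ.target := mem_extChartAt_target x₀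
  have hev : ∀ᶠ y in 𝓝[φ.target] (φ x₀), areaDensity x₀ y < areaDensity x₀ (φ x₀) + 1 ∧
      y ∈ Metric.ball (φ x₀) 1 :=
    ((continuousOn_areaDensity x₀ _ hqT).eventually_lt continuousWithinAt_const (by linarith)).and
      (nhdsWithin_le_nhds (Metric.ball_mem_nhds _ one_pos))
  obtain ⟨V, hVo, hxV, hVs, hV⟩ := exists_chart_nhds hev
  refine ⟨V, hVo.mem_nhds hxV, ?_⟩
  have h1 : area M V = chartArea x₀ V := by
    rw [← area_restrict_source x₀, Measure.restrict_apply hVo.measurableSet,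
      inter_eq_left.2 hVs]
  rw [h1, chartArea_apply x₀ hVo.measurableSet]
  calc _ ≤ ∫⁻ y in φ.target ∩ φ.symm ⁻¹' V, ENNReal.ofReal (areaDensity x₀ (φ x₀) + 1) := by
        refine setLIntegral_mono' (measurableSet_inter_preimage (continuousOn_extChartAt_symm x₀)
          (measurableSet_target x₀) hVo.measurableSet) fun y hy => ?_
        refine ENNReal.ofReal_le_ofReal ?_
        have := (hV _ hy.2).1
        rw [φ.right_inv hy.1] at this
        exact this.le
    _ ≤ ∫⁻ y in Metric.ball (φ x₀) 1, ENNReal.ofReal (areaDensity x₀ (φ x₀) + 1) := by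
        refine lintegral_mono_set fun y hy => ?_
        have := (hV _ hy.2).2
        rwa [φ.right_inv hy.1] at this
    _ < ⊤ := by
        rw [setLIntegral_const]
        exact ENNReal.mul_lt_top ENNReal.ofReal_lt_top measure_ball_lt_top

instance : IsFiniteMeasure (area M) := ⟨area_lt_top⟩

theorem bdryLength_lt_top : bdryLength M univ < ⊤ := by
  refine isCompact_univ.measure_lt_top_of_nhdsWithin fun x₀ _ => ?_
  rw [nhdsWithin_univ]
  set φ := extChartAt (𝓡∂ 2) x₀ with hφ
  have hqT : φ x₀ ∈ φ.target := mem_extChartAt_target x₀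
  set l : ℝ := √(metricCoeff x₀ (φ x₀) 1 1) + 1 with hl
  have hev : ∀ᶠ y in 𝓝[φ.target] (φ x₀), √(metricCoeff x₀ y 1 1) < l ∧
      y ∈ Metric.ball (φ x₀) 1 :=
    (((continuousOn_metricCoeff x₀ 1 1).sqrt _ hqT).eventually_lt continuousWithinAt_const
      (by rw [hl]; exact lt_add_one _)).and
      (nhdsWithin_le_nhds (Metric.ball_mem_nhds _ one_pos))
  obtain ⟨V, hVo, hxV, hVs, hV⟩ := exists_chart_nhds hev
  refine ⟨V, hVo.mem_nhds hxV, ?_⟩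
  have h1 : bdryLength M V = chartLength x₀ V := by
    rw [← bdryLength_restrict_source x₀, Measure.restrict_apply hVo.measurableSet,
      inter_eq_left.2 hVs]
  rw [h1, chartLength_apply x₀ hVo.measurableSet]
  calc _ ≤ ∫⁻ t in lineSet x₀ ∩ (fun t => φ.symm (linePt t)) ⁻¹' V, ENNReal.ofReal l := by
        refine setLIntegral_mono' (measurableSet_inter_preimage (continuousOn_symm_linePt x₀)
          (measurableSet_lineSet x₀) hVo.measurableSet) fun t ht => ?_
        refine ENNReal.ofReal_le_ofReal ?_
        have := (hV _ ht.2).1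
        rw [φ.right_inv ht.1] at this
        exact this.le
    _ ≤ ∫⁻ t in Metric.ball (φ x₀ 1) 1, ENNReal.ofReal l := by
        refine lintegral_mono_set fun t ht => ?_
        have := (hV _ ht.2).2
        rw [φ.right_inv ht.1, mem_ball_iff_norm] at this
        have h2 := (PiLp.norm_apply_le (linePt t - φ x₀) 1).trans_lt this
        rw [mem_ball_iff_norm]
        simpa [linePt] using h2
    _ < ⊤ := by
        rw [setLIntegral_const]
        exact ENNReal.mul_lt_top ENNReal.ofReal_lt_top measure_ball_lt_top

instance : IsFiniteMeasure (bdryLength M) := ⟨bdryLength_lt_top⟩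

/-- Non-empty open sets have positive area. -/
theorem area_pos {x₀ : M} {V : Set M} (hVo : IsOpen V) (hxV : x₀ ∈ V) : 0 < area M V := by
  set φ := extChartAt (𝓡∂ 2) x₀ with hφ
  set q := φ x₀ with hq
  have hqT : q ∈ φ.target := mem_extChartAt_target x₀
  have h1 : chartArea x₀ V ≤ area M V := by
    rw [← area_restrict_source x₀]; exact Measure.restrict_apply_le _ _
  refine lt_of_lt_of_le ?_ h1
  rw [chartArea_apply x₀ hVo.measurableSet]
  have hm := measurableSet_inter_preimage (continuousOn_extChartAt_symm (I := 𝓡∂ 2) x₀)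
    (measurableSet_target x₀) hVo.measurableSet
  have hm' : Measurable fun y => (φ.target ∩ φ.symm ⁻¹' V).indicator
      (fun y => ENNReal.ofReal (areaDensity x₀ y)) y :=
    measurable_indicator_of_continuousOn
      (ENNReal.continuous_ofReal.comp_continuousOn
        ((continuousOn_areaDensity x₀).mono inter_subset_left)) hm
  rw [← lintegral_indicator hm, lintegral_pos_iff_support hm']
  have hnhds : φ.target ∩ φ.symm ⁻¹' V ∈ 𝓝[halfPlane] q := by
    refine inter_mem (target_mem_nhdsWithin hqT) ?_
    have hc : ContinuousWithinAt φ.symm halfPlane q :=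
      ((continuousOn_extChartAt_symm x₀) _ hqT).mono_of_mem_nhdsWithin (target_mem_nhdsWithin hqT)
    refine hc.preimage_mem_nhdsWithin (hVo.mem_nhds ?_)
    rw [hq, φ.left_inv (mem_extChartAt_source x₀)]; exact hxV
  obtain ⟨r, hr, hrs⟩ := Metric.mem_nhdsWithin_iff.1 hnhds
  have hq0 : 0 ≤ q 0 := target_subset_halfPlane x₀ hqT
  have hopen : IsOpen (Metric.ball q r ∩ {y : Plane | 0 < y 0}) :=
    Metric.isOpen_ball.inter (isOpen_lt continuous_const (by fun_prop))
  refine (hopen.measure_pos volume ⟨q + (r / 2) • EuclideanSpace.single 0 (1 : ℝ), ?_, ?_⟩).trans_le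
    (measure_mono fun y hy => ?_)
  · rw [mem_ball_iff_norm]
    simp [norm_smul, abs_of_pos hr, hr]
  · simp; positivity
  · have hy' : y ∈ φ.target ∩ φ.symm ⁻¹' V := hrs ⟨hy.1, show (0 : ℝ) ≤ y 0 from le_of_lt hy.2⟩
    rw [Function.mem_support, indicator_of_mem hy']
    exact (ENNReal.ofReal_pos.2 (areaDensity_pos hy'.1)).ne'

end

/-! ### Global inequalities for smooth functions -/

section

/-- The Cauchy-Schwarz inequality for integrals. -/
theorem sq_integral_mul_le {α : Type*} [MeasurableSpace α] {μ : Measure α} {f g : α → ℝ}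
    (hf : Integrable (fun x => f x ^ 2) μ) (hg : Integrable (fun x => g x ^ 2) μ)
    (hfg : Integrable (fun x => f x * g x) μ) :
    (∫ x, f x * g x ∂μ) ^ 2 ≤ (∫ x, f x ^ 2 ∂μ) * ∫ x, g x ^ 2 ∂μ := by
  have h : ∀ t : ℝ, 0 ≤ (∫ x, f x ^ 2 ∂μ) * (t * t) + (2 * ∫ x, f x * g x ∂μ) * t
      + ∫ x, g x ^ 2 ∂μ := fun t => by
    have h1 : 0 ≤ ∫ x, (t * f x + g x) ^ 2 ∂μ := integral_nonneg fun x => sq_nonneg _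
    have h2 : ∫ x, (t * f x + g x) ^ 2 ∂μ = ∫ x, ((t * t) * f x ^ 2 + (2 * t) * (f x * g x))
        + g x ^ 2 ∂μ := integral_congr_ae (Eventually.of_forall fun x => by simp only []; ring)
    have ha : Integrable (fun x => (t * t) * f x ^ 2 + (2 * t) * (f x * g x)) μ :=
      (hf.const_mul _).add (hfg.const_mul _)
    rw [h2, integral_add ha hg, integral_add (hf.const_mul _) (hfg.const_mul _),
      integral_const_mul, integral_const_mul] at h1
    linarith
  have := discrim_le_zero h
  rw [discrim] at this
  nlinarith

theorem integrable_of_continuous {α : Type*} [TopologicalSpace α] [CompactSpace α]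
    [MeasurableSpace α] [BorelSpace α] {μ : Measure α} [IsFiniteMeasure μ] {f : α → ℝ}
    (hf : Continuous f) : Integrable f μ :=
  hf.integrable_of_hasCompactSupport (HasCompactSupport.of_compactSpace f)

variable {M : Type*} [TopologicalSpace M] [ChartedSpace (EuclideanHalfSpace 2) M]

/-- A finite smooth partition of unity on a closed set, subordinate to given neighbourhoods. -/
theorem exists_finite_partition [T2Space M] [CompactSpace M] [IsManifold (𝓡∂ 2) ∞ M] {S : Set M}
    (hS : IsClosed S) {V : M → Set M} (hV : ∀ x, IsOpen (V x)) (hx : ∀ x ∈ S, x ∈ V x) :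
    ∃ (t : Finset M) (χ : M → M → ℝ), (∀ i ∈ t, i ∈ S) ∧ (∀ i ∈ t, IsSmooth (χ i)) ∧
      (∀ i ∈ t, ∀ x, 0 ≤ χ i x) ∧ (∀ i ∈ t, tsupport (χ i) ⊆ V i) ∧
      (∀ x ∈ S, ∑ i ∈ t, χ i x = 1) ∧ ∀ x, ∑ i ∈ t, χ i x ≤ 1 := by
  classical
  obtain ⟨t, htS, ht⟩ := hS.isCompact.elim_nhds_subcover V fun x hxS => (hV x).mem_nhds (hx x hxS)
  obtain ⟨f, hf⟩ := SmoothPartitionOfUnity.exists_isSubordinate (𝓡∂ 2) hS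
    (fun i : t => V i) (fun i => hV i) (by simpa [iUnion_subtype] using ht)
  refine ⟨t, fun i => if h : i ∈ t then f ⟨i, h⟩ else 0, htS, fun i hi => ?_, fun i hi x => ?_,
    fun i hi => ?_, fun x hxS => ?_, fun x => ?_⟩
  · simp only [hi, dif_pos]; exact (f ⟨i, hi⟩).contMDiff
  · simp only [hi, dif_pos]; exact f.nonneg _ x
  · simp only [hi, dif_pos]; exact hf ⟨i, hi⟩
  · have := f.sum_eq_one hxS
    rw [finsum_eq_sum_of_fintype] at this
    rw [← this, ← Finset.sum_coe_sort]
    exact Finset.sum_congr rfl fun i _ => by simp [i.2]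
  · have := f.sum_le_one x
    rw [finsum_eq_sum_of_fintype] at this
    refine le_trans (le_of_eq ?_) this
    rw [← Finset.sum_coe_sort]
    exact Finset.sum_congr rfl fun i _ => by simp [i.2]

theorem IsSmooth.mul {f g : M → ℝ} (hf : IsSmooth f) (hg : IsSmooth g) :
    IsSmooth (fun x => f x * g x) := ContMDiff.mul hf hg

variable [RiemannianBundle (fun x : M => TangentSpace (𝓡∂ 2) x)]

theorem norm_grad_mul_le {χ w : M → ℝ} (hχ : IsSmooth χ) (hw : IsSmooth w) (x : M) :
    ‖grad (fun x => χ x * w x) x‖ ≤ |χ x| * ‖grad w x‖ + |w x| * ‖grad χ x‖ := by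
  rw [grad_mul (hχ.mdifferentiableAt x) (hw.mdifferentiableAt x)]
  refine (norm_add_le _ _).trans_eq ?_
  rw [norm_smul, norm_smul, Real.norm_eq_abs, Real.norm_eq_abs]

variable [CompactSpace M] [IsManifold (𝓡∂ 2) ∞ M]
  [IsContMDiffRiemannianBundle (𝓡∂ 2) ∞ (EuclideanSpace ℝ (Fin 2))
      (fun x : M => TangentSpace (𝓡∂ 2) x)]

theorem exists_norm_grad_le {f : M → ℝ} (hf : IsSmooth f) : ∃ C, 0 ≤ C ∧ ∀ x, ‖grad f x‖ ≤ C := by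
  obtain ⟨C, hC⟩ := (isCompact_univ (X := M)).exists_bound_of_continuousOn
    hf.continuous_norm_grad.continuousOn
  exact ⟨max C 0, le_max_right _ _, fun x =>
    (le_abs_self _).trans ((hC x (mem_univ x)).trans (le_max_left _ _))⟩

variable [MeasurableSpace M] [BorelSpace M]

theorem exists_nhds_trace_integral_le (x₀ : M) {ε : ℝ} (hε : 0 < ε) :
    ∃ V : Set M, IsOpen V ∧ x₀ ∈ V ∧ ∀ v : M → ℝ, IsSmooth v → tsupport v ⊆ V →
      ∫ x, |v x| ∂(bdryLength M) ≤ (1 + ε) * ∫ x, ‖grad v x‖ ∂(area M) := by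
  obtain ⟨V, hV, hx, h⟩ := exists_nhds_trace_le x₀ hε
  refine ⟨V, hV, hx, fun v hv hvs => ?_⟩
  have h1 := h v hv hvs
  rw [← ofReal_integral_norm_eq_lintegral_enorm (integrable_of_continuous hv.continuous),
    ← ofReal_integral_eq_lintegral_ofReal (integrable_of_continuous hv.continuous_norm_grad)
      (Eventually.of_forall fun x => norm_nonneg _), ← ENNReal.ofReal_mul (by positivity)] at h1
  exact (ENNReal.ofReal_le_ofReal_iff
    (mul_nonneg (by positivity) (integral_nonneg fun x => norm_nonneg _))).1 h1

theorem exists_nhds_sobolev_integral_le (x₀ : M) :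
    ∃ V : Set M, IsOpen V ∧ x₀ ∈ V ∧ ∃ C : ℝ, 0 ≤ C ∧ ∀ v : M → ℝ, IsSmooth v → tsupport v ⊆ V →
      ∫ x, v x ^ 2 ∂(area M) ≤ C * (∫ x, ‖grad v x‖ ∂(area M)) ^ 2 := by
  obtain ⟨V, hV, hx, C, hC, h⟩ := exists_nhds_sobolev_le x₀
  refine ⟨V, hV, hx, C, hC, fun v hv hvs => ?_⟩
  have h1 := h v hv hvs
  have h2 : ∀ x, ‖v x‖ₑ ^ 2 = ENNReal.ofReal (v x ^ 2) := fun x => by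
    rw [Real.enorm_eq_ofReal_abs, ← ENNReal.ofReal_pow (abs_nonneg _), sq_abs]
  have h3 : 0 ≤ ∫ x, ‖grad v x‖ ∂(area M) := integral_nonneg fun x => norm_nonneg _
  simp only [h2] at h1
  rw [← ofReal_integral_eq_lintegral_ofReal (f := fun x => v x ^ 2)
      (integrable_of_continuous (hv.continuous.pow 2))
      (Eventually.of_forall fun x => sq_nonneg _),
    ← ofReal_integral_eq_lintegral_ofReal (integrable_of_continuous hv.continuous_norm_grad)
      (Eventually.of_forall fun x => norm_nonneg _), ← ENNReal.ofReal_pow h3,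
    ← ENNReal.ofReal_mul hC] at h1
  exact (ENNReal.ofReal_le_ofReal_iff (by positivity)).1 h1

/-- Cutting off costs a multiple of the function in the integral of the gradient. -/
theorem integral_norm_grad_mul_le {χ w : M → ℝ} (hχ : IsSmooth χ) (hw : IsSmooth w)
    (h1 : ∀ x, |χ x| ≤ 1) {D : ℝ} (hD0 : 0 ≤ D) (hD : ∀ x, ‖grad χ x‖ ≤ D) :
    ∫ x, ‖grad (fun x => χ x * w x) x‖ ∂(area M) ≤
      (1 + D) * (∫ x, |w x| ∂(area M) + ∫ x, ‖grad w x‖ ∂(area M)) := by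
  have i1 : Integrable (fun x => |w x|) (area M) := integrable_of_continuous hw.continuous.abs
  have i2 : Integrable (fun x => ‖grad w x‖) (area M) :=
    integrable_of_continuous hw.continuous_norm_grad
  rw [← integral_add i1 i2, ← integral_const_mul]
  refine integral_mono (integrable_of_continuous (hχ.mul hw).continuous_norm_grad)
    ((i1.add i2).const_mul _) fun x => ?_
  have a := abs_nonneg (w x)
  have b := norm_nonneg (grad w x)
  refine (norm_grad_mul_le hχ hw x).trans ?_
  have e1 := mul_le_mul_of_nonneg_right (h1 x) b
  have e2 := mul_le_mul_of_nonneg_left (hD x) a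
  nlinarith [mul_nonneg hD0 b]

variable [T2Space M]

/-- The Sobolev inequality `W¹'¹ ⊂ L²` on the surface. -/
theorem exists_sobolev_le : ∃ C : ℝ, 0 ≤ C ∧ ∀ w : M → ℝ, IsSmooth w →
    ∫ x, w x ^ 2 ∂(area M) ≤
      C * (∫ x, |w x| ∂(area M) + ∫ x, ‖grad w x‖ ∂(area M)) ^ 2 := by
  choose V hVo hxV C hC hV using fun x : M => exists_nhds_sobolev_integral_le x
  obtain ⟨t, χ, -, hχs, hχ0, hχV, hχ1, hχle⟩ :=
    exists_finite_partition (isClosed_univ (X := M)) hVo fun x _ => hxV x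
  have hχle1 : ∀ i ∈ t, ∀ x, |χ i x| ≤ 1 := fun i hi x => by
    rw [abs_of_nonneg (hχ0 i hi x)]
    exact (Finset.single_le_sum (fun j hj => hχ0 j hj x) hi).trans (hχle x)
  have hD : ∀ i, ∃ D, 0 ≤ D ∧ (i ∈ t → ∀ x, ‖grad (χ i) x‖ ≤ D) := fun i => by
    by_cases hi : i ∈ t
    · obtain ⟨D, h0, h⟩ := exists_norm_grad_le (hχs i hi); exact ⟨D, h0, fun _ => h⟩
    · exact ⟨0, le_rfl, fun h => (hi h).elim⟩
  choose D hD0 hD using hD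
  refine ⟨t.card * ∑ i ∈ t, C i * (1 + D i) ^ 2, mul_nonneg (Nat.cast_nonneg _)
    (Finset.sum_nonneg fun i _ => mul_nonneg (hC i) (sq_nonneg _)), fun w hw => ?_⟩
  set E := ∫ x, |w x| ∂(area M) + ∫ x, ‖grad w x‖ ∂(area M) with hE
  have hloc : ∀ i ∈ t, ∫ x, (χ i x * w x) ^ 2 ∂(area M) ≤ C i * (1 + D i) ^ 2 * E ^ 2 := by
    intro i hi
    have h1 := hV i (fun x => χ i x * w x) ((hχs i hi).mul hw)
      ((tsupport_mul_subset_left (g := w)).trans (hχV i hi))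
    have h2 := integral_norm_grad_mul_le (hχs i hi) hw (hχle1 i hi) (hD0 i) (hD i hi)
    have h3 : 0 ≤ ∫ x, ‖grad (fun x => χ i x * w x) x‖ ∂(area M) :=
      integral_nonneg fun x => norm_nonneg _
    refine h1.trans ?_
    rw [mul_assoc, ← mul_pow]
    exact mul_le_mul_of_nonneg_left (pow_le_pow_left₀ h3 h2 2) (hC i)
  have hint : ∀ i ∈ t, Integrable (fun x => (χ i x * w x) ^ 2) (area M) := fun i hi =>
    integrable_of_continuous (((hχs i hi).mul hw).continuous.pow 2)
  calc ∫ x, w x ^ 2 ∂(area M) ≤ ∫ x, t.card * ∑ i ∈ t, (χ i x * w x) ^ 2 ∂(area M) := by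
        refine integral_mono (integrable_of_continuous (hw.continuous.pow 2))
          ((integrable_finsetSum _ hint).const_mul _) fun x => ?_
        have := sq_sum_le_card_mul_sum_sq (s := t) (f := fun i => χ i x * w x)
        rwa [← Finset.sum_mul, hχ1 x (mem_univ x), one_mul] at this
    _ = t.card * ∑ i ∈ t, ∫ x, (χ i x * w x) ^ 2 ∂(area M) := by
        rw [integral_const_mul, integral_finsetSum _ hint]
    _ ≤ t.card * ∑ i ∈ t, C i * (1 + D i) ^ 2 * E ^ 2 := by
        gcongr with i hi
        exact hloc i hi
    _ = _ := by rw [← Finset.sum_mul, mul_assoc]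

/-- The trace inequality `W¹'¹(Σ) → L¹(∂Σ)`. -/
theorem exists_trace_le : ∃ C : ℝ, 0 ≤ C ∧ ∀ w : M → ℝ, IsSmooth w →
    ∫ x, |w x| ∂(bdryLength M) ≤
      C * (∫ x, |w x| ∂(area M) + ∫ x, ‖grad w x‖ ∂(area M)) := by
  choose V hVo hxV hV using fun x : M => exists_nhds_trace_integral_le x one_pos
  obtain ⟨t, χ, -, hχs, hχ0, hχV, hχ1, hχle⟩ :=
    exists_finite_partition (isClosed_univ (X := M)) hVo fun x _ => hxV x
  have hχle1 : ∀ i ∈ t, ∀ x, |χ i x| ≤ 1 := fun i hi x => by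
    rw [abs_of_nonneg (hχ0 i hi x)]
    exact (Finset.single_le_sum (fun j hj => hχ0 j hj x) hi).trans (hχle x)
  have hD : ∀ i, ∃ D, 0 ≤ D ∧ (i ∈ t → ∀ x, ‖grad (χ i) x‖ ≤ D) := fun i => by
    by_cases hi : i ∈ t
    · obtain ⟨D, h0, h⟩ := exists_norm_grad_le (hχs i hi); exact ⟨D, h0, fun _ => h⟩
    · exact ⟨0, le_rfl, fun h => (hi h).elim⟩
  choose D hD0 hD using hD
  refine ⟨∑ i ∈ t, (1 + 1) * (1 + D i), Finset.sum_nonneg fun i _ => by linarith [hD0 i],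
    fun w hw => ?_⟩
  set E := ∫ x, |w x| ∂(area M) + ∫ x, ‖grad w x‖ ∂(area M) with hE
  have hint : ∀ i ∈ t, Integrable (fun x => |χ i x * w x|) (bdryLength M) := fun i hi =>
    integrable_of_continuous (((hχs i hi).mul hw).continuous.abs)
  calc ∫ x, |w x| ∂(bdryLength M) = ∫ x, ∑ i ∈ t, |χ i x * w x| ∂(bdryLength M) := by
        refine integral_congr_ae (Eventually.of_forall fun x => ?_)
        simp only [abs_mul]
        rw [← Finset.sum_mul, Finset.sum_congr rfl fun i hi => abs_of_nonneg (hχ0 i hi x),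
          hχ1 x (mem_univ x), one_mul]
    _ = ∑ i ∈ t, ∫ x, |χ i x * w x| ∂(bdryLength M) := integral_finsetSum _ hint
    _ ≤ ∑ i ∈ t, (1 + 1) * (1 + D i) * E := by
        refine Finset.sum_le_sum fun i hi => ?_
        refine (hV i _ ((hχs i hi).mul hw)
          ((tsupport_mul_subset_left (g := w)).trans (hχV i hi))).trans ?_
        rw [mul_assoc]
        exact mul_le_mul_of_nonneg_left
          (integral_norm_grad_mul_le (hχs i hi) hw (hχle1 i hi) (hD0 i) (hD i hi)) (by norm_num)
    _ = _ := by rw [← Finset.sum_mul]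

theorem isCompact_bdry : IsCompact (bdry M) := isClosed_bdry.isCompact

theorem integrable_bdryLength_of_continuousOn {h : M → ℝ} (hh : ContinuousOn h (bdry M)) :
    Integrable h (bdryLength M) := by
  rw [← bdryLength_restrict_bdry]
  exact hh.integrableOn_compact isCompact_bdry

theorem ae_bdryLength_of_forall {P : M → Prop} (h : ∀ x ∈ bdry M, P x) :
    ∀ᵐ x ∂(bdryLength M), P x := by
  rw [← bdryLength_restrict_bdry]
  exact (ae_restrict_iff' isClosed_bdry.measurableSet).2 (Eventually.of_forall h)

/-- The weighted trace inequality with a sharp constant in front of the gradient: near a boundary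
point the weights `|h|` and `√|K|` are almost constant, and their ratio is at most `D`. -/
theorem exists_weighted_trace_le {K h : M → ℝ} (hK : Continuous K) (hh : ContinuousOn h (bdry M))
    (hK0 : ∀ x ∈ bdry M, K x ≠ 0) {D : ℝ} (hD0 : 0 ≤ D) (hD : ∀ x ∈ bdry M, |h x| ≤ D * √|K x|)
    {ε : ℝ} (hε : 0 < ε) :
    ∃ C : ℝ, 0 ≤ C ∧ ∀ w : M → ℝ, IsSmooth w → (∀ x, 0 ≤ w x) →
      ∫ x, |h x| * w x ∂(bdryLength M) ≤ (D + ε) * ∫ x, √|K x| * ‖grad w x‖ ∂(area M)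
        + C * ∫ x, √|K x| * w x ∂(area M) := by
  have hKc : Continuous fun x => √|K x| := hK.abs.sqrt
  set ε' : ℝ := (ε / 3) / (D + ε / 3) with hε'
  have hε'0 : 0 < ε' := by positivity
  have hε'e : (1 + ε') * (D + ε / 3) = D + 2 * (ε / 3) := by
    rw [hε', add_mul, div_mul_cancel₀ _ (by positivity)]; ring
  have hloc : ∀ q : M, ∃ V : Set M, IsOpen V ∧ (q ∈ bdry M → q ∈ V) ∧
      (q ∈ bdry M → ∃ c : ℝ, 0 ≤ c ∧ (∀ x ∈ V ∩ bdry M, |h x| ≤ c) ∧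
      (∀ x ∈ V, (1 + ε') * c ≤ (D + ε) * √|K x|) ∧ ∀ v : M → ℝ, IsSmooth v → tsupport v ⊆ V →
      ∫ x, |v x| ∂(bdryLength M) ≤ (1 + ε') * ∫ x, ‖grad v x‖ ∂(area M)) := by
    intro q
    by_cases hq : q ∈ bdry M
    swap
    -- nothing is asked of the neighbourhood of an interior point
    · exact ⟨∅, isOpen_empty, fun h => (hq h).elim, fun h => (hq h).elim⟩
    obtain ⟨V, hVo, hqV, hV⟩ := exists_nhds_trace_integral_le q hε'0
    have hk : 0 < √|K q| := Real.sqrt_pos.2 (abs_pos.2 (hK0 q hq))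
    set c : ℝ := (D + ε / 3) * √|K q| with hc
    have h1 : ∀ᶠ x in 𝓝[bdry M] q, |h x| < c := by
      refine (hh.abs q hq).eventually_lt continuousWithinAt_const ?_
      exact (hD q hq).trans_lt (mul_lt_mul_of_pos_right (by linarith) hk)
    have h2 : ∀ᶠ x in 𝓝 q, (1 + ε') * c < (D + ε) * √|K x| := by
      refine continuousAt_const.eventually_lt (continuous_const.mul hKc).continuousAt ?_
      rw [hc, ← mul_assoc, hε'e]
      exact mul_lt_mul_of_pos_right (by linarith) hk
    obtain ⟨W, hW, hWo, hqW⟩ := mem_nhds_iff.1 ((eventually_nhdsWithin_iff.1 h1).and h2)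
    refine ⟨V ∩ W, hVo.inter hWo, fun _ => ⟨hqV, hqW⟩, fun _ => ⟨c, by positivity, ?_, ?_, ?_⟩⟩
    · exact fun x hx => ((hW hx.1.2).1 hx.2).le
    · exact fun x hx => (hW hx.2).2.le
    · exact fun v hv hvs => hV v hv (hvs.trans inter_subset_left)
  choose V hVo hqV hloc using hloc
  obtain ⟨t, χ, htS, hχs, hχ0, hχV, hχ1, hχle⟩ := exists_finite_partition isClosed_bdry hVo hqV
  have hDχ : ∀ i, ∃ D, 0 ≤ D ∧ (i ∈ t → ∀ x, ‖grad (χ i) x‖ ≤ D) := fun i => by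
    by_cases hi : i ∈ t
    · obtain ⟨D, h0, h⟩ := exists_norm_grad_le (hχs i hi); exact ⟨D, h0, fun _ => h⟩
    · exact ⟨0, le_rfl, fun h => (hi h).elim⟩
  choose Dχ hDχ0 hDχ using hDχ
  refine ⟨∑ i ∈ t, Dχ i * (D + ε), Finset.sum_nonneg fun i _ =>
    mul_nonneg (hDχ0 i) (by positivity), fun w hw hw0 => ?_⟩
  have hhw : ContinuousOn (fun x => |h x| * w x) (bdry M) := hh.abs.mul hw.continuous.continuousOn
  have hg : Continuous fun x => ‖grad w x‖ := hw.continuous_norm_grad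
  have hi1 : ∀ i ∈ t, Integrable (fun x => χ i x * (√|K x| * ‖grad w x‖)) (area M) := fun i hi =>
    integrable_of_continuous ((hχs i hi).continuous.mul (hKc.mul hg))
  have hi2 : Integrable (fun x => √|K x| * w x) (area M) :=
    integrable_of_continuous (hKc.mul hw.continuous)
  have hterm : ∀ i ∈ t, ∫ x, χ i x * (|h x| * w x) ∂(bdryLength M) ≤
      (D + ε) * ∫ x, χ i x * (√|K x| * ‖grad w x‖) ∂(area M)
        + Dχ i * (D + ε) * ∫ x, √|K x| * w x ∂(area M) := by
    intro i hi
    obtain ⟨c, hc0, hc1, hc2, hc3⟩ := hloc i (htS i hi)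
    have hsm : IsSmooth fun x => χ i x * w x := (hχs i hi).mul hw
    calc ∫ x, χ i x * (|h x| * w x) ∂(bdryLength M)
        ≤ ∫ x, c * |χ i x * w x| ∂(bdryLength M) := by
          refine integral_mono_ae (integrable_bdryLength_of_continuousOn
            ((hχs i hi).continuous.continuousOn.mul hhw))
            (integrable_of_continuous (continuous_const.mul hsm.continuous.abs))
            (ae_bdryLength_of_forall fun x hx => ?_)
          simp only []
          rw [abs_of_nonneg (mul_nonneg (hχ0 i hi x) (hw0 x))]
          by_cases hxV : x ∈ V i
          · have := mul_le_mul_of_nonneg_right (hc1 x ⟨hxV, hx⟩)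
              (mul_nonneg (hχ0 i hi x) (hw0 x))
            linarith
          · rw [image_eq_zero_of_notMem_tsupport fun h => hxV (hχV i hi h)]; simp
      _ = c * ∫ x, |χ i x * w x| ∂(bdryLength M) := integral_const_mul _ _
      _ ≤ c * ((1 + ε') * ∫ x, ‖grad (fun x => χ i x * w x) x‖ ∂(area M)) :=
          mul_le_mul_of_nonneg_left (hc3 _ hsm
            ((tsupport_mul_subset_left (g := w)).trans (hχV i hi))) hc0
      _ = ∫ x, (1 + ε') * c * ‖grad (fun x => χ i x * w x) x‖ ∂(area M) := by
          rw [integral_const_mul]; ring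
      _ ≤ ∫ x, (D + ε) * (χ i x * (√|K x| * ‖grad w x‖))
            + Dχ i * (D + ε) * (√|K x| * w x) ∂(area M) := by
          refine integral_mono (integrable_of_continuous
            (continuous_const.mul hsm.continuous_norm_grad))
            (((hi1 i hi).const_mul _).add (hi2.const_mul _)) fun x => ?_
          by_cases hxV : x ∈ tsupport (χ i)
          · have h1 := norm_grad_mul_le (hχs i hi) hw x
            rw [abs_of_nonneg (hχ0 i hi x), abs_of_nonneg (hw0 x)] at h1
            have h2 := hc2 x (hχV i hi hxV)
            have h3 : 0 ≤ (1 + ε') * c := by positivity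
            have h4 := hDχ i hi x
            have h5 : χ i x * ‖grad w x‖ + w x * ‖grad (χ i) x‖ ≤
                χ i x * ‖grad w x‖ + w x * Dχ i := by
              have := mul_le_mul_of_nonneg_left h4 (hw0 x); linarith
            have h6 : 0 ≤ χ i x * ‖grad w x‖ + w x * Dχ i :=
              add_nonneg (mul_nonneg (hχ0 i hi x) (norm_nonneg _)) (mul_nonneg (hw0 x) (hDχ0 i))
            calc _ ≤ (1 + ε') * c * (χ i x * ‖grad w x‖ + w x * Dχ i) :=
                  mul_le_mul_of_nonneg_left (h1.trans h5) h3
              _ ≤ (D + ε) * √|K x| * (χ i x * ‖grad w x‖ + w x * Dχ i) :=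
                  mul_le_mul_of_nonneg_right h2 h6
              _ = _ := by ring
          · have h1 : ‖grad (fun x => χ i x * w x) x‖ = 0 := by
              rw [grad_eq_zero_of_notMem_tsupport fun h => hxV (tsupport_mul_subset_left h)]
              exact norm_zero
            simp only [h1, image_eq_zero_of_notMem_tsupport hxV, mul_zero, zero_mul, zero_add]
            exact mul_nonneg (mul_nonneg (hDχ0 i) (by positivity))
              (mul_nonneg (Real.sqrt_nonneg _) (hw0 x))
      _ = _ := by
          rw [integral_add ((hi1 i hi).const_mul _) (hi2.const_mul _), integral_const_mul,
            integral_const_mul]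
  calc ∫ x, |h x| * w x ∂(bdryLength M)
      = ∫ x, ∑ i ∈ t, χ i x * (|h x| * w x) ∂(bdryLength M) := by
        refine integral_congr_ae (ae_bdryLength_of_forall fun x hx => ?_)
        show |h x| * w x = ∑ i ∈ t, χ i x * (|h x| * w x)
        rw [← Finset.sum_mul, hχ1 x hx, one_mul]
    _ = ∑ i ∈ t, ∫ x, χ i x * (|h x| * w x) ∂(bdryLength M) :=
        integral_finsetSum _ fun i hi => integrable_bdryLength_of_continuousOn
          ((hχs i hi).continuous.continuousOn.mul hhw)
    _ ≤ ∑ i ∈ t, ((D + ε) * ∫ x, χ i x * (√|K x| * ‖grad w x‖) ∂(area M)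
        + Dχ i * (D + ε) * ∫ x, √|K x| * w x ∂(area M)) := Finset.sum_le_sum hterm
    _ = (D + ε) * ∫ x, ∑ i ∈ t, χ i x * (√|K x| * ‖grad w x‖) ∂(area M)
        + (∑ i ∈ t, Dχ i * (D + ε)) * ∫ x, √|K x| * w x ∂(area M) := by
        rw [Finset.sum_add_distrib, ← Finset.mul_sum, ← Finset.sum_mul, integral_finsetSum _ hi1]
    _ ≤ _ := by
        refine add_le_add_left (mul_le_mul_of_nonneg_left ?_ (by positivity)) _
        refine integral_mono (integrable_finsetSum _ hi1)
          (integrable_of_continuous (hKc.mul hg)) fun x => ?_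
        simp only []
        rw [← Finset.sum_mul]
        exact mul_le_of_le_one_left (by positivity) (hχle x)

/-- The inequality of the theorem for smooth functions, cleared of its denominator. -/
theorem exists_smooth_inequality {K h : M → ℝ} (hK : Continuous K) (hh : ContinuousOn h (bdry M))
    (hK0 : ∀ x ∈ bdry M, K x ≠ 0) {D : ℝ} (hD0 : 0 ≤ D) (hD : ∀ x ∈ bdry M, |h x| ≤ D * √|K x|)
    {ε : ℝ} (hε : 0 < ε) :
    ∃ C : ℝ, ∀ f : M → ℝ, IsSmooth f →
      (∫ x, h x * Real.exp (f x / 2) ∂(bdryLength M)) ^ 2 ≤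
        ((D + ε) ^ 2 / 4 * ∫ x, ‖grad f x‖ ^ 2 ∂(area M) + C) *
          ∫ x, |K x| * Real.exp (f x) ∂(area M) := by
  obtain ⟨C, hC0, hC⟩ := exists_weighted_trace_le hK hh hK0 hD0 hD (half_pos hε)
  have hd : 0 < D + ε / 2 := by positivity
  set η : ℝ := (D + ε) ^ 2 / (D + ε / 2) ^ 2 - 1 with hη
  have hη0 : 0 < η := by
    rw [hη, sub_pos, one_lt_div (by positivity)]; gcongr; linarith
  have hηe : (1 + η) * (D + ε / 2) ^ 2 = (D + ε) ^ 2 := by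
    rw [hη, add_sub_cancel, div_mul_cancel₀ _ (by positivity)]
  refine ⟨(1 + 1 / η) * (C ^ 2 * (area M).real univ), fun f hf => ?_⟩
  set w : M → ℝ := fun x => Real.exp (f x / 2) with hw
  have hws : IsSmooth w := hf.comp (F := fun s => Real.exp (s / 2)) (by fun_prop)
  have hwg : ∀ x, ‖grad w x‖ = w x * ‖grad f x‖ / 2 := fun x => by
    have h1 : HasDerivAt (fun s : ℝ => Real.exp (s / 2)) (Real.exp (f x / 2) * (1 / 2)) (f x) :=
      ((hasDerivAt_id (f x)).div_const 2).exp
    rw [hw, grad_comp (hf.mdifferentiableAt x) h1, norm_smul, Real.norm_of_nonneg (by positivity)]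
    ring
  have hKc : Continuous fun x => √|K x| := hK.abs.sqrt
  have hwsq : ∀ x, (√|K x| * w x) ^ 2 = |K x| * Real.exp (f x) := fun x => by
    rw [mul_pow, Real.sq_sqrt (abs_nonneg _), hw, ← Real.exp_nat_mul]
    congr 2; push_cast; ring
  set B := ∫ x, |K x| * Real.exp (f x) ∂(area M) with hB
  set G := ∫ x, ‖grad f x‖ ^ 2 ∂(area M) with hG
  have hB0 : 0 ≤ B := integral_nonneg fun x => by positivity
  have hG0 : 0 ≤ G := integral_nonneg fun x => by positivity
  have c1 : Continuous fun x => √|K x| * w x := hKc.mul hws.continuous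
  have cg : Continuous fun x => ‖grad f x‖ := hf.continuous_norm_grad
  set I := ∫ x, √|K x| * w x * ‖grad f x‖ ∂(area M) with hI
  set J := ∫ x, √|K x| * w x * 1 ∂(area M) with hJ
  have hI2 : I ^ 2 ≤ B * G := by
    have := sq_integral_mul_le (μ := area M) (integrable_of_continuous (c1.pow 2))
      (integrable_of_continuous (cg.pow 2)) (integrable_of_continuous (c1.mul cg))
    simpa only [hwsq] using this
  have hJ2 : J ^ 2 ≤ B * (area M).real univ := by
    have := sq_integral_mul_le (μ := area M) (integrable_of_continuous (c1.pow 2))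
      (g := fun _ => 1) (integrable_of_continuous (by fun_prop))
      (integrable_of_continuous (c1.mul continuous_const))
    simpa only [hJ, hB, hwsq, one_pow, integral_const, smul_eq_mul, mul_one] using this
  have hA : |∫ x, h x * w x ∂(bdryLength M)| ≤ (D + ε / 2) / 2 * I + C * J := by
    calc |∫ x, h x * w x ∂(bdryLength M)| ≤ ∫ x, |h x * w x| ∂(bdryLength M) :=
          abs_integral_le_integral_abs
      _ = ∫ x, |h x| * w x ∂(bdryLength M) := by
          refine integral_congr_ae (Eventually.of_forall fun x => ?_)
          simp only []
          rw [abs_mul, abs_of_nonneg (Real.exp_nonneg _ : 0 ≤ w x)]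
      _ ≤ _ := hC w hws fun x => Real.exp_nonneg _
      _ = _ := by
          have e1 : ∀ x, √|K x| * ‖grad w x‖ = (1 / 2) * (√|K x| * w x * ‖grad f x‖) := fun x => by
            rw [hwg]; ring
          simp only [e1, integral_const_mul, hI, hJ, mul_one]
          ring
  have hI0 : 0 ≤ I := integral_nonneg fun x => by positivity
  have hJ0 : 0 ≤ J := integral_nonneg fun x => by positivity
  have h1 : (∫ x, h x * w x ∂(bdryLength M)) ^ 2 ≤ ((D + ε / 2) / 2 * I + C * J) ^ 2 := by
    rw [← sq_abs (∫ x, h x * w x ∂(bdryLength M))]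
    exact pow_le_pow_left₀ (abs_nonneg _) hA 2
  -- Young's inequality `(a + b)² ≤ (1 + η) a² + (1 + 1/η) b²` absorbs the lower order term
  have h2 : ∀ a b : ℝ, (a + b) ^ 2 ≤ (1 + η) * a ^ 2 + (1 + 1 / η) * b ^ 2 := fun a b => by
    have : 0 ≤ (η * a - b) ^ 2 / η := by positivity
    have e : (1 + η) * a ^ 2 + (1 + 1 / η) * b ^ 2 - (a + b) ^ 2 = (η * a - b) ^ 2 / η := by
      field_simp; ring
    linarith
  refine h1.trans ((h2 _ _).trans ?_)
  have h3 : (1 + η) * ((D + ε / 2) / 2 * I) ^ 2 = (D + ε) ^ 2 / 4 * I ^ 2 := by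
    rw [← hηe]; ring
  rw [h3, mul_pow]
  have h4 := mul_le_mul_of_nonneg_left hI2 (show 0 ≤ (D + ε) ^ 2 / 4 by positivity)
  have h5 := mul_le_mul_of_nonneg_left hJ2 (show 0 ≤ (1 + 1 / η) * C ^ 2 by positivity)
  nlinarith

end

/-! ### Closedness of weak derivatives in the plane -/

section

theorem tendsto_integral_mul_of_tendsto_lintegral {α : Type*} [TopologicalSpace α]
    [MeasurableSpace α] [BorelSpace α] [R1Space α] {μ : Measure α} {η : α → ℝ} (hη : Continuous η)
    (hc : HasCompactSupport η) {F : ℕ → α → ℝ} {f : α → ℝ}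
    (hF : ∀ k, IntegrableOn (F k) (tsupport η) μ) (hf : IntegrableOn f (tsupport η) μ)
    (h : Tendsto (fun k => ∫⁻ x in tsupport η, ‖F k x - f x‖ₑ ∂μ) atTop (𝓝 0)) :
    (∀ k, Integrable (fun x => η x * F k x) μ) ∧
    Tendsto (fun k => ∫ x, η x * F k x ∂μ) atTop (𝓝 (∫ x, η x * f x ∂μ)) := by
  have hm : MeasurableSet (tsupport η) := (isClosed_tsupport η).measurableSet
  obtain ⟨C, hC⟩ := hc.exists_bound_of_continuous hη
  have hzero : ∀ (g : α → ℝ) x, x ∉ tsupport η → η x * g x = 0 := fun g x hx => by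
    rw [image_eq_zero_of_notMem_tsupport hx, zero_mul]
  have hset : ∀ g : α → ℝ, ∫ x, η x * g x ∂μ = ∫ x in tsupport η, η x * g x ∂μ := fun g =>
    (setIntegral_eq_integral_of_forall_compl_eq_zero (hzero g)).symm
  have hint : ∀ g : α → ℝ, IntegrableOn g (tsupport η) μ →
      IntegrableOn (fun x => η x * g x) (tsupport η) μ := fun g hg =>
    hg.bdd_mul hη.aestronglyMeasurable (ae_of_all _ hC)
  refine ⟨fun k => ?_, ?_⟩
  · exact (integrableOn_iff_integrable_of_support_subset (fun x hx => by
      by_contra hx'; exact hx (hzero _ x hx'))).1 (hint _ (hF k))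
  simp only [hset]
  refine tendsto_integral_of_L1 _ (hint f hf).aestronglyMeasurable
    (Eventually.of_forall fun k => hint _ (hF k)) ?_
  have hlim : Tendsto (fun k => ENNReal.ofReal C * ∫⁻ x in tsupport η, ‖F k x - f x‖ₑ ∂μ) atTop
      (𝓝 0) := by
    simpa using ENNReal.Tendsto.const_mul h (Or.inr ENNReal.ofReal_ne_top)
  refine tendsto_of_tendsto_of_tendsto_of_le_of_le tendsto_const_nhds hlim (fun _ => zero_le)
    fun k => ?_
  show ∫⁻ x in tsupport η, ‖η x * F k x - η x * f x‖ₑ ∂μ ≤ _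
  rw [← lintegral_const_mul' _ _ ENNReal.ofReal_ne_top]
  refine lintegral_mono fun x => ?_
  rw [← mul_sub, enorm_mul]
  refine mul_le_mul_left ?_ _
  rw [← ofReal_norm]
  exact ENNReal.ofReal_le_ofReal (hC x)

/-- Weak derivatives in the plane are closed: if `G k → 0` and `∂G k → Y` in `L¹` on compact
sets, then `Y = 0`. -/
theorem ae_eq_zero_of_tendsto_fderiv {O : Set Plane} (hO : IsOpen O) {G : ℕ → Plane → ℝ}
    (hG : ∀ k, ContDiffOn ℝ ∞ (G k) O) (n : Plane) {Y : Plane → ℝ}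
    (hY : AEStronglyMeasurable Y (volume.restrict O))
    (h0 : ∀ B ⊆ O, IsCompact B → Tendsto (fun k => ∫⁻ y in B, ‖G k y‖ₑ) atTop (𝓝 0))
    (h1 : ∀ B ⊆ O, IsCompact B →
      Tendsto (fun k => ∫⁻ y in B, ‖fderiv ℝ (G k) y n - Y y‖ₑ) atTop (𝓝 0)) :
    ∀ᵐ y ∂(volume : Measure Plane), y ∈ O → Y y = 0 := by
  have hD : ∀ k, ContinuousOn (fun y => fderiv ℝ (G k) y n) O := fun k =>
    (((hG k).continuousOn_fderiv_of_isOpen hO (by simp)).clm_apply continuousOn_const)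
  have hYint : ∀ B ⊆ O, IsCompact B → IntegrableOn Y B := fun B hB hBc => by
    have hDY : ∀ k, AEStronglyMeasurable (fun y => fderiv ℝ (G k) y n - Y y)
        (volume.restrict B) := fun k =>
      (((hD k).mono hB).aestronglyMeasurable hBc.measurableSet).sub
        (hY.mono_measure (Measure.restrict_mono hB le_rfl))
    obtain ⟨k, hk⟩ := ((h1 B hB hBc).eventually (gt_mem_nhds ENNReal.zero_lt_top)).exists
    have i1 : IntegrableOn (fun y => fderiv ℝ (G k) y n - Y y) B := ⟨hDY k, hk⟩
    have i2 : IntegrableOn (fun y => fderiv ℝ (G k) y n) B :=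
      ((hD k).mono hB).integrableOn_compact hBc
    exact (i2.sub i1).congr (ae_of_all _ fun y => by simp)
  refine hO.ae_eq_zero_of_integral_contDiff_smul_eq_zero
    ((locallyIntegrableOn_iff hO.isLocallyClosed).2 fun B hB hBc => hYint B hB hBc) ?_
  intro η hη hc hsub
  have hη1 : ContDiff ℝ 1 η := hη.of_le (by simp)
  have hdη : Continuous fun y => fderiv ℝ η y n :=
    (hη1.continuous_fderiv (by simp)).clm_apply continuous_const
  have hsub' : tsupport (fun y => fderiv ℝ η y n) ⊆ tsupport η :=
    (tsupport_fderiv_apply_subset ℝ n)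
  have hcd : HasCompactSupport fun y => fderiv ℝ η y n := hc.fderiv_apply (𝕜 := ℝ) n
  obtain ⟨iD, lD⟩ := tendsto_integral_mul_of_tendsto_lintegral hη.continuous hc
    (F := fun k y => fderiv ℝ (G k) y n)
    (fun k => ((hD k).mono hsub).integrableOn_compact hc) (hYint _ hsub hc) (h1 _ hsub hc)
  obtain ⟨iG, lG⟩ := tendsto_integral_mul_of_tendsto_lintegral hdη hcd
    (F := G) (f := fun _ => 0) (fun k => ((hG k).continuousOn.mono
      (hsub'.trans hsub)).integrableOn_compact hcd) integrableOn_zero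
    (by simpa using h0 _ (hsub'.trans hsub) hcd)
  have hparts : ∀ k, ∫ y, η y * fderiv ℝ (G k) y n = -∫ y, fderiv ℝ η y n * G k y := fun k => by
    refine integral_mul_fderiv_eq_neg_fderiv_mul_of_integrable (iG k) (iD k) ?_
      (fun x _ => (hη1.differentiable (by simp)) x) (fun x hx => ?_)
    · exact (integrableOn_iff_integrable_of_support_subset (s := tsupport η) (fun x hx => by
        by_contra hx'
        exact hx (by simp [image_eq_zero_of_notMem_tsupport hx']))).1
        ((hη.continuous.continuousOn.mul ((hG k).continuousOn.mono hsub)).integrableOn_compact hc)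
    · exact ((hG k).differentiableOn (by simp)).differentiableAt (hO.mem_nhds (hsub hx))
  simp only [hparts] at lD
  have := tendsto_nhds_unique lD lG.neg
  simpa using this

end

/-! ### Null sets in charts -/

section

variable {M : Type*} [TopologicalSpace M] [ChartedSpace (EuclideanHalfSpace 2) M]

theorem tendsto_lintegral_enorm_of_eLpNorm_two {α : Type*} [MeasurableSpace α] {μ : Measure α}
    [IsFiniteMeasure μ] {f : ℕ → α → ℝ} (hf : ∀ n, AEStronglyMeasurable (f n) μ)
    (h : Tendsto (fun n => eLpNorm (f n) 2 μ) atTop (𝓝 0)) :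
    Tendsto (fun n => ∫⁻ x, ‖f n x‖ₑ ∂μ) atTop (𝓝 0) := by
  simp only [← eLpNorm_one_eq_lintegral_enorm]
  set c : ℝ≥0∞ := μ univ ^ (1 / (1 : ℝ≥0∞).toReal - 1 / (2 : ℝ≥0∞).toReal) with hc
  have hct : c ≠ ⊤ := ENNReal.rpow_ne_top_of_nonneg (by norm_num) (measure_ne_top _ _)
  have hlim : Tendsto (fun n => eLpNorm (f n) 2 μ * c) atTop (𝓝 0) := by
    simpa using ENNReal.Tendsto.mul_const h (Or.inr hct)
  exact tendsto_of_tendsto_of_tendsto_of_le_of_le tendsto_const_nhds hlim (fun _ => zero_le)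
    fun n => eLpNorm_le_eLpNorm_mul_rpow_measure_univ (by norm_num) (hf n)

theorem exists_seq_tendsto_ae_of_eLpNorm {α : Type*} [MeasurableSpace α] {μ : Measure α}
    {f : ℕ → α → ℝ} (hf : ∀ n, AEStronglyMeasurable (f n) μ)
    (h : Tendsto (fun n => eLpNorm (f n) 2 μ) atTop (𝓝 0)) :
    ∃ ns : ℕ → ℕ, StrictMono ns ∧ ∀ᵐ x ∂μ, Tendsto (fun i => f (ns i) x) atTop (𝓝 0) :=
  (tendstoInMeasure_of_tendsto_eLpNorm (g := fun _ => (0 : ℝ)) (p := 2) (by norm_num) hf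
    aestronglyMeasurable_const (h.congr fun n => by
      congr 1; ext x; simp)).exists_seq_tendsto_ae

/-- Almost every point of a chart domain is interior, because the others lie on the boundary
line. -/
theorem ae_mem_interior_target (p : M) : ∀ᵐ y ∂(volume : Measure Plane),
    y ∈ (extChartAt (𝓡∂ 2) p).target → y ∈ interior (extChartAt (𝓡∂ 2) p).target := by
  have hline : ∀ᵐ y ∂(volume : Measure Plane), y 0 ≠ 0 := by
    have hm : Measurable fun y : Plane => y 0 := by fun_prop
    have hms : MeasurableSet {y : Plane | y 0 = 0} := hm (measurableSet_singleton 0)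
    rw [ae_iff]
    simp only [ne_eq, not_not]
    rw [← lintegral_indicator_one hms,
      lintegral_plane (measurable_one.indicator hms)]
    refine (lintegral_congr_ae ?_).trans lintegral_zero
    filter_upwards [compl_mem_ae_iff.2 (measure_singleton (μ := (volume : Measure ℝ)) 0)] with s hs
    refine (lintegral_congr fun t => ?_).trans lintegral_zero
    refine indicator_of_notMem ?_ _
    simpa [pt] using hs
  filter_upwards [hline] with y hy hyT
  have h1 := target_mem_nhdsWithin hyT
  have h0 : 0 < y 0 := lt_of_le_of_ne (target_subset_halfPlane p hyT) (Ne.symm hy)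
  have h2 : halfPlane ∈ 𝓝 y := by
    have hc : Continuous fun y : Plane => y 0 := by fun_prop
    filter_upwards [(isOpen_lt continuous_const hc).mem_nhds h0] with z hz using le_of_lt hz
  rw [nhdsWithin_eq_nhds.2 h2] at h1
  exact mem_interior_iff_mem_nhds.2 h1

variable [RiemannianBundle (fun x : M => TangentSpace (𝓡∂ 2) x)] [CompactSpace M]
  [IsManifold (𝓡∂ 2) ∞ M]
  [IsContMDiffRiemannianBundle (𝓡∂ 2) ∞ (EuclideanSpace ℝ (Fin 2))
      (fun x : M => TangentSpace (𝓡∂ 2) x)] [MeasurableSpace M] [BorelSpace M]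

/-- Null sets of the area are null in every chart. -/
theorem ae_chart_of_ae_area (p : M) {P : M → Prop} (h : ∀ᵐ x ∂(area M), P x) :
    ∀ᵐ y ∂(volume.restrict (extChartAt (𝓡∂ 2) p).target), P ((extChartAt (𝓡∂ 2) p).symm y) := by
  obtain ⟨A, hsub, hA, hA0⟩ := exists_measurable_superset_of_null (ae_iff.1 h)
  have h0 : chartArea p A = 0 := le_antisymm (by
    rw [← area_restrict_source p, ← hA0]; exact Measure.restrict_apply_le _ _) zero_le
  have hTA := measurableSet_inter_preimage (continuousOn_extChartAt_symm (I := 𝓡∂ 2) p)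
    (measurableSet_target p) hA
  rw [chartArea_apply p hA] at h0
  have hcont : AEMeasurable (fun y => ENNReal.ofReal (areaDensity p y))
      (volume.restrict ((extChartAt (𝓡∂ 2) p).target ∩ (extChartAt (𝓡∂ 2) p).symm ⁻¹' A)) :=
    (((continuousOn_areaDensity p).mono inter_subset_left).aemeasurable hTA).ennreal_ofReal
  rw [lintegral_eq_zero_iff' hcont, Filter.EventuallyEq, ae_restrict_iff' hTA] at h0
  rw [ae_restrict_iff' (measurableSet_target p)]
  filter_upwards [h0] with y hy hyT
  by_contra hP
  have h1 := hy ⟨hyT, hsub hP⟩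
  have h2 := areaDensity_pos hyT
  simp only [Pi.zero_apply, ENNReal.ofReal_eq_zero] at h1
  linarith

theorem setLIntegral_chart_le (p : M) {B : Set Plane} (hB : IsCompact B)
    (hBT : B ⊆ (extChartAt (𝓡∂ 2) p).target) : ∃ C : ℝ≥0∞, C ≠ ⊤ ∧ ∀ F : M → ℝ≥0∞,
      AEMeasurable F (area M) →
      ∫⁻ y in B, F ((extChartAt (𝓡∂ 2) p).symm y) ≤ C * ∫⁻ x, F x ∂(area M) := by
  have hinv : ContinuousOn (fun y => (areaDensity p y)⁻¹) B :=
    ((continuousOn_areaDensity p).mono hBT).inv₀ fun y hy => (areaDensity_pos (hBT hy)).ne'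
  obtain ⟨C, hC⟩ := hB.exists_bound_of_continuousOn hinv
  refine ⟨ENNReal.ofReal C, ENNReal.ofReal_ne_top, fun F hF => ?_⟩
  have hmk := ae_restrict_of_ae_restrict_of_subset hBT (ae_chart_of_ae_area p hF.ae_eq_mk)
  rw [lintegral_congr_ae hmk, lintegral_congr_ae hF.ae_eq_mk]
  calc ∫⁻ y in B, hF.mk F ((extChartAt (𝓡∂ 2) p).symm y)
      ≤ ∫⁻ y in B, ENNReal.ofReal C * (ENNReal.ofReal (areaDensity p y) *
          hF.mk F ((extChartAt (𝓡∂ 2) p).symm y)) := by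
        refine setLIntegral_mono' hB.measurableSet fun y hy => ?_
        have hd := areaDensity_pos (hBT hy)
        have hCy := hC y hy
        rw [Real.norm_of_nonneg (by positivity)] at hCy
        have hC0 : 0 ≤ C := le_trans (by positivity) hCy
        rw [← mul_assoc, ← ENNReal.ofReal_mul hC0]
        refine le_mul_of_one_le_left zero_le ?_
        rw [← ENNReal.ofReal_one]
        refine ENNReal.ofReal_le_ofReal ?_
        calc (1 : ℝ) = (areaDensity p y)⁻¹ * areaDensity p y := (inv_mul_cancel₀ hd.ne').symm
          _ ≤ C * areaDensity p y := by gcongr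
    _ = ENNReal.ofReal C * ∫⁻ y in B, ENNReal.ofReal (areaDensity p y) *
          hF.mk F ((extChartAt (𝓡∂ 2) p).symm y) :=
        lintegral_const_mul' _ _ ENNReal.ofReal_ne_top
    _ ≤ ENNReal.ofReal C * ∫⁻ y in (extChartAt (𝓡∂ 2) p).target,
          ENNReal.ofReal (areaDensity p y) * hF.mk F ((extChartAt (𝓡∂ 2) p).symm y) :=
        mul_le_mul_right (lintegral_mono_set hBT) _
    _ = ENNReal.ofReal C * ∫⁻ x, hF.mk F x ∂(chartArea p) := by
        rw [lintegral_chartArea p hF.measurable_mk]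
    _ ≤ ENNReal.ofReal C * ∫⁻ x, hF.mk F x ∂(area M) := by
        refine mul_le_mul_right ?_ _
        rw [← area_restrict_source p]
        exact setLIntegral_le_lintegral _ _

end

/-! ### Closability of the gradient -/

section

variable {M : Type*} [TopologicalSpace M] [ChartedSpace (EuclideanHalfSpace 2) M]
  [RiemannianBundle (fun x : M => TangentSpace (𝓡∂ 2) x)] [CompactSpace M]
  [IsManifold (𝓡∂ 2) ∞ M]
  [IsContMDiffRiemannianBundle (𝓡∂ 2) ∞ (EuclideanSpace ℝ (Fin 2))
      (fun x : M => TangentSpace (𝓡∂ 2) x)] [MeasurableSpace M] [BorelSpace M]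

/-- The component of the limit field in a constant direction of the chart vanishes almost
everywhere: there it is the `L¹` limit of derivatives of functions that tend to zero. -/
theorem IsH1Limit.ae_inner_eq_zero {g : ℕ → M → ℝ} {Y : ∀ x : M, TangentSpace (𝓡∂ 2) x}
    (h : IsH1Limit g (fun _ => 0) Y) (p : M) (n : Plane) :
    ∀ᵐ y ∂(volume : Measure Plane), y ∈ interior (extChartAt (𝓡∂ 2) p).target →
      (⟪Y ((extChartAt (𝓡∂ 2) p).symm y), n 0 • coordVec p y 0 + n 1 • coordVec p y 1⟫ : ℝ) =
        0 := by
  set O := interior (extChartAt (𝓡∂ 2) p).target with hO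
  have hOT : O ⊆ (extChartAt (𝓡∂ 2) p).target := interior_subset
  set G : ℕ → Plane → ℝ := fun k y => g k ((extChartAt (𝓡∂ 2) p).symm y) with hG
  have hderiv : ∀ k, ∀ y ∈ O, fderiv ℝ (G k) y n =
      ⟪grad (g k) ((extChartAt (𝓡∂ 2) p).symm y),
        n 0 • coordVec p y 0 + n 1 • coordVec p y 1⟫ := fun k y hy => by
    rw [← fderivWithin_chart (hOT hy) (IsSmooth.mdifferentiableAt (h.smooth k) _) n,
      fderivWithin_of_mem_nhds]
    exact mem_of_superset (isOpen_interior.mem_nhds hy) (hOT.trans (target_subset_halfPlane p))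
  have hdiff : ∀ k, ∀ y ∈ O, ‖fderiv ℝ (G k) y n - ⟪Y ((extChartAt (𝓡∂ 2) p).symm y),
      n 0 • coordVec p y 0 + n 1 • coordVec p y 1⟫‖ ≤
      ‖grad (g k) ((extChartAt (𝓡∂ 2) p).symm y) - Y ((extChartAt (𝓡∂ 2) p).symm y)‖ *
        ‖n 0 • coordVec p y 0 + n 1 • coordVec p y 1‖ := fun k y hy => by
    rw [hderiv k y hy, ← inner_sub_left]
    exact norm_inner_le_norm _ _
  have hsm : ∀ k, ContDiffOn ℝ ∞ (G k) O := fun k => (contDiffOn_chart (h.smooth k) p).mono hOT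
  refine ae_eq_zero_of_tendsto_fderiv isOpen_interior hsm n ?_ ?_ ?_
  · obtain ⟨ns, -, hns⟩ := exists_seq_tendsto_ae_of_eLpNorm h.aestronglyMeasurable h.tendsto_grad
    refine aestronglyMeasurable_of_tendsto_ae atTop (f := fun i y => fderiv ℝ (G (ns i)) y n)
      (fun i => ?_) ?_
    · exact (((hsm (ns i)).continuousOn_fderiv_of_isOpen isOpen_interior (by simp)).clm_apply
        continuousOn_const).aestronglyMeasurable isOpen_interior.measurableSet
    · have h1 := ae_restrict_of_ae_restrict_of_subset hOT (ae_chart_of_ae_area p hns)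
      filter_upwards [h1, ae_restrict_mem isOpen_interior.measurableSet] with y hy hyO
      rw [tendsto_iff_norm_sub_tendsto_zero]
      refine squeeze_zero (fun _ => norm_nonneg _) (fun i => hdiff (ns i) y hyO) ?_
      simpa using hy.mul_const ‖n 0 • coordVec p y 0 + n 1 • coordVec p y 1‖
  · intro B hB hBc
    obtain ⟨C, hC, hle⟩ := setLIntegral_chart_le p hBc (hB.trans hOT)
    have hm : ∀ k, AEStronglyMeasurable (g k) (area M) := fun k =>
      (h.smooth k).continuous.aestronglyMeasurable
    have hlim := ENNReal.Tendsto.const_mul (a := C) (tendsto_lintegral_enorm_of_eLpNorm_two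
      (μ := area M) (f := g) hm (by simpa using h.tendsto_fun)) (Or.inr hC)
    rw [mul_zero] at hlim
    exact tendsto_of_tendsto_of_tendsto_of_le_of_le tendsto_const_nhds hlim (fun _ => zero_le)
      fun k => hle (fun x => ‖g k x‖ₑ) (hm k).enorm
  · intro B hB hBc
    obtain ⟨C, hC, hle⟩ := setLIntegral_chart_le p hBc (hB.trans hOT)
    obtain ⟨D, hD⟩ := hBc.exists_bound_of_continuousOn
      ((continuousOn_norm_comb p (n 0) (n 1)).mono (hB.trans hOT))
    have hlim := ENNReal.Tendsto.const_mul (a := C * ENNReal.ofReal D)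
      (tendsto_lintegral_enorm_of_eLpNorm_two h.aestronglyMeasurable h.tendsto_grad)
      (Or.inr (ENNReal.mul_ne_top hC ENNReal.ofReal_ne_top))
    rw [mul_zero] at hlim
    refine tendsto_of_tendsto_of_tendsto_of_le_of_le tendsto_const_nhds hlim (fun _ => zero_le)
      fun k => ?_
    calc ∫⁻ y in B, ‖fderiv ℝ (G k) y n - ⟪Y ((extChartAt (𝓡∂ 2) p).symm y),
          n 0 • coordVec p y 0 + n 1 • coordVec p y 1⟫‖ₑ
        ≤ ∫⁻ y in B, ENNReal.ofReal D * ‖‖grad (g k) ((extChartAt (𝓡∂ 2) p).symm y) -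
            Y ((extChartAt (𝓡∂ 2) p).symm y)‖‖ₑ := by
          refine setLIntegral_mono' hBc.measurableSet fun y hy => ?_
          rw [← ofReal_norm, ← ofReal_norm, ← ENNReal.ofReal_mul'  (norm_nonneg _)]
          refine ENNReal.ofReal_le_ofReal ((hdiff k y (hB hy)).trans ?_)
          rw [mul_comm, norm_norm]
          have := hD y hy
          rw [norm_norm] at this
          gcongr
      _ = ENNReal.ofReal D * ∫⁻ y in B, ‖‖grad (g k) ((extChartAt (𝓡∂ 2) p).symm y) -
            Y ((extChartAt (𝓡∂ 2) p).symm y)‖‖ₑ := lintegral_const_mul' _ _ ENNReal.ofReal_ne_top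
      _ ≤ ENNReal.ofReal D * (C * ∫⁻ x, ‖‖grad (g k) x - Y x‖‖ₑ ∂(area M)) :=
          mul_le_mul_right (hle (fun x => ‖‖grad (g k) x - Y x‖‖ₑ)
            (h.aestronglyMeasurable k).enorm) _
      _ = _ := by ring

/-- The gradient is closable: if smooth functions converge to zero and their gradients converge
to `Y` in `L²`, then `Y` vanishes almost everywhere. -/
theorem IsH1Limit.ae_eq_zero {g : ℕ → M → ℝ} {Y : ∀ x : M, TangentSpace (𝓡∂ 2) x}
    (h : IsH1Limit g (fun _ => 0) Y) : ∀ᵐ x ∂(area M), ‖Y x‖ = 0 := by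
  obtain ⟨ns, -, hns⟩ := exists_seq_tendsto_ae_of_eLpNorm h.aestronglyMeasurable h.tendsto_grad
  have hY : AEStronglyMeasurable (fun x => ‖Y x‖) (area M) := by
    refine aestronglyMeasurable_of_tendsto_ae atTop (f := fun i x => ‖grad (g (ns i)) x‖)
      (fun i => (IsSmooth.continuous_norm_grad (h.smooth (ns i))).aestronglyMeasurable) ?_
    filter_upwards [hns] with x hx
    rw [tendsto_iff_norm_sub_tendsto_zero]
    exact squeeze_zero (fun _ => norm_nonneg _) (fun i => abs_norm_sub_norm_le _ _) hx
  have hmk := hY.ae_eq_mk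
  set ρ := hY.mk _ with hρ
  have hρm : Measurable ρ := hY.stronglyMeasurable_mk.measurable
  have hchart : ∀ p : M, ∀ᵐ x ∂(chartArea p), ‖Y x‖ = 0 := by
    intro p
    have hT := measurableSet_target p
    have hzero : ∫⁻ x, ‖ρ x‖ₑ ∂(chartArea p) = 0 := by
      rw [lintegral_chartArea p hρm.enorm]
      refine (lintegral_congr_ae ?_).trans lintegral_zero
      have h0 := h.ae_inner_eq_zero p (pt (1, 0))
      have h1 := h.ae_inner_eq_zero p (pt (0, 1))
      filter_upwards [ae_chart_of_ae_area p hmk, ae_restrict_mem hT,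
        ae_restrict_of_ae (ae_mem_interior_target p), ae_restrict_of_ae h0,
        ae_restrict_of_ae h1] with y hy hyT hyO hy0 hy1
      have e0 := hy0 (hyO hyT)
      have e1 := hy1 (hyO hyT)
      have hn := norm_sq_mul_metricDet hyT (Y ((extChartAt (𝓡∂ 2) p).symm y))
      have c0 : (⟪Y ((extChartAt (𝓡∂ 2) p).symm y), coordVec p y 0⟫ : ℝ) = 0 := by
        rw [← e0]; congr 1
        rw [show (pt (1, 0)) 0 = 1 from rfl, show (pt (1, 0)) 1 = 0 from rfl]
        rw [one_smul, zero_smul, add_zero]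
      have c1 : (⟪Y ((extChartAt (𝓡∂ 2) p).symm y), coordVec p y 1⟫ : ℝ) = 0 := by
        rw [← e1]; congr 1
        rw [show (pt (0, 1)) 0 = 0 from rfl, show (pt (0, 1)) 1 = 1 from rfl]
        rw [one_smul, zero_smul, zero_add]
      rw [c0, c1] at hn
      have hd := metricDet_pos hyT
      have : ‖Y ((extChartAt (𝓡∂ 2) p).symm y)‖ ^ 2 = 0 := by
        have : ‖Y ((extChartAt (𝓡∂ 2) p).symm y)‖ ^ 2 * metricDet p y = 0 := by rw [hn]; ring
        exact (mul_eq_zero.1 this).resolve_right hd.ne'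
      have h3 : ‖Y ((extChartAt (𝓡∂ 2) p).symm y)‖ = 0 := by
        exact pow_eq_zero_iff (by norm_num) |>.1 this
      rw [← hy, h3]; simp
    rw [lintegral_eq_zero_iff hρm.enorm] at hzero
    have hmk' : ∀ᵐ x ∂(chartArea p), ‖Y x‖ = ρ x := by
      rw [← area_restrict_source p]; exact ae_restrict_of_ae hmk
    filter_upwards [hzero, hmk'] with x hx hx'
    rw [hx']; simpa using hx
  rw [ae_iff, ← Measure.restrict_apply_univ]
  refine isCompact_univ.measure_zero_of_nhdsWithin fun p _ =>
    ⟨(extChartAt (𝓡∂ 2) p).source, mem_nhdsWithin_of_mem_nhds (extChartAt_source_mem_nhds p), ?_⟩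
  have := ae_iff.1 (hchart p)
  rw [← area_restrict_source p, Measure.restrict_apply' (measurableSet_source p)] at this
  rw [Measure.restrict_apply (measurableSet_source p), inter_comm]
  exact this

end

/-! ### Approximating sequences -/

section

theorem eLpNorm_two_eq {α : Type*} [MeasurableSpace α] {μ : Measure α} {f : α → ℝ}
    (hf : MemLp f 2 μ) : eLpNorm f 2 μ = ENNReal.ofReal √(∫ x, f x ^ 2 ∂μ) := by
  rw [hf.eLpNorm_eq_integral_rpow_norm (by norm_num) (by norm_num)]
  simp [Real.sqrt_eq_rpow]

variable {M : Type*} [TopologicalSpace M] [ChartedSpace (EuclideanHalfSpace 2) M]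
  [RiemannianBundle (fun x : M => TangentSpace (𝓡∂ 2) x)] [MeasurableSpace M]

/-- The square of the `H¹` norm, for a function with a classical gradient. -/
def energy (w : M → ℝ) : ℝ := ∫ x, w x ^ 2 ∂(area M) + ∫ x, ‖grad w x‖ ^ 2 ∂(area M)

variable [CompactSpace M]
  [IsManifold (𝓡∂ 2) ∞ M]
  [IsContMDiffRiemannianBundle (𝓡∂ 2) ∞ (EuclideanSpace ℝ (Fin 2))
      (fun x : M => TangentSpace (𝓡∂ 2) x)]  [BorelSpace M]

theorem IsSmooth.sub {f g : M → ℝ} (hf : IsSmooth f) (hg : IsSmooth g) :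
    IsSmooth (fun x => f x - g x) := ContMDiff.sub hf hg

theorem memLp_of_continuous {w : M → ℝ} (hw : Continuous w) (p : ℝ≥0∞) {μ : Measure M}
    [IsFiniteMeasure μ] : MemLp w p μ := by
  obtain ⟨C, hC⟩ := isCompact_univ.exists_bound_of_continuousOn hw.continuousOn
  exact MemLp.of_bound hw.aestronglyMeasurable C (ae_of_all _ fun x => hC x (mem_univ x))

theorem norm_grad_sub_sub_le {f g : M → ℝ} (hf : IsSmooth f) (hg : IsSmooth g) (x : M)
    (X : TangentSpace (𝓡∂ 2) x) :
    ‖grad (fun x => f x - g x) x‖ ≤ ‖grad f x - X‖ + ‖grad g x - X‖ := by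
  rw [grad_sub (hf.mdifferentiableAt x) (hg.mdifferentiableAt x)]
  calc ‖grad f x - grad g x‖ = ‖(grad f x - X) - (grad g x - X)‖ := by
        rw [sub_sub_sub_cancel_right]
    _ ≤ _ := norm_sub_le _ _

theorem IsH1Limit.sub {f f' : ℕ → M → ℝ} {u : M → ℝ} {X X' : ∀ x : M, TangentSpace (𝓡∂ 2) x}
    (hu : AEStronglyMeasurable u (area M)) (h : IsH1Limit f u X) (h' : IsH1Limit f' u X') :
    IsH1Limit (fun n x => f n x - f' n x) (fun _ => 0) (fun x => X x - X' x) := by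
  have hg : ∀ n x, grad (fun x => f n x - f' n x) x = grad (f n) x - grad (f' n) x := fun n x =>
    grad_sub (IsSmooth.mdifferentiableAt (h.smooth n) x)
      (IsSmooth.mdifferentiableAt (h'.smooth n) x)
  have hle : ∀ n x, ‖grad (fun x => f n x - f' n x) x - (X x - X' x)‖ ≤
      ‖grad (f n) x - X x‖ + ‖grad (f' n) x - X' x‖ := fun n x => by
    rw [hg, sub_sub_sub_comm]; exact norm_sub_le _ _
  have hsm : ∀ n, IsSmooth (fun x => f n x - f' n x) := fun n =>
    IsSmooth.sub (h.smooth n) (h'.smooth n)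
  have hmf : ∀ n, AEStronglyMeasurable (fun x => f n x - u x) (area M) := fun n =>
    (h.smooth n).continuous.aestronglyMeasurable.sub hu
  have hmf' : ∀ n, AEStronglyMeasurable (fun x => f' n x - u x) (area M) := fun n =>
    (h'.smooth n).continuous.aestronglyMeasurable.sub hu
  refine ⟨hsm, ?_, fun n => ?_, ?_⟩
  · have hlim := h.tendsto_fun.add h'.tendsto_fun
    rw [add_zero] at hlim
    refine tendsto_of_tendsto_of_tendsto_of_le_of_le tendsto_const_nhds hlim (fun _ => zero_le)
      fun n => ?_
    refine le_trans (le_of_eq ?_) (eLpNorm_sub_le (hmf n) (hmf' n) (by norm_num))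
    congr 1; ext x; simp
  · -- the field is an almost everywhere limit of gradients of smooth functions
    obtain ⟨ns, hns, hns'⟩ := exists_seq_tendsto_ae_of_eLpNorm h.aestronglyMeasurable h.tendsto_grad
    obtain ⟨ms, hms, hms'⟩ := exists_seq_tendsto_ae_of_eLpNorm
      (fun n => h'.aestronglyMeasurable (ns n)) (h'.tendsto_grad.comp hns.tendsto_atTop)
    refine aestronglyMeasurable_of_tendsto_ae atTop (f := fun i x =>
      ‖grad (fun x => (f n x - f' n x) - (f (ns (ms i)) x - f' (ns (ms i)) x)) x‖)
      (fun i => (IsSmooth.continuous_norm_grad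
        (IsSmooth.sub (hsm n) (hsm (ns (ms i))))).aestronglyMeasurable) ?_
    filter_upwards [hns', hms'] with x hx hx'
    have hx1 := (hx.comp hms.tendsto_atTop).add hx'
    rw [add_zero] at hx1
    rw [tendsto_iff_norm_sub_tendsto_zero]
    refine squeeze_zero (fun _ => norm_nonneg _) (fun i => ?_) hx1
    have hgs : grad (fun x => (f n x - f' n x) - (f (ns (ms i)) x - f' (ns (ms i)) x)) x =
        grad (fun x => f n x - f' n x) x - grad (fun x => f (ns (ms i)) x - f' (ns (ms i)) x) x :=
      grad_sub ((hsm n).mdifferentiableAt x) ((hsm (ns (ms i))).mdifferentiableAt x)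
    rw [hgs]
    refine (abs_norm_sub_norm_le _ _).trans ?_
    rw [sub_sub_sub_cancel_left, norm_sub_rev]
    exact hle _ x
  · have hlim := h.tendsto_grad.add h'.tendsto_grad
    rw [add_zero] at hlim
    refine tendsto_of_tendsto_of_tendsto_of_le_of_le tendsto_const_nhds hlim (fun _ => zero_le)
      fun n => ?_
    refine le_trans ?_ (eLpNorm_add_le (h.aestronglyMeasurable n) (h'.aestronglyMeasurable n)
      (by norm_num))
    refine eLpNorm_mono_real fun x => ?_
    rw [norm_norm]
    exact hle n x

/-- The weak gradient is unique. -/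
theorem IsH1Limit.ae_unique {f f' : ℕ → M → ℝ} {u : M → ℝ}
    {X X' : ∀ x : M, TangentSpace (𝓡∂ 2) x} (hu : AEStronglyMeasurable u (area M))
    (h : IsH1Limit f u X) (h' : IsH1Limit f' u X') : ∀ᵐ x ∂(area M), X x = X' x := by
  filter_upwards [(h.sub hu h').ae_eq_zero] with x hx
  exact sub_eq_zero.1 (norm_eq_zero.1 hx)

/-- Two sequences that approximate the same element of `H¹` are asymptotically close in `H¹`. -/
theorem IsH1Limit.energy_sub_le {f f' : ℕ → M → ℝ} {u : M → ℝ}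
    {X X' : ∀ x : M, TangentSpace (𝓡∂ 2) x} (hu : AEStronglyMeasurable u (area M))
    (h : IsH1Limit f u X) (h' : IsH1Limit f' u X') {ε : ℝ} (hε : 0 < ε) :
    ∃ N, ∀ n ≥ N, ∀ m ≥ N, energy (fun x => f n x - f' m x) ≤ ε := by
  have hmf : ∀ n, AEStronglyMeasurable (fun x => f n x - u x) (area M) := fun n =>
    (h.smooth n).continuous.aestronglyMeasurable.sub hu
  have hmf' : ∀ n, AEStronglyMeasurable (fun x => f' n x - u x) (area M) := fun n =>
    (h'.smooth n).continuous.aestronglyMeasurable.sub hu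
  set δ : ℝ := √(ε / 2) / 2 with hδ
  have hδ0 : 0 < δ := by positivity
  have hδp : (0 : ℝ≥0∞) < ENNReal.ofReal δ := by simpa using hδ0
  have hδ2 : (2 * δ) ^ 2 = ε / 2 := by
    rw [hδ, mul_div_cancel₀ _ (by norm_num), Real.sq_sqrt (by positivity)]
  have key : ∀ w : M → ℝ, Continuous w → eLpNorm w 2 (area M) ≤
      ENNReal.ofReal δ + ENNReal.ofReal δ → ∫ x, w x ^ 2 ∂(area M) ≤ ε / 2 := fun w hw hle => by
    rw [eLpNorm_two_eq (memLp_of_continuous hw 2), ← ENNReal.ofReal_add hδ0.le hδ0.le,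
      ENNReal.ofReal_le_ofReal_iff (by positivity), Real.sqrt_le_left (by positivity)] at hle
    rw [← hδ2]; convert hle using 1; ring
  have e1 := h.tendsto_fun.eventually (gt_mem_nhds hδp)
  have e2 := h'.tendsto_fun.eventually (gt_mem_nhds hδp)
  have e3 := h.tendsto_grad.eventually (gt_mem_nhds hδp)
  have e4 := h'.tendsto_grad.eventually (gt_mem_nhds hδp)
  obtain ⟨N, hN⟩ := eventually_atTop.1 (((e1.and e2).and e3).and e4)
  refine ⟨N, fun n hn m hm => ?_⟩
  have hs : IsSmooth (fun x => f n x - f' m x) := IsSmooth.sub (h.smooth n) (h'.smooth m)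
  have a1 : ∫ x, (f n x - f' m x) ^ 2 ∂(area M) ≤ ε / 2 := by
    refine key _ hs.continuous ?_
    refine le_trans (le_trans (le_of_eq ?_) (eLpNorm_sub_le (hmf n) (hmf' m) (by norm_num)))
      (add_le_add (hN n hn).1.1.1.le (hN m hm).1.1.2.le)
    congr 1; ext x; simp
  have a2 : ∫ x, ‖grad (fun x => f n x - f' m x) x‖ ^ 2 ∂(area M) ≤ ε / 2 := by
    refine key _ hs.continuous_norm_grad ?_
    refine le_trans (le_trans ?_ (eLpNorm_add_le (h.aestronglyMeasurable n)
      (h'.aestronglyMeasurable m) (by norm_num))) (add_le_add (hN n hn).1.2.le (hN m hm).2.le)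
    refine eLpNorm_mono_ae_real ?_
    filter_upwards [h.ae_unique hu h'] with x hx
    rw [norm_norm]
    have := norm_grad_sub_sub_le (h.smooth n) (h'.smooth m) x (X x)
    simp only [Pi.add_apply]
    rwa [← hx]
  unfold energy
  linarith

/-- The Dirichlet integrals of an approximating sequence are asymptotically at most that of the
limit. -/
theorem IsH1Limit.exists_tendsto_bound {f : ℕ → M → ℝ} {u : M → ℝ}
    {X : ∀ x : M, TangentSpace (𝓡∂ 2) x} (h : IsH1Limit f u X) :
    ∃ B : ℕ → ℝ, Tendsto B atTop (𝓝 (∫ x, ‖X x‖ ^ 2 ∂(area M))) ∧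
      ∀ᶠ n in atTop, ∫ x, ‖grad (f n) x‖ ^ 2 ∂(area M) ≤ B n := by
  have hfin := h.tendsto_grad.eventually (gt_mem_nhds ENNReal.zero_lt_top)
  have hgm : ∀ n, MemLp (fun x => ‖grad (f n) x‖) 2 (area M) := fun n =>
    memLp_of_continuous (IsSmooth.continuous_norm_grad (h.smooth n)) 2
  have hXm : MemLp (fun x => ‖X x‖) 2 (area M) := by
    obtain ⟨ns, -, hns⟩ := exists_seq_tendsto_ae_of_eLpNorm h.aestronglyMeasurable h.tendsto_grad
    have hY : AEStronglyMeasurable (fun x => ‖X x‖) (area M) := by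
      refine aestronglyMeasurable_of_tendsto_ae atTop (f := fun i x => ‖grad (f (ns i)) x‖)
        (fun i => (IsSmooth.continuous_norm_grad (h.smooth (ns i))).aestronglyMeasurable) ?_
      filter_upwards [hns] with x hx
      rw [tendsto_iff_norm_sub_tendsto_zero]
      exact squeeze_zero (fun _ => norm_nonneg _) (fun i => abs_norm_sub_norm_le _ _) hx
    obtain ⟨n, hn⟩ := hfin.exists
    refine MemLp.of_le ((hgm n).add ⟨h.aestronglyMeasurable n, hn⟩) hY (ae_of_all _ fun x => ?_)
    rw [norm_norm, Pi.add_apply, Real.norm_of_nonneg (by positivity)]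
    have := norm_sub_norm_le (X x) (grad (f n) x)
    rw [norm_sub_rev] at this
    linarith
  set e : ℕ → ℝ := fun n => (eLpNorm (fun x => ‖grad (f n) x - X x‖) 2 (area M)).toReal with he
  have hel : Tendsto e atTop (𝓝 0) := by
    have := (ENNReal.tendsto_toReal (ENNReal.zero_ne_top)).comp h.tendsto_grad
    rw [ENNReal.toReal_zero] at this
    exact this
  refine ⟨fun n => (√(∫ x, ‖X x‖ ^ 2 ∂(area M)) + e n) ^ 2, ?_, ?_⟩
  · have := (tendsto_const_nhds (x := √(∫ x, ‖X x‖ ^ 2 ∂(area M)))).add hel |>.pow 2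
    rwa [add_zero, Real.sq_sqrt (integral_nonneg fun x => by positivity)] at this
  · filter_upwards [hfin] with n hn
    have h1 : eLpNorm (fun x => ‖grad (f n) x‖) 2 (area M) ≤
        eLpNorm (fun x => ‖X x‖) 2 (area M) +
          eLpNorm (fun x => ‖grad (f n) x - X x‖) 2 (area M) := by
      refine le_trans (eLpNorm_mono_real fun x => ?_) (eLpNorm_add_le hXm.1
        (h.aestronglyMeasurable n) (by norm_num))
      rw [norm_norm, Pi.add_apply]
      have := norm_sub_norm_le (grad (f n) x) (X x)
      linarith
    rw [eLpNorm_two_eq (hgm n), eLpNorm_two_eq hXm, ← ENNReal.ofReal_toReal hn.ne,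
      ← ENNReal.ofReal_add (by positivity) (by positivity),
      ENNReal.ofReal_le_ofReal_iff (by positivity), Real.sqrt_le_left (by positivity)] at h1
    exact h1

end

/-! ### An inequality of Trudinger type -/

section

variable {M : Type*} [TopologicalSpace M] [ChartedSpace (EuclideanHalfSpace 2) M]
  [RiemannianBundle (fun x : M => TangentSpace (𝓡∂ 2) x)] [MeasurableSpace M] [CompactSpace M]
  [IsManifold (𝓡∂ 2) ∞ M]
  [IsContMDiffRiemannianBundle (𝓡∂ 2) ∞ (EuclideanSpace ℝ (Fin 2))
      (fun x : M => TangentSpace (𝓡∂ 2) x)]  [BorelSpace M]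

theorem sq_integral_mul_le_of_continuous {μ : Measure M} [IsFiniteMeasure μ] {f g : M → ℝ}
    (hf : Continuous f) (hg : Continuous g) :
    (∫ x, f x * g x ∂μ) ^ 2 ≤ (∫ x, f x ^ 2 ∂μ) * ∫ x, g x ^ 2 ∂μ :=
  sq_integral_mul_le (integrable_of_continuous (hf.pow 2)) (integrable_of_continuous (hg.pow 2))
    (integrable_of_continuous (hf.mul hg))

variable [T2Space M]

/-- The growth of the moments of a function: the Sobolev inequality for `v ^ (k + 1)` bounds the
moment of order `2 k + 2` by that of order `2 k`. -/
theorem exists_moment_le : ∃ C : ℝ, 0 ≤ C ∧ ∀ v : M → ℝ, IsSmooth v → ∀ k : ℕ,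
    ∫ x, v x ^ (2 * k) ∂(area M) ≤
      (C * energy v) ^ k * (k.factorial : ℝ) ^ 2 * (area M).real univ := by
  obtain ⟨C, hC0, hC⟩ := exists_sobolev_le (M := M)
  refine ⟨2 * C, by positivity, fun v hv k => ?_⟩
  have hvc := hv.continuous
  have hgc := hv.continuous_norm_grad
  have he0 : 0 ≤ energy v := add_nonneg (integral_nonneg fun x => by positivity)
    (integral_nonneg fun x => by positivity)
  induction k with
  | zero => simp
  | succ k ih =>
    have hw : IsSmooth (fun x => v x ^ (k + 1)) := hv.comp (contDiff_id.pow (k + 1))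
    have hgrad : ∀ x, ‖grad (fun x => v x ^ (k + 1)) x‖ = (k + 1) * (|v x| ^ k * ‖grad v x‖) := by
      intro x
      have := grad_comp (F := fun t => t ^ (k + 1)) (hv.mdifferentiableAt x)
        (hasDerivAt_pow (k + 1) (v x))
      rw [this, norm_smul, norm_mul, norm_pow, Real.norm_eq_abs, Real.norm_eq_abs]
      simp only [Nat.add_sub_cancel]
      rw [abs_of_nonneg (by positivity)]
      push_cast; ring
    have h1 := hC _ hw
    simp only [hgrad] at h1
    rw [integral_const_mul] at h1
    have h2 : ∀ x, |v x ^ (k + 1)| = |v x| ^ k * |v x| := fun x => by rw [abs_pow, pow_succ]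
    simp only [h2] at h1
    set A := ∫ x, |v x| ^ k * |v x| ∂(area M) with hA
    set B := ∫ x, |v x| ^ k * ‖grad v x‖ ∂(area M) with hB
    have hsq : ∀ x, (|v x| ^ k) ^ 2 = v x ^ (2 * k) := fun x => by
      rw [← pow_mul, mul_comm k 2, pow_mul, sq_abs, ← pow_mul]
    have hA2 : A ^ 2 ≤ (∫ x, v x ^ (2 * k) ∂(area M)) * ∫ x, v x ^ 2 ∂(area M) := by
      have := sq_integral_mul_le_of_continuous (μ := area M) (f := fun x => |v x| ^ k)
        (hvc.abs.pow k) hvc.abs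
      simpa only [hsq, sq_abs] using this
    have hB2 : B ^ 2 ≤ (∫ x, v x ^ (2 * k) ∂(area M)) * ∫ x, ‖grad v x‖ ^ 2 ∂(area M) := by
      have := sq_integral_mul_le_of_continuous (μ := area M) (f := fun x => |v x| ^ k)
        (hvc.abs.pow k) hgc
      simpa only [hsq] using this
    have hA0 : 0 ≤ A := integral_nonneg fun x => by positivity
    have hB0 : 0 ≤ B := integral_nonneg fun x => by positivity
    have hk1 : (1 : ℝ) ≤ k + 1 := by linarith [(Nat.cast_nonneg k : (0 : ℝ) ≤ k)]
    have ha0 : 0 ≤ ∫ x, v x ^ (2 * k) ∂(area M) := integral_nonneg fun x => by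
      rw [pow_mul]; positivity
    have h3 : (A + (k + 1) * B) ^ 2 ≤
        2 * (k + 1) ^ 2 * ((∫ x, v x ^ (2 * k) ∂(area M)) * energy v) := by
      calc (A + (k + 1) * B) ^ 2 ≤ ((k + 1) * A + (k + 1) * B) ^ 2 := by
            gcongr; exact le_mul_of_one_le_left hA0 hk1
        _ = (k + 1) ^ 2 * (A + B) ^ 2 := by ring
        _ ≤ (k + 1) ^ 2 * (2 * (A ^ 2 + B ^ 2)) := by
            gcongr; nlinarith [sq_nonneg (A - B)]
        _ ≤ (k + 1) ^ 2 * (2 * ((∫ x, v x ^ (2 * k) ∂(area M)) * energy v)) := by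
            gcongr; unfold energy; rw [mul_add]; exact add_le_add hA2 hB2
        _ = _ := by ring
    calc ∫ x, v x ^ (2 * (k + 1)) ∂(area M) = ∫ x, (v x ^ (k + 1)) ^ 2 ∂(area M) := by
          simp only [← pow_mul, mul_comm]
      _ ≤ C * (A + (k + 1) * B) ^ 2 := h1
      _ ≤ C * (2 * (k + 1) ^ 2 * ((∫ x, v x ^ (2 * k) ∂(area M)) * energy v)) := by gcongr
      _ ≤ C * (2 * (k + 1) ^ 2 * (((2 * C * energy v) ^ k * (k.factorial : ℝ) ^ 2 *
          (area M).real univ) * energy v)) := by gcongr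
      _ = _ := by rw [Nat.factorial_succ]; push_cast; ring

/-- An inequality of Trudinger type: exponentials of functions of small energy have bounded
integral. -/
theorem exists_trudinger : ∃ δ : ℝ, 0 < δ ∧ ∀ v : M → ℝ, IsSmooth v → energy v ≤ δ →
    ∫ x, Real.exp (2 * v x) ∂(area M) ≤ 4 * (area M).real univ := by
  obtain ⟨C, hC0, hC⟩ := exists_moment_le (M := M)
  refine ⟨1 / (8 * (C + 1)), by positivity, fun v hv hE => ?_⟩
  have hvc := hv.continuous
  have he0 : 0 ≤ energy v := add_nonneg (integral_nonneg fun x => by positivity)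
    (integral_nonneg fun x => by positivity)
  have hCE : 4 * (C * energy v) ≤ 1 / 2 := by
    have : (C + 1) * energy v ≤ 1 / 8 := by
      rw [le_div_iff₀ (by positivity)] at hE
      linarith
    nlinarith
  set F : ℕ → M → ℝ := fun k x => (2 * v x) ^ (2 * k) / ((2 * k).factorial : ℝ) with hF
  have hFc : ∀ k, Continuous (F k) := fun k => by simp only [hF]; fun_prop
  have hF0 : ∀ k x, 0 ≤ F k x := fun k x => by
    simp only [hF]; rw [pow_mul]; positivity
  have hFi : ∀ k, Integrable (F k) (area M) := fun k => integrable_of_continuous (hFc k)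
  have hle : ∀ k, ∫ x, F k x ∂(area M) ≤ (1 / 2) ^ k * (area M).real univ := fun k => by
    -- `(k!)² ≤ (2 k)!` turns the exponential series into a geometric one
    have hfact : (k.factorial : ℝ) ^ 2 ≤ (2 * k).factorial := by
      have := Nat.factorial_mul_factorial_dvd_factorial_add k k
      rw [sq, two_mul]
      exact_mod_cast Nat.le_of_dvd (Nat.factorial_pos _) this
    have hfp : (0 : ℝ) < (2 * k).factorial := by exact_mod_cast Nat.factorial_pos _
    have e : ∀ x, F k x = 4 ^ k / ((2 * k).factorial : ℝ) * v x ^ (2 * k) := fun x => by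
      simp only [hF]; rw [mul_pow, pow_mul 2 2 k]; norm_num; ring
    simp only [e]
    rw [integral_const_mul]
    calc 4 ^ k / ((2 * k).factorial : ℝ) * ∫ x, v x ^ (2 * k) ∂(area M)
        ≤ 4 ^ k / ((2 * k).factorial : ℝ) *
            ((C * energy v) ^ k * (k.factorial : ℝ) ^ 2 * (area M).real univ) := by
          gcongr; exact hC v hv k
      _ = (4 * (C * energy v)) ^ k * (area M).real univ *
            ((k.factorial : ℝ) ^ 2 / ((2 * k).factorial : ℝ)) := by rw [mul_pow]; ring
      _ ≤ (1 / 2) ^ k * (area M).real univ * 1 := by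
          gcongr
          rw [div_le_one hfp]; exact hfact
      _ = _ := mul_one _
  have hgeo : Summable fun k : ℕ => ((1 : ℝ) / 2) ^ k * (area M).real univ :=
    summable_geometric_two.mul_right _
  have hsum : Summable fun k => ∫ x, ‖F k x‖ ∂(area M) := by
    refine Summable.of_nonneg_of_le (fun k => integral_nonneg fun x => norm_nonneg _)
      (fun k => ?_) hgeo
    simp only [Real.norm_of_nonneg (hF0 k _)]
    exact hle k
  have hcosh : ∀ x, ∑' k, F k x = Real.cosh (2 * v x) := fun x => (Real.hasSum_cosh _).tsum_eq
  have hs := hasSum_integral_of_summable_integral_norm hFi hsum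
  simp only [hcosh] at hs
  have hle2 : ∫ x, Real.cosh (2 * v x) ∂(area M) ≤ 2 * (area M).real univ := by
    have hg := hasSum_geometric_two.mul_right ((area M).real univ)
    exact hasSum_le hle hs hg
  calc ∫ x, Real.exp (2 * v x) ∂(area M) ≤ ∫ x, 2 * Real.cosh (2 * v x) ∂(area M) := by
        refine integral_mono (integrable_of_continuous (by fun_prop))
          (integrable_of_continuous (by fun_prop)) fun x => ?_
        show Real.exp (2 * v x) ≤ 2 * Real.cosh (2 * v x)
        rw [Real.cosh_eq]
        linarith [Real.exp_pos (-(2 * v x))]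
    _ ≤ _ := by rw [integral_const_mul]; linarith

theorem integral_exp_two_le_of_le {f g : M → ℝ} {m : ℝ} (hf : Continuous f) (hg : Continuous g)
    (h : ∀ x, g x ≤ m) : ∫ x, Real.exp (2 * f x) ∂(area M) ≤
      Real.exp (2 * m) * ∫ x, Real.exp (2 * (f x - g x)) ∂(area M) := by
  rw [← integral_const_mul]
  refine integral_mono (integrable_of_continuous (by fun_prop))
    (integrable_of_continuous (by fun_prop)) fun x => ?_
  show _ ≤ Real.exp (2 * m) * Real.exp (2 * (f x - g x))
  rw [← Real.exp_add]
  exact Real.exp_le_exp.2 (by linarith [h x])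

theorem energy_add_le {f g : M → ℝ} (hf : IsSmooth f) (hg : IsSmooth g) :
    energy f ≤ 2 * energy (fun x => f x - g x) + 2 * energy g := by
  have hs := hf.sub hg
  have i1 : Integrable (fun x => (f x - g x) ^ 2) (area M) :=
    integrable_of_continuous (hs.continuous.pow 2)
  have i2 : Integrable (fun x => g x ^ 2) (area M) :=
    integrable_of_continuous (hg.continuous.pow 2)
  have i3 : Integrable (fun x => ‖grad (fun x => f x - g x) x‖ ^ 2) (area M) :=
    integrable_of_continuous (hs.continuous_norm_grad.pow 2)
  have i4 : Integrable (fun x => ‖grad g x‖ ^ 2) (area M) :=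
    integrable_of_continuous (hg.continuous_norm_grad.pow 2)
  have a1 : ∫ x, f x ^ 2 ∂(area M) ≤
      2 * ∫ x, (f x - g x) ^ 2 ∂(area M) + 2 * ∫ x, g x ^ 2 ∂(area M) := by
    rw [← integral_const_mul, ← integral_const_mul,
      ← integral_add (i1.const_mul 2) (i2.const_mul 2)]
    refine integral_mono (integrable_of_continuous (hf.continuous.pow 2))
      ((i1.const_mul 2).add (i2.const_mul 2)) fun x => ?_
    show f x ^ 2 ≤ 2 * (f x - g x) ^ 2 + 2 * g x ^ 2
    nlinarith [sq_nonneg (f x - g x - g x)]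
  have a2 : ∫ x, ‖grad f x‖ ^ 2 ∂(area M) ≤
      2 * ∫ x, ‖grad (fun x => f x - g x) x‖ ^ 2 ∂(area M) + 2 * ∫ x, ‖grad g x‖ ^ 2 ∂(area M) := by
    rw [← integral_const_mul, ← integral_const_mul,
      ← integral_add (i3.const_mul 2) (i4.const_mul 2)]
    refine integral_mono (integrable_of_continuous (hf.continuous_norm_grad.pow 2))
      ((i3.const_mul 2).add (i4.const_mul 2)) fun x => ?_
    show ‖grad f x‖ ^ 2 ≤ 2 * ‖grad (fun x => f x - g x) x‖ ^ 2 + 2 * ‖grad g x‖ ^ 2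
    rw [grad_sub (hf.mdifferentiableAt x) (hg.mdifferentiableAt x)]
    have h1 := norm_sub_norm_le (grad f x) (grad g x)
    have h2 := norm_nonneg (grad f x)
    have h3 : ‖grad f x‖ ≤ ‖grad f x - grad g x‖ + ‖grad g x‖ := by linarith
    calc ‖grad f x‖ ^ 2 ≤ (‖grad f x - grad g x‖ + ‖grad g x‖) ^ 2 := by gcongr
      _ ≤ _ := by nlinarith [sq_nonneg (‖grad f x - grad g x‖ - ‖grad g x‖)]
  unfold energy
  linarith

/-- Along a sequence that converges in `H¹`, exponentials have bounded integrals, on the surface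
and on its boundary. -/
theorem IsH1Limit.exists_exp_bound {f : ℕ → M → ℝ} {u : M → ℝ}
    {X : ∀ x : M, TangentSpace (𝓡∂ 2) x} (hu : AEStronglyMeasurable u (area M))
    (h : IsH1Limit f u X) : ∃ C : ℝ, ∀ᶠ n in atTop,
      ∫ x, Real.exp (2 * f n x) ∂(area M) ≤ C ∧ ∫ x, Real.exp (f n x) ∂(bdryLength M) ≤ C := by
  obtain ⟨δ, hδ, hT⟩ := exists_trudinger (M := M)
  -- `f n` differs from the bounded function `f N` by a function of small energy
  obtain ⟨N, hN⟩ := h.energy_sub_le hu h hδ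
  obtain ⟨Ct, hCt0, hCt⟩ := exists_trace_le (M := M)
  obtain ⟨m, hm⟩ := isCompact_univ.exists_bound_of_continuousOn (h.smooth N).continuous.continuousOn
  set C₁ := Real.exp (2 * m) * (4 * (area M).real univ) with hC₁
  set E := 2 * δ + 2 * energy (f N) with hE
  have b1 : ∀ n ≥ N, ∫ x, Real.exp (2 * f n x) ∂(area M) ≤ C₁ := fun n hn => by
    refine (integral_exp_two_le_of_le (m := m) (h.smooth n).continuous (h.smooth N).continuous
      fun x => (le_abs_self _).trans (hm x (mem_univ x))).trans ?_
    rw [hC₁]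
    gcongr
    exact hT _ (IsSmooth.sub (h.smooth n) (h.smooth N)) (hN n hn N le_rfl)
  have bE : ∀ n ≥ N, energy (f n) ≤ E := fun n hn => by
    have := energy_add_le (h.smooth n) (h.smooth N)
    have := hN n hn N le_rfl
    linarith
  refine ⟨max C₁ (Ct * ((area M).real univ + 2 * C₁ + E)), ?_⟩
  filter_upwards [eventually_ge_atTop N] with n hn
  refine ⟨(b1 n hn).trans (le_max_left _ _), le_trans ?_ (le_max_right _ _)⟩
  have hsm : IsSmooth (f n) := h.smooth n
  have hc := hsm.continuous
  have hgc := hsm.continuous_norm_grad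
  -- the boundary integral is controlled by the trace inequality for `exp ∘ f n`
  have h1 := hCt (fun x => Real.exp (f n x)) (hsm.comp Real.contDiff_exp)
  simp only [abs_of_pos (Real.exp_pos _)] at h1
  refine h1.trans ?_
  have hg : ∀ x, ‖grad (fun x => Real.exp (f n x)) x‖ = Real.exp (f n x) * ‖grad (f n) x‖ :=
    fun x => by
    rw [grad_comp (hsm.mdifferentiableAt x) (Real.hasDerivAt_exp _), norm_smul,
      Real.norm_of_nonneg (Real.exp_pos _).le]
  simp only [hg]
  have e2 : ∀ x, Real.exp (2 * f n x) = Real.exp (f n x) ^ 2 := fun x => by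
    rw [← Real.exp_nat_mul]; norm_num
  have i2 : Integrable (fun x => Real.exp (2 * f n x)) (area M) :=
    integrable_of_continuous (by fun_prop)
  have ig : Integrable (fun x => ‖grad (f n) x‖ ^ 2) (area M) :=
    integrable_of_continuous (hgc.pow 2)
  have c1 : ∫ x, Real.exp (f n x) ∂(area M) ≤ (area M).real univ + C₁ := by
    calc ∫ x, Real.exp (f n x) ∂(area M) ≤ ∫ x, (1 + Real.exp (2 * f n x)) ∂(area M) := by
          refine integral_mono (integrable_of_continuous (by fun_prop))
            ((integrable_const 1).add i2) fun x => ?_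
          show Real.exp (f n x) ≤ 1 + Real.exp (2 * f n x)
          rw [e2]; nlinarith [sq_nonneg (Real.exp (f n x) - 1)]
      _ ≤ _ := by
          rw [integral_add (integrable_const 1) i2]
          simp only [integral_const, smul_eq_mul, mul_one]
          linarith [b1 n hn]
  have c2 : ∫ x, Real.exp (f n x) * ‖grad (f n) x‖ ∂(area M) ≤ C₁ + E := by
    calc ∫ x, Real.exp (f n x) * ‖grad (f n) x‖ ∂(area M)
        ≤ ∫ x, (Real.exp (2 * f n x) + ‖grad (f n) x‖ ^ 2) ∂(area M) := by
          refine integral_mono (integrable_of_continuous ((Real.continuous_exp.comp hc).mul hgc))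
            (i2.add ig) fun x => ?_
          show Real.exp (f n x) * ‖grad (f n) x‖ ≤ Real.exp (2 * f n x) + ‖grad (f n) x‖ ^ 2
          rw [e2]
          nlinarith [sq_nonneg (Real.exp (f n x) - ‖grad (f n) x‖), sq_nonneg (Real.exp (f n x)),
            sq_nonneg (‖grad (f n) x‖)]
      _ ≤ _ := by
          rw [integral_add i2 ig]
          have := bE n hn
          have h0 : 0 ≤ ∫ x, f n x ^ 2 ∂(area M) := integral_nonneg fun x => by positivity
          unfold energy at this
          linarith [b1 n hn]
  refine mul_le_mul_of_nonneg_left ?_ hCt0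
  linarith

end

/-! ### Traces and the passage to the limit -/

section

theorem abs_exp_sub_exp_le (a b : ℝ) :
    |Real.exp a - Real.exp b| ≤ |a - b| * (Real.exp a + Real.exp b) := by
  wlog hab : b ≤ a generalizing a b
  · have := this b a (le_of_not_ge hab)
    rwa [abs_sub_comm, abs_sub_comm a b, add_comm]
  rw [abs_of_nonneg (by linarith [Real.exp_le_exp.2 hab]), abs_of_nonneg (by linarith)]
  have h1 := Real.add_one_le_exp (b - a)
  have h2 : Real.exp b = Real.exp a * Real.exp (b - a) := by rw [← Real.exp_add]; congr 1; ring
  have h3 : Real.exp a * (b - a + 1) ≤ Real.exp b := by rw [h2]; gcongr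
  have h4 : 0 ≤ (a - b) * Real.exp b := mul_nonneg (by linarith) (Real.exp_pos b).le
  nlinarith [Real.exp_pos a]

/-- Convergence in `L²`, together with a bound for `∫ e²ᵛ`, allows passage to the limit in
weighted integrals of exponentials. -/
theorem tendsto_integral_mul_exp {α : Type*} [MeasurableSpace α] {μ : Measure α}
    [IsFiniteMeasure μ] {k : α → ℝ} (hk : AEStronglyMeasurable k μ) {C : ℝ}
    (hkC : ∀ᵐ x ∂μ, ‖k x‖ ≤ C) {v : ℕ → α → ℝ} {w : α → ℝ}
    (hv : ∀ n, AEStronglyMeasurable (v n) μ) (hw : AEStronglyMeasurable w μ)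
    (hlim : Tendsto (fun n => eLpNorm (fun x => v n x - w x) 2 μ) atTop (𝓝 0)) {B : ℝ}
    (hB : ∀ᶠ n in atTop, Integrable (fun x => Real.exp (2 * v n x)) μ ∧
      ∫ x, Real.exp (2 * v n x) ∂μ ≤ B) :
    Integrable (fun x => k x * Real.exp (w x)) μ ∧
    Tendsto (fun n => ∫ x, k x * Real.exp (v n x) ∂μ) atTop
      (𝓝 (∫ x, k x * Real.exp (w x) ∂μ)) := by
  have hexp : ∀ {g : α → ℝ}, AEStronglyMeasurable g μ →
      AEStronglyMeasurable (fun x => Real.exp (g x)) μ := fun hg =>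
    Real.continuous_exp.comp_aestronglyMeasurable hg
  have hexp2 : ∀ {g : α → ℝ}, AEStronglyMeasurable g μ →
      AEStronglyMeasurable (fun x => Real.exp (2 * g x)) μ := fun hg => hexp (hg.const_mul 2)
  have hsq : ∀ t : ℝ, Real.exp t ^ 2 = Real.exp (2 * t) := fun t => by
    rw [← Real.exp_nat_mul]; norm_num
  have hmem : ∀ {g : α → ℝ}, AEStronglyMeasurable g μ →
      Integrable (fun x => Real.exp (2 * g x)) μ → MemLp (fun x => Real.exp (g x)) 2 μ :=
    fun hg hi => (memLp_two_iff_integrable_sq (hexp hg)).2 (by simpa only [hsq] using hi)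
  -- Fatou's lemma along a subsequence that converges almost everywhere
  have hw2 : Integrable (fun x => Real.exp (2 * w x)) μ := by
    obtain ⟨ns, hns, hae⟩ := exists_seq_tendsto_ae_of_eLpNorm (fun n => (hv n).sub hw) hlim
    refine ⟨hexp2 hw, ?_⟩
    have hF := lintegral_liminf_le' (μ := μ) (u := atTop)
      (f := fun i x => ‖Real.exp (2 * v (ns i) x)‖ₑ) fun i => (hexp2 (hv (ns i))).enorm
    have hbd : liminf (fun i => ∫⁻ x, ‖Real.exp (2 * v (ns i) x)‖ₑ ∂μ) atTop ≤
        ENNReal.ofReal B := by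
      refine (liminf_le_liminf ?_).trans_eq (liminf_const (f := atTop) (ENNReal.ofReal B))
      filter_upwards [hns.tendsto_atTop.eventually hB] with i hi
      rw [← ofReal_integral_norm_eq_lintegral_enorm hi.1]
      refine ENNReal.ofReal_le_ofReal ?_
      simp only [Real.norm_of_nonneg (Real.exp_pos _).le]
      exact hi.2
    have heq : ∫⁻ x, ‖Real.exp (2 * w x)‖ₑ ∂μ =
        ∫⁻ x, liminf (fun i => ‖Real.exp (2 * v (ns i) x)‖ₑ) atTop ∂μ := by
      refine lintegral_congr_ae ?_
      filter_upwards [hae] with x hx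
      have h1 : Tendsto (fun i => v (ns i) x) atTop (𝓝 (w x)) := by
        have := hx.add_const (w x)
        simpa using this
      have h2 : Tendsto (fun i => ‖Real.exp (2 * v (ns i) x)‖ₑ) atTop
          (𝓝 ‖Real.exp (2 * w x)‖ₑ) :=
        ((continuous_enorm.comp (Real.continuous_exp.comp (continuous_const.mul
          continuous_id))).tendsto (w x)).comp h1
      exact h2.liminf_eq.symm
    show ∫⁻ x, ‖Real.exp (2 * w x)‖ₑ ∂μ < ⊤
    rw [heq]
    exact (hF.trans hbd).trans_lt ENNReal.ofReal_lt_top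
  have hwm := hmem hw hw2
  have hkint : ∀ {g : α → ℝ}, MemLp (fun x => Real.exp (g x)) 2 μ →
      Integrable (fun x => k x * Real.exp (g x)) μ := fun hg =>
    (hg.integrable (by norm_num)).bdd_mul hk hkC
  refine ⟨hkint hwm, ?_⟩
  refine tendsto_integral_of_L1' _ (hkint hwm).1
    (hB.mono fun n hn => hkint (hmem (hv n) hn.1)) ?_
  set D : ℝ≥0∞ := ENNReal.ofReal √B + eLpNorm (fun x => Real.exp (w x)) 2 μ with hD
  have hDt : D ≠ ⊤ := ENNReal.add_ne_top.2 ⟨ENNReal.ofReal_ne_top, hwm.2.ne⟩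
  have hl : Tendsto (fun n => ENNReal.ofReal C * (eLpNorm (fun x => v n x - w x) 2 μ * D)) atTop
      (𝓝 0) := by
    have := ENNReal.Tendsto.const_mul (a := ENNReal.ofReal C)
      (ENNReal.Tendsto.mul_const (b := D) hlim (Or.inr hDt)) (Or.inr ENNReal.ofReal_ne_top)
    simpa using this
  refine tendsto_of_tendsto_of_tendsto_of_le_of_le' tendsto_const_nhds hl
    (Eventually.of_forall fun _ => zero_le) ?_
  filter_upwards [hB] with n hn
  have hvm := hmem (hv n) hn.1
  have h1 : eLpNorm ((fun x => k x * Real.exp (v n x)) - fun x => k x * Real.exp (w x)) 1 μ ≤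
      ENNReal.ofReal C * eLpNorm ((fun x => v n x - w x) •
        ((fun x => Real.exp (v n x)) + fun x => Real.exp (w x))) 1 μ := by
    refine eLpNorm_le_mul_eLpNorm_of_ae_le_mul ?_ 1
    filter_upwards [hkC] with x hx
    simp only [Pi.sub_apply, Pi.smul_apply', Pi.add_apply, smul_eq_mul]
    rw [← mul_sub, norm_mul, norm_mul, Real.norm_of_nonneg (r := _ + _) (by positivity)]
    exact mul_le_mul hx (abs_exp_sub_exp_le _ _) (norm_nonneg _) ((norm_nonneg _).trans hx)
  refine h1.trans (mul_le_mul_right ?_ _)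
  refine (eLpNorm_smul_le_mul_eLpNorm (p := 2) (q := 2) ((hexp (hv n)).add (hexp hw))
    ((hv n).sub hw)).trans (mul_le_mul_right ?_ _)
  refine (eLpNorm_add_le (hexp (hv n)) (hexp hw) (by norm_num)).trans (add_le_add ?_ le_rfl)
  rw [eLpNorm_two_eq hvm]
  refine ENNReal.ofReal_le_ofReal (Real.sqrt_le_sqrt ?_)
  simp only [hsq]
  exact hn.2

variable {M : Type*} [TopologicalSpace M] [ChartedSpace (EuclideanHalfSpace 2) M]
  [RiemannianBundle (fun x : M => TangentSpace (𝓡∂ 2) x)] [MeasurableSpace M] [CompactSpace M]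
  [IsManifold (𝓡∂ 2) ∞ M]
  [IsContMDiffRiemannianBundle (𝓡∂ 2) ∞ (EuclideanSpace ℝ (Fin 2))
      (fun x : M => TangentSpace (𝓡∂ 2) x)]  [BorelSpace M]

theorem isH1Limit_const {u : M → ℝ} (hu : IsSmooth u) :
    IsH1Limit (fun _ => u) u (fun x => grad u x) := by
  refine ⟨fun _ => hu, by simp, fun _ => ?_, ?_⟩
  · have : (fun x => ‖grad u x - grad u x‖) = fun _ => (0 : ℝ) := by
      ext x; rw [sub_self]; exact norm_zero
    rw [this]; exact aestronglyMeasurable_const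
  · have : (fun x => ‖grad u x - grad u x‖) = fun _ => (0 : ℝ) := by
      ext x; rw [sub_self]; exact norm_zero
    rw [this]; simp

theorem IsSmooth.memH1 {u : M → ℝ} (hu : IsSmooth u) : MemH1 u :=
  ⟨memLp_of_continuous hu.continuous 2, _, _, isH1Limit_const hu⟩

theorem MemH1.exists_isH1Limit {u : M → ℝ} (hu : MemH1 u) :
    ∃ f, IsH1Limit f u (weakGrad u) := by
  have h : ∃ X, ∃ f, IsH1Limit f u X := by
    obtain ⟨-, f, X, h⟩ := hu; exact ⟨X, f, h⟩
  rw [weakGrad, dif_pos h]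
  exact h.choose_spec

theorem IsSmooth.dirichlet_eq {u : M → ℝ} (hu : IsSmooth u) :
    dirichlet u = ∫ x, ‖grad u x‖ ^ 2 ∂(area M) := by
  obtain ⟨f, hf⟩ := hu.memH1.exists_isH1Limit
  refine integral_congr_ae ?_
  filter_upwards [hf.ae_unique hu.continuous.aestronglyMeasurable (isH1Limit_const hu)] with x hx
  rw [hx]

variable [T2Space M]

/-- Smooth functions are bounded in `L²(∂Σ)` by their `H¹` norm. -/
theorem exists_trace_energy_le : ∃ C : ℝ, 0 ≤ C ∧ ∀ w : M → ℝ, IsSmooth w →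
    ∫ x, w x ^ 2 ∂(bdryLength M) ≤ C * energy w := by
  obtain ⟨C, hC0, hC⟩ := exists_trace_le (M := M)
  refine ⟨C * 2, by positivity, fun w hw => ?_⟩
  have hw2 : IsSmooth (fun x => w x ^ 2) := hw.comp (contDiff_id.pow 2)
  have hg : ∀ x, ‖grad (fun x => w x ^ 2) x‖ = 2 * (|w x| * ‖grad w x‖) := fun x => by
    rw [grad_comp (F := fun t => t ^ 2) (hw.mdifferentiableAt x) (hasDerivAt_pow 2 (w x)),
      norm_smul, norm_mul, norm_pow]
    simp [mul_assoc]
  have h := hC _ hw2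
  simp only [hg, abs_pow, sq_abs] at h
  refine h.trans ?_
  have i1 : Integrable (fun x => w x ^ 2) (area M) :=
    integrable_of_continuous (hw.continuous.pow 2)
  have i2 : Integrable (fun x => ‖grad w x‖ ^ 2) (area M) :=
    integrable_of_continuous (hw.continuous_norm_grad.pow 2)
  have h2 : ∫ x, 2 * (|w x| * ‖grad w x‖) ∂(area M) ≤ energy w := by
    unfold energy
    rw [← integral_add i1 i2]
    refine integral_mono (integrable_of_continuous
      (continuous_const.mul (hw.continuous.abs.mul hw.continuous_norm_grad))) (i1.add i2)
      fun x => ?_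
    show 2 * (|w x| * ‖grad w x‖) ≤ w x ^ 2 + ‖grad w x‖ ^ 2
    nlinarith [sq_nonneg (|w x| - ‖grad w x‖), sq_abs (w x)]
  have h3 : ∫ x, w x ^ 2 ∂(area M) ≤ energy w :=
    le_add_of_nonneg_right (integral_nonneg fun x => by positivity)
  rw [mul_assoc]
  refine mul_le_mul_of_nonneg_left ?_ hC0
  linarith

/-- Two sequences that approximate the same element of `H¹` have asymptotically close boundary
values. -/
theorem IsH1Limit.eLpNorm_bdry_sub_le {f f' : ℕ → M → ℝ} {u : M → ℝ}
    {X X' : ∀ x : M, TangentSpace (𝓡∂ 2) x} (hu : AEStronglyMeasurable u (area M))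
    (h : IsH1Limit f u X) (h' : IsH1Limit f' u X') {ε : ℝ} (hε : 0 < ε) :
    ∃ N, ∀ n ≥ N, ∀ m ≥ N,
      eLpNorm (fun x => f n x - f' m x) 2 (bdryLength M) ≤ ENNReal.ofReal ε := by
  obtain ⟨C, hC0, hC⟩ := exists_trace_energy_le (M := M)
  obtain ⟨N, hN⟩ := h.energy_sub_le hu h' (ε := ε ^ 2 / (C + 1)) (by positivity)
  refine ⟨N, fun n hn m hm => ?_⟩
  have hs : IsSmooth (fun x => f n x - f' m x) := IsSmooth.sub (h.smooth n) (h'.smooth m)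
  rw [eLpNorm_two_eq (memLp_of_continuous hs.continuous 2)]
  refine ENNReal.ofReal_le_ofReal ?_
  rw [Real.sqrt_le_left hε.le]
  calc _ ≤ C * energy (fun x => f n x - f' m x) := hC _ hs
    _ ≤ C * (ε ^ 2 / (C + 1)) := by gcongr; exact hN n hn m hm
    _ = C / (C + 1) * ε ^ 2 := by ring
    _ ≤ 1 * ε ^ 2 := by
        gcongr
        rw [div_le_one (by positivity)]; linarith
    _ = ε ^ 2 := one_mul _

theorem MemH1.isTrace_trace {u : M → ℝ} (hu : MemH1 u) : IsTrace u (trace u) := by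
  have h : ∃ τ, IsTrace u τ := by
    obtain ⟨hum, f, X, hf⟩ := hu
    have hmem : ∀ n, MemLp (f n) 2 (bdryLength M) := fun n =>
      memLp_of_continuous (hf.smooth n).continuous 2
    have hcau : CauchySeq fun n => (hmem n).toLp (f n) := by
      refine Metric.cauchySeq_iff.2 fun ε hε => ?_
      obtain ⟨N, hN⟩ := hf.eLpNorm_bdry_sub_le hum.1 hf (half_pos hε)
      refine ⟨N, fun m hm n hn => ?_⟩
      rw [dist_eq_norm, ← MemLp.toLp_sub, Lp.norm_toLp]
      have := ENNReal.toReal_mono ENNReal.ofReal_ne_top (hN m hm n hn)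
      rw [ENNReal.toReal_ofReal (half_pos hε).le] at this
      exact lt_of_le_of_lt this (half_lt_self hε)
    obtain ⟨T, hT⟩ := cauchySeq_tendsto_of_complete hcau
    have hTm : MemLp T 2 (bdryLength M) := Lp.memLp T
    have hlim : Tendsto (fun n => eLpNorm (fun x => f n x - T x) 2 (bdryLength M)) atTop (𝓝 0) :=
      (Lp.tendsto_Lp_iff_tendsto_eLpNorm'' f hmem T hTm).1 (by
        rwa [Lp.toLp_coeFn])
    refine ⟨T, hTm, fun f' X' hf' => ?_⟩
    rw [ENNReal.tendsto_atTop_zero] at hlim ⊢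
    intro ε hε
    by_cases htop : ε = ⊤
    · exact ⟨0, fun n _ => htop ▸ le_top⟩
    have hε0 : 0 < ε.toReal := ENNReal.toReal_pos hε.ne' htop
    obtain ⟨N, hN⟩ := hf'.eLpNorm_bdry_sub_le hum.1 hf (half_pos hε0)
    obtain ⟨N', hN'⟩ := hlim (ENNReal.ofReal (ε.toReal / 2)) (by simpa using hε0)
    refine ⟨max N N', fun n hn => ?_⟩
    have hn1 : N ≤ n := (le_max_left _ _).trans hn
    have hn2 : N' ≤ n := (le_max_right _ _).trans hn
    have hm : MemLp (f' n) 2 (bdryLength M) := memLp_of_continuous (hf'.smooth n).continuous 2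
    calc eLpNorm (fun x => f' n x - T x) 2 (bdryLength M)
        = eLpNorm ((fun x => f' n x - f n x) + fun x => f n x - T x) 2 (bdryLength M) := by
          congr 1; ext x; simp
      _ ≤ _ := eLpNorm_add_le (hm.1.sub (hmem n).1) ((hmem n).1.sub hTm.1) (by norm_num)
      _ ≤ ENNReal.ofReal (ε.toReal / 2) + ENNReal.ofReal (ε.toReal / 2) :=
          add_le_add (hN n hn1 n hn1) (hN' n hn2)
      _ = ε := by
          rw [← ENNReal.ofReal_add (by positivity) (by positivity), add_halves,
            ENNReal.ofReal_toReal htop]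
  rw [trace, dif_pos h]
  exact h.choose_spec

theorem IsSmooth.trace_ae_eq {u : M → ℝ} (hu : IsSmooth u) :
    ∀ᵐ x ∂(bdryLength M), trace u x = u x := by
  obtain ⟨hm, ht⟩ := hu.memH1.isTrace_trace
  have h0 := tendsto_nhds_unique (ht _ _ (isH1Limit_const hu)) tendsto_const_nhds
  have h1 := (eLpNorm_eq_zero_iff (hu.continuous.aestronglyMeasurable.sub hm.1)
    (by norm_num)).1 h0.symm
  filter_upwards [h1] with x hx
  simp only [Pi.zero_apply, Pi.sub_apply] at hx
  linarith

theorem IsSmooth.bdryInt_eq {u : M → ℝ} (hu : IsSmooth u) (h : M → ℝ) :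
    bdryInt h u = ∫ x, h x * Real.exp (u x / 2) ∂(bdryLength M) := by
  refine integral_congr_ae ?_
  filter_upwards [hu.trace_ae_eq] with x hx
  rw [hx]

/-- The two exponential integrals pass to the limit along an approximating sequence. -/
theorem IsH1Limit.tendsto_integrals {f : ℕ → M → ℝ} {u : M → ℝ}
    {X : ∀ x : M, TangentSpace (𝓡∂ 2) x} (hu : MemH1 u) (hf : IsH1Limit f u X) {K h : M → ℝ}
    (hK : Continuous K) (hh : ContinuousOn h (bdry M)) :
    (Integrable (fun x => |K x| * Real.exp (u x)) (area M) ∧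
      Tendsto (fun n => ∫ x, |K x| * Real.exp (f n x) ∂(area M)) atTop (𝓝 (curvInt K u))) ∧
    (Integrable (fun x => h x * Real.exp (trace u x / 2)) (bdryLength M) ∧
      Tendsto (fun n => ∫ x, h x * Real.exp (f n x / 2) ∂(bdryLength M)) atTop
        (𝓝 (bdryInt h u))) := by
  obtain ⟨C, hC⟩ := hf.exists_exp_bound hu.1.1
  have hfc : ∀ n, Continuous (f n) := fun n => (hf.smooth n).continuous
  constructor
  · obtain ⟨CK, hCK⟩ := isCompact_univ.exists_bound_of_continuousOn hK.abs.continuousOn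
    exact tendsto_integral_mul_exp hK.abs.aestronglyMeasurable
      (ae_of_all _ fun x => hCK x (mem_univ x))
      (fun n => (hfc n).aestronglyMeasurable) hu.1.1 hf.tendsto_fun
      (hC.mono fun n hn => ⟨integrable_of_continuous (by have := hfc n; fun_prop), hn.1⟩)
  · obtain ⟨Ch, hCh⟩ := isCompact_bdry.exists_bound_of_continuousOn hh
    obtain ⟨htm, ht⟩ := hu.isTrace_trace
    refine tendsto_integral_mul_exp (w := fun x => trace u x / 2) (v := fun n x => f n x / 2)
      (integrable_bdryLength_of_continuousOn hh).1
      (ae_bdryLength_of_forall hCh) (fun n => ((hfc n).div_const 2).aestronglyMeasurable)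
      (by simp only [div_eq_mul_inv]; exact AEStronglyMeasurable.mul_const htm.1 _) ?_
      (B := C) (hC.mono fun n hn => ⟨?_, ?_⟩)
    · refine tendsto_of_tendsto_of_tendsto_of_le_of_le tendsto_const_nhds (ht f X hf)
        (fun _ => zero_le) fun n => ?_
      refine eLpNorm_mono fun x => ?_
      rw [← sub_div, norm_div]
      exact div_le_self (norm_nonneg _) (by norm_num)
    · exact integrable_of_continuous (by have := hfc n; fun_prop)
    · simpa only [mul_div_cancel₀ _ (two_ne_zero (α := ℝ))] using hn.2

theorem curvInt_pos {u K : M → ℝ} (hu : MemH1 u) (hK : Continuous K) {x₀ : M} (hx₀ : K x₀ ≠ 0) :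
    0 < curvInt K u := by
  obtain ⟨f, hf⟩ := hu.exists_isH1Limit
  have hi := (hf.tendsto_integrals hu hK (h := fun _ => 0) continuousOn_const).1.1
  unfold curvInt
  rw [integral_pos_iff_support_of_nonneg (fun x => by positivity) hi]
  refine lt_of_lt_of_le (area_pos (isOpen_ne_fun hK continuous_const) hx₀)
    (measure_mono fun x hx => ?_)
  have : |K x| ≠ 0 := abs_ne_zero.2 hx
  exact mul_ne_zero this (Real.exp_pos _).ne'

/-- The inequality in `H¹`, by passage to the limit from smooth functions. -/
theorem exists_trace_inequality {K h : M → ℝ} (hK : Continuous K) (hh : ContinuousOn h (bdry M))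
    (hK0 : ∀ x ∈ bdry M, K x ≠ 0) (hM : (bdry M).Nonempty) {D : ℝ} (hD0 : 0 ≤ D)
    (hD : ∀ x ∈ bdry M, |h x| ≤ D * √|K x|) {ε : ℝ} (hε : 0 < ε) :
    ∃ C : ℝ, ∀ u : M → ℝ, MemH1 u →
      bdryInt h u ^ 2 / curvInt K u ≤ (D + ε) ^ 2 / 4 * dirichlet u + C := by
  obtain ⟨C, hC⟩ := exists_smooth_inequality hK hh hK0 hD0 hD hε
  refine ⟨C, fun u hu => ?_⟩
  obtain ⟨x₀, hx₀⟩ := hM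
  obtain ⟨f, hf⟩ := hu.exists_isH1Limit
  obtain ⟨⟨-, h1⟩, -, h2⟩ := hf.tendsto_integrals hu hK hh
  obtain ⟨B, hB, hBle⟩ := hf.exists_tendsto_bound
  rw [div_le_iff₀ (curvInt_pos hu hK (hK0 x₀ hx₀))]
  refine le_of_tendsto_of_tendsto (h2.pow 2) (((hB.const_mul _).add_const C).mul h1) ?_
  filter_upwards [hBle] with n hn
  refine (hC (f n) (hf.smooth n)).trans ?_
  refine mul_le_mul_of_nonneg_right ?_ (integral_nonneg fun x => by positivity)
  gcongr

end

/-! ### A function with a peak at the boundary -/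

section

theorem setLIntegral_Ici_inv_sq_le {a c : ℝ} (ha : 0 < a) (hc : 0 < c) :
    ∫⁻ s in Ici (0 : ℝ), ENNReal.ofReal (1 / (a + c * s) ^ 2) ≤ ENNReal.ofReal (1 / (c * a)) := by
  have hpos : ∀ x ∈ Ici (0 : ℝ), 0 < a + c * x := fun x hx => by
    have : 0 ≤ c * x := mul_nonneg hc.le hx
    linarith
  have hd : ∀ x ∈ Ici (0 : ℝ), HasDerivAt (fun s => -(1 / c) * (a + c * s)⁻¹)
      (1 / (a + c * x) ^ 2) x := fun x hx => by
    have h1 : HasDerivAt (fun s => a + c * s) c x := by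
      simpa using ((hasDerivAt_id x).const_mul c).const_add a
    refine ((h1.fun_inv (hpos x hx).ne').const_mul (-(1 / c))).congr_deriv ?_
    field_simp
  have h0 : ∀ x ∈ Ioi (0 : ℝ), 0 ≤ 1 / (a + c * x) ^ 2 := fun x _ => by positivity
  have hl : Tendsto (fun s => -(1 / c) * (a + c * s)⁻¹) atTop (𝓝 0) := by
    have : Tendsto (fun s => a + c * s) atTop atTop :=
      tendsto_atTop_add_const_left _ _ (tendsto_id.const_mul_atTop hc)
    simpa using (tendsto_inv_atTop_zero.comp this).const_mul (-(1 / c))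
  have hi := integrableOn_Ioi_deriv_of_nonneg' hd h0 hl
  have he := integral_Ioi_of_hasDerivAt_of_nonneg' hd h0 hl
  rw [Measure.restrict_congr_set Ioi_ae_eq_Ici.symm, ← ofReal_integral_eq_lintegral_ofReal hi
    ((ae_restrict_mem measurableSet_Ioi).mono h0), he]
  refine ENNReal.ofReal_le_ofReal (le_of_eq ?_)
  rw [mul_zero, add_zero]
  field_simp
  ring

/-- Integration over the lines orthogonal to the boundary of the square of
`1 / (δ + c y₀ + (y₁ - t₀)²)`. -/
theorem lintegral_box_le {c δ t₀ r : ℝ} (hc : 0 < c) (hδ : 0 < δ) :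
    ∫⁻ y : Plane, {y : Plane | 0 ≤ y 0 ∧ y 1 ∈ Ioo (t₀ - r) (t₀ + r)}.indicator
        (fun y => ENNReal.ofReal (1 / (δ + (y 1 - t₀) ^ 2 + c * y 0) ^ 2)) y ≤
      ∫⁻ t in Ioo (t₀ - r) (t₀ + r), ENNReal.ofReal (1 / (c * (δ + (t - t₀) ^ 2))) := by
  have hS : MeasurableSet {y : Plane | 0 ≤ y 0 ∧ y 1 ∈ Ioo (t₀ - r) (t₀ + r)} := by
    have h0 : Measurable fun y : Plane => y 0 := by fun_prop
    have h1 : Measurable fun y : Plane => y 1 := by fun_prop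
    exact (measurableSet_le measurable_const h0).inter (h1 measurableSet_Ioo)
  have hF : Measurable fun y : Plane =>
      ENNReal.ofReal (1 / (δ + (y 1 - t₀) ^ 2 + c * y 0) ^ 2) := by fun_prop
  have hFi := hF.indicator hS
  rw [lintegral_plane hFi, lintegral_lintegral_swap (f := fun s t =>
      {y : Plane | 0 ≤ y 0 ∧ y 1 ∈ Ioo (t₀ - r) (t₀ + r)}.indicator
        (fun y => ENNReal.ofReal (1 / (δ + (y 1 - t₀) ^ 2 + c * y 0) ^ 2)) (pt (s, t)))
    (hFi.comp continuous_pt.measurable).aemeasurable, ← lintegral_indicator measurableSet_Ioo]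
  refine lintegral_mono fun t => ?_
  by_cases ht : t ∈ Ioo (t₀ - r) (t₀ + r)
  · rw [indicator_of_mem ht]
    refine le_trans (le_of_eq ?_)
      (setLIntegral_Ici_inv_sq_le (a := δ + (t - t₀) ^ 2) (by positivity) hc)
    rw [← lintegral_indicator measurableSet_Ici]
    refine lintegral_congr fun s => ?_
    have hmem : pt (s, t) ∈ {y : Plane | 0 ≤ y 0 ∧ y 1 ∈ Ioo (t₀ - r) (t₀ + r)} ↔
        s ∈ Ici (0 : ℝ) :=
      ⟨fun h => h.1, fun h => ⟨h, ht⟩⟩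
    by_cases hs : s ∈ Ici (0 : ℝ)
    · rw [indicator_of_mem hs, indicator_of_mem (hmem.2 hs)]
      simp [pt]
    · rw [indicator_of_notMem hs, indicator_of_notMem (mt hmem.1 hs)]
  · rw [indicator_of_notMem ht]
    refine le_of_eq ((lintegral_congr fun s => indicator_of_notMem ?_ _).trans lintegral_zero)
    rintro ⟨-, h⟩
    exact ht (by simpa [pt] using h)

theorem le_setLIntegral_Ioo {lam t₀ r ρ : ℝ} (hlam : 0 ≤ lam) (hρ : 0 < ρ) (hρr : ρ ≤ r) :
    ENNReal.ofReal (lam / (2 * ρ)) ≤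
      ∫⁻ t in Ioo (t₀ - r) (t₀ + r), ENNReal.ofReal (lam / (ρ ^ 2 + (t - t₀) ^ 2)) := by
  calc ENNReal.ofReal (lam / (2 * ρ))
      = ∫⁻ t in Ioo t₀ (t₀ + ρ), ENNReal.ofReal (lam / (2 * ρ ^ 2)) := by
        rw [setLIntegral_const, Real.volume_Ioo, ← ENNReal.ofReal_mul (by positivity)]
        congr 1; field_simp; ring
    _ ≤ ∫⁻ t in Ioo t₀ (t₀ + ρ), ENNReal.ofReal (lam / (ρ ^ 2 + (t - t₀) ^ 2)) := by
        refine setLIntegral_mono' measurableSet_Ioo fun t ht => ENNReal.ofReal_le_ofReal ?_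
        have : (t - t₀) ^ 2 ≤ ρ ^ 2 := by
          have h1 : 0 ≤ t - t₀ := by linarith [ht.1]
          have h2 : t - t₀ ≤ ρ := by linarith [ht.2]
          gcongr
        gcongr
        linarith
    _ ≤ _ := lintegral_mono_set (Ioo_subset_Ioo (by linarith) (by linarith))

/-- An inequality between quadratic polynomials that holds for arbitrarily large arguments holds for
their leading coefficients. -/
theorem sq_le_of_frequently {η κ b C C' : ℝ} (hη : 0 < η)
    (h : ∀ R : ℝ, ∃ L A : ℝ, R ≤ L ∧ η * L - C ≤ A ∧ A ^ 2 ≤ (b * L + C') * (κ * L + C)) :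
    η ^ 2 ≤ b * κ := by
  by_contra! hlt
  set d := η ^ 2 - b * κ with hd
  have hd0 : 0 < d := by linarith
  set c₁ := |2 * η * C + b * C + C' * κ| with hc₁
  set c₂ := |C' * C - C ^ 2| with hc₂
  obtain ⟨L, A, hL, hA, hle⟩ := h (max (max 1 (C / η)) ((c₁ + c₂) / d + 1))
  have hL1 : 1 ≤ L := ((le_max_left _ _).trans (le_max_left _ _)).trans hL
  have hL2 : C / η ≤ L := ((le_max_right _ _).trans (le_max_left _ _)).trans hL
  have hL3 : (c₁ + c₂) / d + 1 ≤ L := (le_max_right _ _).trans hL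
  have h0 : 0 ≤ η * L - C := by
    rw [div_le_iff₀ hη] at hL2; linarith
  have hsq : (η * L - C) ^ 2 ≤ A ^ 2 := by gcongr
  have h3 : c₁ + c₂ < d * L := by
    have : (c₁ + c₂) / d < L := by linarith
    rw [div_lt_iff₀ hd0] at this; linarith
  have e : (η * L - C) ^ 2 - (b * L + C') * (κ * L + C) =
      d * L * L - (2 * η * C + b * C + C' * κ) * L - (C' * C - C ^ 2) := by rw [hd]; ring
  have i1 : (2 * η * C + b * C + C' * κ) * L ≤ c₁ * L := by gcongr; exact le_abs_self _
  have i2 : C' * C - C ^ 2 ≤ c₂ * L :=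
    (le_abs_self _).trans (le_mul_of_one_le_right (abs_nonneg _) hL1)
  have i3 : (c₁ + c₂) * L < d * L * L := by gcongr
  linarith

variable {M : Type*} [TopologicalSpace M] [ChartedSpace (EuclideanHalfSpace 2) M]
  [RiemannianBundle (fun x : M => TangentSpace (𝓡∂ 2) x)] [CompactSpace M]
  [IsManifold (𝓡∂ 2) ∞ M]
  [IsContMDiffRiemannianBundle (𝓡∂ 2) ∞ (EuclideanSpace ℝ (Fin 2))
      (fun x : M => TangentSpace (𝓡∂ 2) x)] [T2Space M]

/-- A smooth function with a single zero, at a boundary point, near which it is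
`c y₀ + (y₁ - t₀)²` in the chart around that point. -/
theorem exists_peak {x₀ : M} (hx₀ : x₀ ∈ bdry M) {c : ℝ} (hc : 0 < c) :
    ∃ ψ : M → ℝ, IsSmooth ψ ∧ (∀ x, 0 ≤ ψ x) ∧ (∀ x, x ≠ x₀ → 0 < ψ x) ∧
      (∀ᶠ y in 𝓝[halfPlane] (extChartAt (𝓡∂ 2) x₀ x₀),
        ψ ((extChartAt (𝓡∂ 2) x₀).symm y) = c * y 0 + (y 1 - extChartAt (𝓡∂ 2) x₀ x₀ 1) ^ 2) ∧
      ‖grad ψ x₀‖ ^ 2 * metricDet x₀ (extChartAt (𝓡∂ 2) x₀ x₀) =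
        c ^ 2 * metricCoeff x₀ (extChartAt (𝓡∂ 2) x₀ x₀) 1 1 := by
  have hsrc : x₀ ∈ (extChartAt (𝓡∂ 2) x₀).source := mem_extChartAt_source x₀
  have htgt : extChartAt (𝓡∂ 2) x₀ x₀ ∈ (extChartAt (𝓡∂ 2) x₀).target :=
    mem_extChartAt_target x₀
  set φ := extChartAt (𝓡∂ 2) x₀ with hφ
  set t₀ : ℝ := φ x₀ 1 with ht₀
  have hy0 : φ x₀ 0 = 0 := (mem_bdry_iff hsrc).1 hx₀
  set F : Plane → ℝ := fun y => c * y 0 + (y 1 - t₀) ^ 2 with hF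
  have hFs : ContDiff ℝ ∞ F := by simp only [hF]; fun_prop
  obtain ⟨b⟩ : Nonempty (SmoothBumpFunction (𝓡∂ 2) x₀) := inferInstance
  set ψ : M → ℝ := fun x => b x • F (φ x) + (1 - b x) with hψ
  have hsm : IsSmooth ψ := by
    refine ContMDiff.add (b.contMDiff_smul ?_) (contMDiff_const.sub b.contMDiff)
    exact hFs.contMDiff.comp_contMDiffOn (contMDiffOn_extChartAt (n := ∞))
  have hF0 : ∀ x ∈ φ.source, 0 ≤ F (φ x) := fun x hx => by
    have : 0 ≤ φ x 0 := target_subset_halfPlane x₀ (φ.map_source hx)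
    simp only [hF]; positivity
  have hbsrc : ∀ x, b x ≠ 0 → x ∈ φ.source := fun x hx => by
    rw [hφ, extChartAt_source]; exact b.support_subset_source hx
  have hnn : ∀ x, 0 ≤ ψ x := fun x => by
    have h1 := b.le_one (x := x)
    by_cases hb : b x = 0
    · simp [hψ, hb]
    · have := mul_nonneg (b.nonneg (x := x)) (hF0 x (hbsrc x hb))
      simp only [hψ, smul_eq_mul]; linarith
  have hpos : ∀ x, x ≠ x₀ → 0 < ψ x := fun x hx => by
    have h1 := b.le_one (x := x)
    by_cases hb : b x = 0
    · simp [hψ, hb]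
    · have hxs := hbsrc x hb
      have hb0 : 0 < b x := lt_of_le_of_ne b.nonneg (Ne.symm hb)
      have hFp : 0 < F (φ x) := by
        refine lt_of_le_of_ne (hF0 x hxs) fun h0 => hx ?_
        have hn : 0 ≤ φ x 0 := target_subset_halfPlane x₀ (φ.map_source hxs)
        simp only [hF] at h0
        have e0 : φ x 0 = 0 := by
          have := mul_nonneg hc.le hn
          have h2 : c * φ x 0 = 0 := by linarith [sq_nonneg (φ x 1 - t₀)]
          exact (mul_eq_zero.1 h2).resolve_left hc.ne'
        have e1 : φ x 1 = t₀ := by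
          have : (φ x 1 - t₀) ^ 2 = 0 := by rw [e0] at h0; linarith
          have := pow_eq_zero_iff (two_ne_zero) |>.1 this
          linarith
        refine φ.injOn hxs hsrc ?_
        rw [eq_linePt e0, eq_linePt hy0, e1]
      have := mul_pos hb0 hFp
      simp only [hψ, smul_eq_mul]; linarith
  have hev : ∀ᶠ y in 𝓝[halfPlane] (φ x₀), ψ (φ.symm y) = F y := by
    have h1 : ∀ᶠ y in 𝓝 (φ x₀), b (φ.symm y) = 1 := by
      have hcont : ContinuousAt φ.symm (φ x₀) := continuousAt_extChartAt_symm x₀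
      have h2 : Tendsto φ.symm (𝓝 (φ x₀)) (𝓝 x₀) := by
        have := hcont.tendsto
        rwa [φ.left_inv hsrc] at this
      exact h2.eventually b.eventuallyEq_one
    filter_upwards [nhdsWithin_le_nhds h1, target_mem_nhdsWithin htgt] with y hy hyT
    simp only [hψ]
    rw [hy, φ.right_inv hyT]; simp
  refine ⟨ψ, hsm, hnn, hpos, hev, ?_⟩
  have hyH : φ x₀ ∈ halfPlane := target_subset_halfPlane x₀ htgt
  have hder : ∀ v : Plane, fderivWithin ℝ (fun z => ψ (φ.symm z)) halfPlane (φ x₀) v = c * v 0 := by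
    intro v
    have he : (fun z => ψ (φ.symm z)) =ᶠ[𝓝[halfPlane] (φ x₀)] F := hev
    have hFd : HasFDerivAt F (c • (EuclideanSpace.proj (0 : Fin 2) : Plane →L[ℝ] ℝ) +
        (2 * (φ x₀ 1 - t₀)) • (EuclideanSpace.proj (1 : Fin 2) : Plane →L[ℝ] ℝ)) (φ x₀) := by
      have p0 : HasFDerivAt (fun y : Plane => y 0)
        (EuclideanSpace.proj (0 : Fin 2) : Plane →L[ℝ] ℝ) (φ x₀) :=
        (EuclideanSpace.proj (0 : Fin 2) : Plane →L[ℝ] ℝ).hasFDerivAt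
      have p1 : HasFDerivAt (fun y : Plane => y 1)
        (EuclideanSpace.proj (1 : Fin 2) : Plane →L[ℝ] ℝ) (φ x₀) :=
        (EuclideanSpace.proj (1 : Fin 2) : Plane →L[ℝ] ℝ).hasFDerivAt
      have := (p0.const_mul c).add ((p1.sub_const t₀).pow 2)
      refine this.congr_fderiv ?_
      simp
    rw [he.fderivWithin_eq_of_mem hyH, hFd.hasFDerivWithinAt.fderivWithin
      (uniqueDiffOn_halfPlane _ hyH)]
    simp [ht₀]
  have hn := norm_sq_mul_metricDet htgt (grad ψ (φ.symm (φ x₀)))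
  have i0 := inner_grad_coordVec_zero hsm htgt
  have i1 := inner_grad_coordVec_one hsm htgt
  rw [← hφ, hder] at i0 i1
  rw [i0, i1] at hn
  have e : ‖grad ψ (φ.symm (φ x₀))‖ = ‖grad ψ x₀‖ := by rw [φ.left_inv hsrc]
  rw [e] at hn
  rw [hn]
  simp [pt]
  ring

end

/-! ### Comparison of the two masses of the peak -/

section

variable {M : Type*} [TopologicalSpace M] [ChartedSpace (EuclideanHalfSpace 2) M]

/-- A half-box with one side on the boundary line, centred at `(0, t₀)`. -/
def halfBox (t₀ r : ℝ) : Set Plane := {y | 0 ≤ y 0 ∧ y 0 < r ∧ y 1 ∈ Ioo (t₀ - r) (t₀ + r)}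

theorem exists_halfBox {t₀ : ℝ} {P : Plane → Prop}
    (h : ∀ᶠ y in 𝓝[halfPlane] (linePt t₀), P y) : ∃ r, 0 < r ∧ ∀ y ∈ halfBox t₀ r, P y := by
  have h1 := eventually_nhdsWithin_iff.1 h
  have hpt : Tendsto pt (𝓝 (0, t₀)) (𝓝 (linePt t₀)) := continuous_pt.tendsto (0, t₀)
  have h2 : ∀ᶠ z in 𝓝 ((0, t₀) : ℝ × ℝ), pt z ∈ halfPlane → P (pt z) := hpt.eventually h1
  obtain ⟨r, hr, hb⟩ := Metric.eventually_nhds_iff.1 h2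
  refine ⟨r, hr, fun y hy => ?_⟩
  have e : pt (y 0, y 1) = y := by ext i; fin_cases i <;> simp [pt]
  have hd : dist ((y 0, y 1) : ℝ × ℝ) (0, t₀) < r := by
    obtain ⟨h0, h0r, h1l, h1r⟩ := hy
    rw [Prod.dist_eq, max_lt_iff, Real.dist_eq, Real.dist_eq, sub_zero, abs_of_nonneg h0, abs_lt]
    exact ⟨h0r, by linarith, by linarith⟩
  have := hb hd
  rw [e] at this
  exact this hy.1

/-- The part of the surface that corresponds to a half-box. -/
def boxNhd (p : M) (t₀ r : ℝ) : Set M :=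
  (extChartAt (𝓡∂ 2) p).source ∩
    extChartAt (𝓡∂ 2) p ⁻¹' {y | y 0 < r ∧ y 1 ∈ Ioo (t₀ - r) (t₀ + r)}

theorem isOpen_boxNhd (p : M) (t₀ r : ℝ) : IsOpen (boxNhd p t₀ r) := by
  refine (continuousOn_extChartAt p).isOpen_inter_preimage (isOpen_extChartAt_source p) ?_
  have h0 : Continuous fun y : Plane => y 0 := by fun_prop
  have h1 : Continuous fun y : Plane => y 1 := by fun_prop
  exact (isOpen_lt h0 continuous_const).inter (isOpen_Ioo.preimage h1)

theorem symm_mem_boxNhd_iff {p : M} {t₀ r : ℝ} {y : Plane}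
    (hy : y ∈ (extChartAt (𝓡∂ 2) p).target) :
    (extChartAt (𝓡∂ 2) p).symm y ∈ boxNhd p t₀ r ↔ y ∈ halfBox t₀ r := by
  have h0 : 0 ≤ y 0 := target_subset_halfPlane p hy
  have h1 := (extChartAt (𝓡∂ 2) p).map_target hy
  simp only [boxNhd, halfBox, mem_inter_iff, mem_preimage, (extChartAt (𝓡∂ 2) p).right_inv hy,
    mem_ofPred_eq, h0, h1, true_and]

theorem map_mem_halfBox {p : M} {t₀ r : ℝ} {x : M} (hx : x ∈ boxNhd p t₀ r) :
    extChartAt (𝓡∂ 2) p x ∈ halfBox t₀ r :=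
  ⟨target_subset_halfPlane p ((extChartAt (𝓡∂ 2) p).map_source hx.1), hx.2.1, hx.2.2⟩

variable [RiemannianBundle (fun x : M => TangentSpace (𝓡∂ 2) x)] [CompactSpace M]
  [IsManifold (𝓡∂ 2) ∞ M]
  [IsContMDiffRiemannianBundle (𝓡∂ 2) ∞ (EuclideanSpace ℝ (Fin 2))
      (fun x : M => TangentSpace (𝓡∂ 2) x)] [MeasurableSpace M] [BorelSpace M]

theorem ofReal_integral_indicator {μ : Measure M} [IsFiniteMeasure μ] {w : M → ℝ}
    (hw : Continuous w) (h0 : ∀ x, 0 ≤ w x) {W : Set M} (hW : IsOpen W) :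
    Measurable (W.indicator fun x => ENNReal.ofReal (w x)) ∧
    ENNReal.ofReal (∫ x, W.indicator w x ∂μ) =
      ∫⁻ x, W.indicator (fun x => ENNReal.ofReal (w x)) x ∂μ := by
  refine ⟨(ENNReal.measurable_ofReal.comp hw.measurable).indicator hW.measurableSet, ?_⟩
  rw [ofReal_integral_eq_lintegral_ofReal ((integrable_of_continuous hw).indicator hW.measurableSet)
    (ae_of_all _ fun x => indicator_nonneg (fun x _ => h0 x) x)]
  refine lintegral_congr fun x => ?_
  by_cases hx : x ∈ W
  · rw [indicator_of_mem hx, indicator_of_mem hx]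
  · rw [indicator_of_notMem hx, indicator_of_notMem hx, ENNReal.ofReal_zero]

/-- Near the peak, the area integral of `w²` with `w = 1 / (ρ² + ψ)` is at most the boundary
integral of `w`, which grows like `1 / ρ`. -/
theorem integral_sq_le_integral_bdry {p : M} {ψ : M → ℝ} (hψ : Continuous ψ) (hψ0 : ∀ x, 0 ≤ ψ x)
    {t₀ r c lam : ℝ} (hc : 0 < c) (hlam : 0 < lam)
    (hbox : ∀ y ∈ halfBox t₀ r, y ∈ (extChartAt (𝓡∂ 2) p).target ∧
      ψ ((extChartAt (𝓡∂ 2) p).symm y) = c * y 0 + (y 1 - t₀) ^ 2 ∧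
      areaDensity p y ≤ c * lam ∧ lam ≤ √(metricCoeff p y 1 1))
    {ρ : ℝ} (hρ : 0 < ρ) (hρr : ρ ≤ r) :
    ∫ x, (boxNhd p t₀ r).indicator (fun x => (1 / (ρ ^ 2 + ψ x)) ^ 2) x ∂(area M) ≤
      ∫ x, (boxNhd p t₀ r).indicator (fun x => 1 / (ρ ^ 2 + ψ x)) x ∂(bdryLength M) ∧
    lam / (2 * ρ) ≤
      ∫ x, (boxNhd p t₀ r).indicator (fun x => 1 / (ρ ^ 2 + ψ x)) x ∂(bdryLength M) := by
  set W := boxNhd p t₀ r with hWdef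
  have hW : IsOpen W := isOpen_boxNhd p t₀ r
  have hpos : ∀ x, 0 < ρ ^ 2 + ψ x := fun x => by have := hψ0 x; positivity
  have hw : Continuous fun x => 1 / (ρ ^ 2 + ψ x) :=
    continuous_const.div (continuous_const.add hψ) fun x => (hpos x).ne'
  have hw0 : ∀ x, 0 ≤ 1 / (ρ ^ 2 + ψ x) := fun x => (one_div_pos.2 (hpos x)).le
  obtain ⟨m1, e1⟩ := ofReal_integral_indicator (μ := area M) (hw.pow 2)
    (fun x => sq_nonneg _) hW
  obtain ⟨m2, e2⟩ := ofReal_integral_indicator (μ := bdryLength M) hw hw0 hW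
  set I := ∫⁻ t in Ioo (t₀ - r) (t₀ + r), ENNReal.ofReal (lam / (ρ ^ 2 + (t - t₀) ^ 2)) with hI
  have hoff : ∀ (g : M → ℝ≥0∞), ∀ x ∉ (extChartAt (𝓡∂ 2) p).source, W.indicator g x = 0 :=
    fun g x hx => indicator_of_notMem (fun h => hx h.1) _
  have hJ : ENNReal.ofReal
      (∫ x, W.indicator (fun x => (1 / (ρ ^ 2 + ψ x)) ^ 2) x ∂(area M)) ≤ I := by
    refine (le_of_eq e1).trans ?_
    rw [lintegral_area_chart p m1 (hoff _), ← lintegral_indicator (measurableSet_target p)]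
    calc _ ≤ ∫⁻ y : Plane, ENNReal.ofReal (c * lam) *
          {y : Plane | 0 ≤ y 0 ∧ y 1 ∈ Ioo (t₀ - r) (t₀ + r)}.indicator
            (fun y => ENNReal.ofReal (1 / (ρ ^ 2 + (y 1 - t₀) ^ 2 + c * y 0) ^ 2)) y := by
          refine lintegral_mono fun y => ?_
          by_cases hyT : y ∈ (extChartAt (𝓡∂ 2) p).target
          · rw [indicator_of_mem hyT]
            by_cases hyb : y ∈ halfBox t₀ r
            · obtain ⟨-, hψy, hdy, -⟩ := hbox y hyb
              rw [indicator_of_mem ((symm_mem_boxNhd_iff hyT).2 hyb),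
                indicator_of_mem (show y ∈ {y : Plane | 0 ≤ y 0 ∧ y 1 ∈ Ioo (t₀ - r) (t₀ + r)} from
                  ⟨hyb.1, hyb.2.2⟩)]
              refine mul_le_mul' (ENNReal.ofReal_le_ofReal hdy) (le_of_eq ?_)
              simp only [Pi.pow_apply]
              rw [hψy, div_pow, one_pow]
              congr 3; ring
            · rw [indicator_of_notMem (fun h => hyb ((symm_mem_boxNhd_iff hyT).1 h)), mul_zero]
              exact zero_le
          · rw [indicator_of_notMem hyT]; exact zero_le
      _ = ENNReal.ofReal (c * lam) * ∫⁻ y : Plane,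
          {y : Plane | 0 ≤ y 0 ∧ y 1 ∈ Ioo (t₀ - r) (t₀ + r)}.indicator
            (fun y => ENNReal.ofReal (1 / (ρ ^ 2 + (y 1 - t₀) ^ 2 + c * y 0) ^ 2)) y :=
          lintegral_const_mul' _ _ ENNReal.ofReal_ne_top
      _ ≤ ENNReal.ofReal (c * lam) * ∫⁻ t in Ioo (t₀ - r) (t₀ + r),
            ENNReal.ofReal (1 / (c * (ρ ^ 2 + (t - t₀) ^ 2))) :=
          mul_le_mul_right (lintegral_box_le hc (by positivity)) _
      _ = I := by
          rw [← lintegral_const_mul' _ _ ENNReal.ofReal_ne_top]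
          refine lintegral_congr fun t => ?_
          rw [← ENNReal.ofReal_mul (by positivity)]
          congr 1
          have : (0 : ℝ) < ρ ^ 2 + (t - t₀) ^ 2 := by positivity
          field_simp
  have hL : I ≤
      ENNReal.ofReal (∫ x, W.indicator (fun x => 1 / (ρ ^ 2 + ψ x)) x ∂(bdryLength M)) := by
    refine le_trans ?_ (le_of_eq e2.symm)
    rw [lintegral_bdryLength_chart p m2 (hoff _), ← lintegral_indicator (measurableSet_lineSet p),
      hI, ← lintegral_indicator measurableSet_Ioo]
    refine lintegral_mono fun t => ?_
    by_cases ht : t ∈ Ioo (t₀ - r) (t₀ + r)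
    · have hyb : linePt t ∈ halfBox t₀ r := by
        refine ⟨by simp [linePt], by simpa [linePt] using hρ.trans_le hρr,
          by simpa [linePt] using ht⟩
      obtain ⟨hyT, hψy, -, hly⟩ := hbox _ hyb
      have htl : t ∈ lineSet p := hyT
      rw [indicator_of_mem ht, indicator_of_mem htl,
        indicator_of_mem ((symm_mem_boxNhd_iff hyT).2 hyb), hψy,
        ← ENNReal.ofReal_mul (show 0 ≤ lengthDensity p t from Real.sqrt_nonneg _)]
      refine ENNReal.ofReal_le_ofReal ?_
      have e : c * linePt t 0 + (linePt t 1 - t₀) ^ 2 = (t - t₀) ^ 2 := by simp [linePt]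
      rw [e, mul_one_div]
      have : (0 : ℝ) < ρ ^ 2 + (t - t₀) ^ 2 := by positivity
      exact div_le_div_of_nonneg_right hly this.le
    · rw [indicator_of_notMem ht]; exact zero_le
  have hLnn : 0 ≤ ∫ x, W.indicator (fun x => 1 / (ρ ^ 2 + ψ x)) x ∂(bdryLength M) :=
    integral_nonneg fun x => indicator_nonneg (fun x _ => hw0 x) x
  exact ⟨(ENNReal.ofReal_le_ofReal_iff hLnn).1 (hJ.trans hL),
    (ENNReal.ofReal_le_ofReal_iff hLnn).1 ((le_setLIntegral_Ioo hlam.le hρ hρr).trans hL)⟩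

end

/-! ### Concentration at a boundary point -/

section

variable {M : Type*} [TopologicalSpace M] [ChartedSpace (EuclideanHalfSpace 2) M]
  [RiemannianBundle (fun x : M => TangentSpace (𝓡∂ 2) x)] [CompactSpace M]
  [IsManifold (𝓡∂ 2) ∞ M]
  [IsContMDiffRiemannianBundle (𝓡∂ 2) ∞ (EuclideanSpace ℝ (Fin 2))
      (fun x : M => TangentSpace (𝓡∂ 2) x)] [T2Space M]

/-- The data of the concentrating functions: a function with a peak at a boundary point, and a
half-box around that point on which the geometry and the coefficients are almost constant. -/
theorem exists_peak_halfBox {K h : M → ℝ} (hK : Continuous K) (hh : ContinuousOn h (bdry M))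
    {x₀ : M} (hx₀ : x₀ ∈ bdry M) {κ η G : ℝ} (hκ : |K x₀| < κ) (hη : η < h x₀) (hG : 1 < G) :
    ∃ (ψ : M → ℝ) (t₀ r c lam : ℝ), IsSmooth ψ ∧ (∀ x, 0 ≤ ψ x) ∧ 0 < r ∧ 0 < c ∧ 0 < lam ∧
      (∀ x ∉ boxNhd x₀ t₀ r, 0 < ψ x) ∧
      (∀ y ∈ halfBox t₀ r, y ∈ (extChartAt (𝓡∂ 2) x₀).target ∧
        ψ ((extChartAt (𝓡∂ 2) x₀).symm y) = c * y 0 + (y 1 - t₀) ^ 2 ∧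
        areaDensity x₀ y ≤ c * lam ∧ lam ≤ √(metricCoeff x₀ y 1 1)) ∧
      ∀ x ∈ boxNhd x₀ t₀ r, |K x| ≤ κ ∧ ‖grad ψ x‖ ^ 2 ≤ G ∧ (x ∈ bdry M → η ≤ h x) := by
  have hsrc : x₀ ∈ (extChartAt (𝓡∂ 2) x₀).source := mem_extChartAt_source x₀
  have htgt : extChartAt (𝓡∂ 2) x₀ x₀ ∈ (extChartAt (𝓡∂ 2) x₀).target := mem_extChartAt_target x₀
  set φ := extChartAt (𝓡∂ 2) x₀ with hφ
  set t₀ : ℝ := φ x₀ 1 with ht₀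
  have hy0 : φ x₀ 0 = 0 := (mem_bdry_iff hsrc).1 hx₀
  have hy₀ : φ x₀ = linePt t₀ := eq_linePt hy0
  have hg := metricCoeff_self_pos htgt 1
  have hdet := metricDet_pos htgt
  set s : ℝ := √((1 + G) / 2) with hs
  have hs2 : s ^ 2 = (1 + G) / 2 := Real.sq_sqrt (by linarith)
  have hs1 : 1 < s := by
    rw [hs, Real.lt_sqrt (by norm_num)]; linarith
  set l : ℝ := √(metricCoeff x₀ (φ x₀) 1 1) with hl
  have hl0 : 0 < l := Real.sqrt_pos.2 hg
  have hl2 : l ^ 2 = metricCoeff x₀ (φ x₀) 1 1 := Real.sq_sqrt hg.le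
  have hd0 : 0 < areaDensity x₀ (φ x₀) := areaDensity_pos htgt
  have hd2 : areaDensity x₀ (φ x₀) ^ 2 = metricDet x₀ (φ x₀) := by
    rw [areaDensity_eq, Real.sq_sqrt hdet.le]
  set d : ℝ := areaDensity x₀ (φ x₀) with hd
  -- the slope `c` makes `|∇ψ|² = s² < G` at the peak, and leaves room for `d < c λ`, `λ < l`
  set c : ℝ := s * d / l with hc
  set lam : ℝ := l * (1 + s⁻¹) / 2 with hlam
  have hc0 : 0 < c := by positivity
  have hlam0 : 0 < lam := by positivity
  have hcl : d < c * lam := by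
    have : c * lam = d * ((s + 1) / 2) := by rw [hc, hlam]; field_simp
    rw [this]
    nlinarith
  have hll : lam < l := by
    have : s⁻¹ < 1 := inv_lt_one_of_one_lt₀ hs1
    rw [hlam]; nlinarith
  obtain ⟨ψ, hψs, hψ0, hψpos, hψev, hψg⟩ := exists_peak hx₀ hc0
  have hgrad : ‖grad ψ x₀‖ ^ 2 = (1 + G) / 2 := by
    have : ‖grad ψ x₀‖ ^ 2 * d ^ 2 = s ^ 2 * d ^ 2 := by
      rw [hd2, hψg, ← hφ, ← hl2, hc, ← hd2]
      field_simp
    rw [mul_right_cancel₀ (by positivity) this, hs2]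
  have hT : (extChartAt (𝓡∂ 2) x₀).target ∈ 𝓝[halfPlane] (φ x₀) := target_mem_nhdsWithin htgt
  have hle : 𝓝[halfPlane] (φ x₀) ≤ 𝓝[(extChartAt (𝓡∂ 2) x₀).target] (φ x₀) :=
    nhdsWithin_le_of_mem hT
  have hsymm : Tendsto φ.symm (𝓝[halfPlane] (φ x₀)) (𝓝 x₀) := by
    have := (continuousAt_extChartAt_symm (I := 𝓡∂ 2) x₀).tendsto
    rw [← hφ, φ.left_inv hsrc] at this
    exact this.mono_left nhdsWithin_le_nhds
  have ev1 : ∀ᶠ y in 𝓝[halfPlane] (φ x₀), areaDensity x₀ y < c * lam :=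
    hle ((continuousOn_areaDensity x₀ _ htgt).eventually (gt_mem_nhds hcl))
  have ev2 : ∀ᶠ y in 𝓝[halfPlane] (φ x₀), lam < √(metricCoeff x₀ y 1 1) :=
    hle (((continuousOn_metricCoeff x₀ 1 1).sqrt _ htgt).eventually (lt_mem_nhds hll))
  have ev3 : ∀ᶠ y in 𝓝[halfPlane] (φ x₀), |K (φ.symm y)| < κ :=
    hsymm.eventually (hK.abs.continuousAt.eventually (gt_mem_nhds hκ))
  have ev4 : ∀ᶠ y in 𝓝[halfPlane] (φ x₀), ‖grad ψ (φ.symm y)‖ ^ 2 < G :=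
    hsymm.eventually ((hψs.continuous_norm_grad.pow 2).continuousAt.eventually
      (gt_mem_nhds (show ‖grad ψ x₀‖ ^ 2 < G by rw [hgrad]; linarith)))
  have ev5 : ∀ᶠ y in 𝓝[halfPlane] (φ x₀), φ.symm y ∈ bdry M → η < h (φ.symm y) :=
    hsymm.eventually (eventually_nhdsWithin_iff.1 ((hh x₀ hx₀).eventually (lt_mem_nhds hη)))
  have hev : ∀ᶠ y in 𝓝[halfPlane] (linePt t₀), y ∈ φ.target ∧
      ψ (φ.symm y) = c * y 0 + (y 1 - t₀) ^ 2 ∧ areaDensity x₀ y < c * lam ∧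
      lam < √(metricCoeff x₀ y 1 1) ∧ |K (φ.symm y)| < κ ∧ ‖grad ψ (φ.symm y)‖ ^ 2 < G ∧
      (φ.symm y ∈ bdry M → η < h (φ.symm y)) := by
    rw [← hy₀]
    filter_upwards [hT, hψev, ev1, ev2, ev3, ev4, ev5] with y a1 a2 a3 a4 a5 a6 a7
    exact ⟨a1, a2, a3, a4, a5, a6, a7⟩
  obtain ⟨r, hr, hbox⟩ := exists_halfBox hev
  have hx₀W : x₀ ∈ boxNhd x₀ t₀ r := by
    refine ⟨hsrc, ?_, ?_, ?_⟩
    · show φ x₀ 0 < r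
      rw [hy0]; exact hr
    · show t₀ - r < φ x₀ 1
      linarith
    · show φ x₀ 1 < t₀ + r
      linarith
  refine ⟨ψ, t₀, r, c, lam, hψs, hψ0, hr, hc0, hlam0, fun x hx => hψpos x fun h => hx (h ▸ hx₀W),
    fun y hy => ?_, fun x hx => ?_⟩
  · obtain ⟨a1, a2, a3, a4, -⟩ := hbox y hy
    exact ⟨a1, a2, a3.le, a4.le⟩
  · obtain ⟨-, -, -, -, a5, a6, a7⟩ := hbox _ (map_mem_halfBox hx)
    have e : φ.symm (φ x) = x := φ.left_inv hx.1
    rw [← hφ, e] at a5 a7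
    have e6 : ‖grad ψ (φ.symm (φ x))‖ = ‖grad ψ x‖ := by rw [e]
    rw [← hφ, e6] at a6
    exact ⟨a5.le, a6.le, fun hb => (a7 hb).le⟩

variable [MeasurableSpace M] [BorelSpace M]

/-- Functions that concentrate at a boundary point, `f = -2 log (ρ² + ψ)` with `ρ → 0`: up to
bounded terms the three integrals are governed by one parameter `L → ∞`. -/
theorem exists_concentrating {K h : M → ℝ} (hK : Continuous K) (hh : ContinuousOn h (bdry M))
    {x₀ : M} (hx₀ : x₀ ∈ bdry M) {κ η G : ℝ} (hκ : |K x₀| < κ) (hη : η < h x₀)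
    (hG : 1 < G) : ∃ C : ℝ, ∀ R : ℝ, ∃ f : M → ℝ, IsSmooth f ∧ ∃ L : ℝ, R ≤ L ∧
      η * L - C ≤ ∫ x, h x * Real.exp (f x / 2) ∂(bdryLength M) ∧
      ∫ x, |K x| * Real.exp (f x) ∂(area M) ≤ κ * L + C ∧
      ∫ x, ‖grad f x‖ ^ 2 ∂(area M) ≤ 4 * G * L + C := by
  obtain ⟨ψ, t₀, r, c, lam, hψs, hψ0, hr, hc, hlam, hoff, hbox, hW⟩ :=
    exists_peak_halfBox hK hh hx₀ hκ hη hG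
  have hψc := hψs.continuous
  have hWo : IsOpen (boxNhd x₀ t₀ r) := isOpen_boxNhd x₀ t₀ r
  set W := boxNhd x₀ t₀ r with hWdef
  have hκ0 : 0 < κ := (abs_nonneg _).trans_lt hκ
  obtain ⟨S, hS⟩ := (hWo.isClosed_compl.isCompact).exists_bound_of_continuousOn
    (f := fun x => 1 / ψ x) (continuousOn_const.div hψc.continuousOn fun x hx => (hoff x hx).ne')
  obtain ⟨k, hk⟩ := isCompact_univ.exists_bound_of_continuousOn hK.continuousOn
  obtain ⟨H, hH⟩ := isCompact_bdry.exists_bound_of_continuousOn hh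
  obtain ⟨g, hg0, hg⟩ := exists_norm_grad_le hψs
  set α := (area M).real univ with hα
  set β := (bdryLength M).real univ with hβ
  refine ⟨|H| * |S| * β + |k| * S ^ 2 * α + 4 * g ^ 2 * S ^ 2 * α, fun R => ?_⟩
  set ρ : ℝ := min r (lam / (2 * (|R| + 1))) with hρ
  have hρ0 : 0 < ρ := lt_min hr (by positivity)
  obtain ⟨hJL, hL⟩ := integral_sq_le_integral_bdry hψc hψ0 hc hlam hbox hρ0 (min_le_left _ _)
  rw [← hWdef] at hJL hL
  have hpos : ∀ x, 0 < ρ ^ 2 + ψ x := fun x => by have := hψ0 x; positivity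
  set w : M → ℝ := fun x => 1 / (ρ ^ 2 + ψ x) with hw
  have hw0 : ∀ x, 0 < w x := fun x => one_div_pos.2 (hpos x)
  have hwc : Continuous w := continuous_const.div (continuous_const.add hψc) fun x => (hpos x).ne'
  set L := ∫ x, W.indicator w x ∂(bdryLength M) with hLdef
  have hwS : ∀ x ∉ W, w x ≤ |S| := fun x hx => by
    have h1 := hS x hx
    rw [Real.norm_of_nonneg (one_div_nonneg.2 (hψ0 x))] at h1
    refine le_trans ?_ (h1.trans (le_abs_self _))
    exact one_div_le_one_div_of_le (hoff x hx) (by linarith [sq_nonneg ρ])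
  have hwS2 : ∀ x ∉ W, w x ^ 2 ≤ S ^ 2 := fun x hx => by
    rw [← sq_abs S]; have := (hw0 x).le; gcongr; exact hwS x hx
  set f : M → ℝ := fun x => -2 * Real.log (ρ ^ 2 + ψ x) with hf
  have hfs : IsSmooth f := by
    intro x
    have h1 : ContDiffAt ℝ ∞ (fun t => -2 * Real.log (ρ ^ 2 + t)) (ψ x) :=
      contDiffAt_const.mul ((contDiffAt_const.add contDiffAt_id).log (hpos x).ne')
    exact h1.contMDiffAt.comp x (hψs x)
  have hexp2 : ∀ x, Real.exp (f x / 2) = w x := fun x => by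
    have : f x / 2 = -Real.log (ρ ^ 2 + ψ x) := by simp only [hf]; ring
    rw [this, Real.exp_neg, Real.exp_log (hpos x)]; simp only [hw, one_div]
  have hexp : ∀ x, Real.exp (f x) = w x ^ 2 := fun x => by
    rw [← hexp2, ← Real.exp_nat_mul]; congr 1; push_cast; ring
  have hgr : ∀ x, ‖grad f x‖ ^ 2 = 4 * ‖grad ψ x‖ ^ 2 * w x ^ 2 := fun x => by
    have h1 : HasDerivAt (fun t => -2 * Real.log (ρ ^ 2 + t)) (-2 * (1 / (ρ ^ 2 + ψ x))) (ψ x) :=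
      (((hasDerivAt_id (ψ x)).const_add (ρ ^ 2)).log (hpos x).ne').const_mul (-2)
    rw [grad_comp (hψs.mdifferentiableAt x) h1, norm_smul, mul_pow, Real.norm_eq_abs, sq_abs]
    ring
  have hiJ : Integrable (W.indicator fun x => w x ^ 2) (area M) :=
    (integrable_of_continuous (hwc.pow 2)).indicator hWo.measurableSet
  have hiL : Integrable (W.indicator w) (bdryLength M) :=
    (integrable_of_continuous hwc).indicator hWo.measurableSet
  -- an area integral is at most its part in the half-box plus a bounded term
  have hsplit : ∀ (q : M → ℝ) (a b : ℝ), Continuous q → 0 ≤ a → 0 ≤ b → (∀ x, 0 ≤ q x) →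
      (∀ x ∈ W, q x ≤ a) →
      (∀ x, q x ≤ b) → ∫ x, q x * w x ^ 2 ∂(area M) ≤ a * L + b * S ^ 2 * α := by
    intro q a b hq ha hb hq0 hqa hqb
    calc ∫ x, q x * w x ^ 2 ∂(area M)
        ≤ ∫ x, (a * W.indicator (fun x => w x ^ 2) x + b * S ^ 2) ∂(area M) := by
          refine integral_mono (integrable_of_continuous (hq.mul (hwc.pow 2)))
            ((hiJ.const_mul a).add (integrable_const _)) fun x => ?_
          show q x * w x ^ 2 ≤ a * W.indicator (fun x => w x ^ 2) x + b * S ^ 2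
          by_cases hx : x ∈ W
          · rw [indicator_of_mem hx]
            have := mul_le_mul_of_nonneg_right (hqa x hx) (sq_nonneg (w x))
            have : 0 ≤ b * S ^ 2 := by positivity
            linarith
          · rw [indicator_of_notMem hx, mul_zero, zero_add]
            exact mul_le_mul (hqb x) (hwS2 x hx) (sq_nonneg _) hb
      _ = a * ∫ x, W.indicator (fun x => w x ^ 2) x ∂(area M) + b * S ^ 2 * α := by
          rw [integral_add (hiJ.const_mul a) (integrable_const _), integral_const_mul]
          simp only [integral_const, smul_eq_mul, ← hα]
          ring
      _ ≤ a * L + b * S ^ 2 * α := by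
          have := mul_le_mul_of_nonneg_left hJL ha
          linarith
  have t1 : 0 ≤ |H| * |S| * β := by positivity
  have t2 : 0 ≤ |k| * S ^ 2 * α := by positivity
  have t3 : 0 ≤ 4 * g ^ 2 * S ^ 2 * α := by positivity
  refine ⟨f, hfs, L, ?_, ?_, ?_, ?_⟩
  · refine le_trans ?_ hL
    have h1 : ρ ≤ lam / (2 * (|R| + 1)) := min_le_right _ _
    rw [le_div_iff₀ (by positivity)] at h1
    rw [le_div_iff₀ (by positivity)]
    have : R * (2 * ρ) ≤ (|R| + 1) * (2 * ρ) := by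
      gcongr; linarith [le_abs_self R]
    linarith
  · simp only [hexp2]
    have hiA : Integrable (fun x => h x * w x) (bdryLength M) := by
      obtain ⟨Cw, hCw⟩ := isCompact_univ.exists_bound_of_continuousOn hwc.continuousOn
      exact (integrable_bdryLength_of_continuousOn hh).mul_bdd hwc.aestronglyMeasurable
        (ae_of_all _ fun x => hCw x (mem_univ x))
    have : η * L - |H| * |S| * β ≤ ∫ x, h x * w x ∂(bdryLength M) := by
      calc η * L - |H| * |S| * β
          = ∫ x, (η * W.indicator w x - |H| * |S|) ∂(bdryLength M) := by
            rw [integral_sub (hiL.const_mul η) (integrable_const _), integral_const_mul]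
            simp only [integral_const, smul_eq_mul, ← hβ, ← hLdef]
            ring
        _ ≤ _ := by
            refine integral_mono_ae ((hiL.const_mul η).sub (integrable_const _)) hiA ?_
            refine ae_bdryLength_of_forall fun x hx => ?_
            show η * W.indicator w x - |H| * |S| ≤ h x * w x
            by_cases hxW : x ∈ W
            · rw [indicator_of_mem hxW]
              have h1 := mul_le_mul_of_nonneg_right ((hW x hxW).2.2 hx) (hw0 x).le
              have : 0 ≤ |H| * |S| := by positivity
              linarith
            · rw [indicator_of_notMem hxW, mul_zero, zero_sub]
              have h1 : |h x| * w x ≤ |H| * |S| :=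
                mul_le_mul ((hH x hx).trans (le_abs_self _)) (hwS x hxW) (hw0 x).le (abs_nonneg _)
              have h2 := mul_le_mul_of_nonneg_right (neg_abs_le (h x)) (hw0 x).le
              linarith
    linarith
  · simp only [hexp]
    have := hsplit (fun x => |K x|) κ |k| hK.abs hκ0.le (abs_nonneg _) (fun x => abs_nonneg _)
      (fun x hx => (hW x hx).1) (fun x => (hk x (mem_univ x)).trans (le_abs_self _))
    linarith
  · simp only [hgr]
    have := hsplit (fun x => 4 * ‖grad ψ x‖ ^ 2) (4 * G) (4 * g ^ 2)
      (continuous_const.mul (hψs.continuous_norm_grad.pow 2)) (by positivity) (by positivity)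
      (fun x => by positivity) (fun x hx => by have := (hW x hx).2.1; linarith)
      (fun x => by have := hg x; gcongr)
    linarith

end

/-! ### Sharpness -/

section

variable {M : Type*} [TopologicalSpace M] [ChartedSpace (EuclideanHalfSpace 2) M]
  [RiemannianBundle (fun x : M => TangentSpace (𝓡∂ 2) x)] [CompactSpace M]
  [IsManifold (𝓡∂ 2) ∞ M]
  [IsContMDiffRiemannianBundle (𝓡∂ 2) ∞ (EuclideanSpace ℝ (Fin 2))
      (fun x : M => TangentSpace (𝓡∂ 2) x)] [T2Space M] [MeasurableSpace M] [BorelSpace M]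

theorem dirichlet_nonneg (u : M → ℝ) : 0 ≤ dirichlet u := integral_nonneg fun x => by positivity

theorem bdryInt_neg (h u : M → ℝ) : bdryInt (fun x => -h x) u = -bdryInt h u := by
  simp only [bdryInt, neg_mul, integral_neg]

/-- No constant below `h² / (4 |K|)` at a boundary point is admissible. -/
theorem not_exists_bound_of_pos {K h : M → ℝ} (hK : Continuous K) (hh : ContinuousOn h (bdry M))
    {x₀ : M} (hx₀ : x₀ ∈ bdry M) (hK0 : K x₀ ≠ 0) (hh0 : 0 < h x₀) {a : ℝ} (ha : 0 ≤ a)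
    (hlt : 4 * a * |K x₀| < h x₀ ^ 2) :
    ¬ ∃ C : ℝ, ∀ u : M → ℝ, MemH1 u →
      bdryInt h u ^ 2 / curvInt K u ≤ a * dirichlet u + C := by
  rintro ⟨C₁, hC₁⟩
  obtain ⟨s, hs, hs0⟩ : ∃ s : ℝ, (4 * a * (1 + s) * (|K x₀| + s) < (h x₀ - s) ^ 2 ∧ 0 < h x₀ - s) ∧
      0 < s := by
    have e1 : ∀ᶠ s in 𝓝 (0 : ℝ), 4 * a * (1 + s) * (|K x₀| + s) < (h x₀ - s) ^ 2 := by
      refine ContinuousAt.eventually_lt (by fun_prop) (by fun_prop) ?_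
      simpa using hlt
    have e2 : ∀ᶠ s in 𝓝 (0 : ℝ), 0 < h x₀ - s := by
      refine ContinuousAt.eventually_lt (by fun_prop) (by fun_prop) ?_
      simpa using hh0
    have e3 := (e1.and e2).filter_mono (nhdsWithin_le_nhds (s := Ioi (0 : ℝ)))
    exact (e3.and self_mem_nhdsWithin).exists
  obtain ⟨C, hC⟩ := exists_concentrating hK hh hx₀ (κ := |K x₀| + s) (η := h x₀ - s) (G := 1 + s)
    (by linarith) (by linarith) (by linarith)
  refine hs.1.not_ge ?_
  refine sq_le_of_frequently (C := C) (C' := a * C + C₁) hs.2 fun R => ?_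
  obtain ⟨f, hf, L, hL, h1, h2, h3⟩ := hC R
  refine ⟨L, bdryInt h f, hL, ?_, ?_⟩
  · rw [hf.bdryInt_eq]; exact h1
  · have hpos := curvInt_pos hf.memH1 hK hK0
    have hle := hC₁ f hf.memH1
    have h3' : a * dirichlet f ≤ a * (4 * (1 + s) * L + C) := by
      rw [hf.dirichlet_eq]; gcongr
    have hle' : bdryInt h f ^ 2 / curvInt K f ≤ 4 * a * (1 + s) * L + (a * C + C₁) := by
      linarith
    have h0 : 0 ≤ bdryInt h f ^ 2 / curvInt K f := by positivity
    rw [div_le_iff₀ hpos] at hle'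
    exact hle'.trans (mul_le_mul_of_nonneg_left h2 (h0.trans (by linarith)))

theorem not_exists_bound {K h : M → ℝ} (hK : Continuous K) (hh : ContinuousOn h (bdry M))
    {x₀ : M} (hx₀ : x₀ ∈ bdry M) (hK0 : K x₀ ≠ 0) {a : ℝ} (ha : a < quot K h x₀ ^ 2 / 4) :
    ¬ ∃ C : ℝ, ∀ u : M → ℝ, MemH1 u →
      bdryInt h u ^ 2 / curvInt K u ≤ a * dirichlet u + C := by
  rintro ⟨C, hC⟩
  have hKp : 0 < |K x₀| := abs_pos.2 hK0
  have hq : quot K h x₀ ^ 2 = h x₀ ^ 2 / |K x₀| := by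
    rw [quot, div_pow, Real.sq_sqrt (abs_nonneg _)]
  by_cases hh0 : h x₀ = 0
  · -- here `a < 0`, so the bound would make the Dirichlet integral bounded on `H¹`; the inequality
    -- for constant coefficients then contradicts its own sharpness
    have ha0 : a < 0 := by rw [hq, hh0] at ha; simpa using ha
    have hdir : ∀ u : M → ℝ, MemH1 u → dirichlet u ≤ C / (-a) := fun u hu => by
      have hpos := curvInt_pos hu hK hK0
      have h0 : 0 ≤ bdryInt h u ^ 2 / curvInt K u := by positivity
      rw [le_div_iff₀ (by linarith)]
      linarith [hC u hu]
    obtain ⟨C', hC'⟩ := exists_trace_inequality (M := M) (K := fun _ => -1) (h := fun _ => 1)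
      continuous_const continuousOn_const (fun _ _ => by norm_num) ⟨x₀, hx₀⟩ zero_le_one
      (fun _ _ => by norm_num) zero_lt_one
    refine not_exists_bound_of_pos (M := M) (K := fun _ => -1) (h := fun _ => 1) continuous_const
      continuousOn_const hx₀ (by norm_num) (by norm_num) le_rfl (by norm_num)
      ⟨(1 + 1) ^ 2 / 4 * (C / (-a)) + C', fun u hu => ?_⟩
    have := hC' u hu
    have := hdir u hu
    linarith
  · have hC0 : ∀ u : M → ℝ, MemH1 u →
        bdryInt h u ^ 2 / curvInt K u ≤ max a 0 * dirichlet u + C := fun u hu =>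
      (hC u hu).trans (by
        have := mul_le_mul_of_nonneg_right (le_max_left a 0) (dirichlet_nonneg u)
        linarith)
    have hlt : 4 * max a 0 * |K x₀| < h x₀ ^ 2 := by
      have h1 : max a 0 < h x₀ ^ 2 / |K x₀| / 4 := by
        rw [← hq]
        refine max_lt ha ?_
        rw [hq]; positivity
      have h2 := (lt_div_iff₀ (by norm_num)).1 h1
      have h3 := (lt_div_iff₀ hKp).1 h2
      linarith
    rcases lt_or_gt_of_ne hh0 with hneg | hpos
    · refine not_exists_bound_of_pos hK hh.neg hx₀ hK0 (by simpa using hneg) (le_max_right a 0)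
        (by simpa using hlt) ⟨C, fun u hu => ?_⟩
      have := hC0 u hu
      have e : bdryInt (-h) u = -bdryInt h u := bdryInt_neg h u
      rwa [e, neg_sq]
    · exact not_exists_bound_of_pos hK hh hx₀ hK0 hpos (le_max_right a 0) hlt ⟨C, hC0⟩

theorem isGreatest_quotMax {K h : M → ℝ} (hM : (bdry M).Nonempty) (hK : Continuous K)
    (hh : ContinuousOn h (bdry M)) (hK0 : ∀ x ∈ bdry M, K x ≠ 0) :
    IsGreatest ((fun x => |quot K h x|) '' bdry M) (quotMax K h) := by
  have hc : IsCompact (bdry M) := isClosed_bdry.isCompact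
  have hq : ContinuousOn (fun x => |quot K h x|) (bdry M) :=
    (hh.div hK.abs.sqrt.continuousOn fun x hx =>
      (Real.sqrt_pos.2 (abs_pos.2 (hK0 x hx))).ne').abs
  exact (hc.image_of_continuousOn hq).isGreatest_sSup (hM.image _)

end

end SurfaceTrace

end

theorem proposition4p1 {M : Type*} [TopologicalSpace M] [T2Space M] [CompactSpace M]
    [ChartedSpace (EuclideanHalfSpace 2) M] [IsManifold (𝓡∂ 2) ∞ M]
    [RiemannianBundle (fun x : M => TangentSpace (𝓡∂ 2) x)]
    [IsContMDiffRiemannianBundle (𝓡∂ 2) ∞ (EuclideanSpace ℝ (Fin 2))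
      (fun x : M => TangentSpace (𝓡∂ 2) x)]
    [MeasurableSpace M] [BorelSpace M]
    (hM : (SurfaceTrace.bdry M).Nonempty)
    (K h : M → ℝ) (hK : Continuous K) (hh : ContinuousOn h (SurfaceTrace.bdry M))
    (hK_nonpos : ∀ x, K x ≤ 0) (hK_bdry : ∀ x ∈ SurfaceTrace.bdry M, K x ≠ 0) :
    IsGreatest ((fun x => |SurfaceTrace.quot K h x|) '' SurfaceTrace.bdry M)
        (SurfaceTrace.quotMax K h) ∧
    (∀ u : M → ℝ, SurfaceTrace.MemH1 u →
      Integrable (fun x => |K x| * Real.exp (u x)) (SurfaceTrace.area M) ∧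
      Integrable (fun x => h x * Real.exp (SurfaceTrace.trace u x / 2))
        (SurfaceTrace.bdryLength M) ∧
      0 < SurfaceTrace.curvInt K u) ∧
    (∀ ε : ℝ, 0 < ε → ∃ C : ℝ, ∀ u : M → ℝ, SurfaceTrace.MemH1 u →
      SurfaceTrace.bdryInt h u ^ 2 / SurfaceTrace.curvInt K u ≤
        (SurfaceTrace.quotMax K h + ε) ^ 2 / 4 * SurfaceTrace.dirichlet u + C) ∧
    (∀ a : ℝ, a < SurfaceTrace.quotMax K h ^ 2 / 4 → ¬ ∃ C : ℝ, ∀ u : M → ℝ,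
      SurfaceTrace.MemH1 u →
      SurfaceTrace.bdryInt h u ^ 2 / SurfaceTrace.curvInt K u ≤
        a * SurfaceTrace.dirichlet u + C) := by
  have hgreat := SurfaceTrace.isGreatest_quotMax hM hK hh hK_bdry
  obtain ⟨x₀, hx₀, hmax⟩ := hgreat.1
  refine ⟨hgreat, fun u hu => ?_, fun ε hε => ?_, fun a ha => ?_⟩
  · obtain ⟨f, hf⟩ := hu.exists_isH1Limit
    obtain ⟨⟨h1, -⟩, h2, -⟩ := hf.tendsto_integrals hu hK hh
    exact ⟨h1, h2, SurfaceTrace.curvInt_pos hu hK (hK_bdry x₀ hx₀)⟩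
  · refine SurfaceTrace.exists_trace_inequality hK hh hK_bdry hM
      (by rw [← hmax]; exact abs_nonneg _) (fun x hx => ?_) hε
    have h1 : |SurfaceTrace.quot K h x| ≤ SurfaceTrace.quotMax K h := hgreat.2 ⟨x, hx, rfl⟩
    rwa [SurfaceTrace.quot, abs_div, abs_of_nonneg (Real.sqrt_nonneg _),
      div_le_iff₀ (Real.sqrt_pos.2 (abs_pos.2 (hK_bdry x hx)))] at h1
  · refine SurfaceTrace.not_exists_bound hK hh hx₀ (hK_bdry x₀ hx₀) ?_
    rwa [← hmax, sq_abs] at ha
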